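/- Proposition (Darboux theorem for regular barely-symplectic manifolds). Let $M$ be a compact smooth manifold (Hausdorff, finite-dimensional, without boundary). "Smooth" means $C^\infty$, and an $\epsilon$-dependent tensor field $T_\epsilon$, $\epsilon\in\mathbb{R}$, is called smooth if it is jointly smooth in $(m,\epsilon)\in M\times\mathbb{R}$. Let $\Omega_\epsilon$, $\epsilon\in\mathbb{R}$, be a barely-symplectic form on $M$, i.e. a smooth $\epsilon$-dependent $2$-form such that $\mathbf{d}\Omega_\epsilon=0$ for every $\epsilon\in\mathbb{R}$ and $\Omega_\epsilon$ is non-degenerate for every $\epsilon\neq 0$. For $\epsilon\ne 0$ let $\mathcal{J}_\epsilon$ be the Poisson bivector obtained by inverting $\Omega_\epsilon$, i.e. $\mathcal{J}_\epsilon(\iota_X\Omega_\epsilon,\beta)=-\beta(X)$ for all tangent vectors $X$ and covectors $\beta$ at the same point. Assume that $\Omega_\epsilon$ is regular with degeneracy index $d$, i.e. $d$ is the smallest non-negative integer for which there is a smooth $\epsilon$-dependent bivector $j_\epsilon$, $\epsilon\in\mathbb{R}$, with $\mathcal{J}_\epsilon=\epsilon^{-d}j_\epsilon$ for all $\epsilon\neq0$.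 Assume moreover that the de Rham cohomology classes satisfy $[\Omega_\epsilon]=[\Omega_0]$ for every $\epsilon\in\mathbb{R}$. Set $$\Omega_\epsilon^{(d)}=\sum_{k=0}^{d}\epsilon^k\,\Omega_k,\qquad \Omega_k=\frac{1}{k!}\frac{\partial^k}{\partial\epsilon^k}\Omega_\epsilon\Big|_{\epsilon=0}.$$ Then there exist $\epsilon_0>0$ and a smooth $\epsilon$-dependent diffeomorphism $\Psi_\epsilon:M\to M$, $\epsilon\in[-\epsilon_0,\epsilon_0]$ (each $\Psi_\epsilon$ is a diffeomorphism of $M$ and $(m,\epsilon)\mapsto\Psi_\epsilon(m)$ is smooth on $M\times[-\epsilon_0,\epsilon_0]$), such that $$\Psi_\epsilon^*\Omega_\epsilon=\Omega_\epsilon^{(d)}\qquad\text{for all }\epsilon\in[-\epsilon_0,\epsilon_0].$$ -/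

import Mathlib

open scoped Manifold ContDiff

namespace BarelySymplectic

noncomputable section

/-- A (not necessarily smooth) differential `k`-form on a manifold `M` modelled on `E`:
an alternating `k`-linear form on each tangent space. -/
abbrev DiffForm (E : Type*) [NormedAddCommGroup E] [NormedSpace ℝ E]
    (M : Type*) [TopologicalSpace M] [ChartedSpace E M] (k : ℕ) :=
  (x : M) → TangentSpace 𝓘(ℝ, E) x [⋀^Fin k]→L[ℝ] ℝ

/-- A (not necessarily smooth) bivector field on `M`. For finite-dimensional `E`, an element of
`Λ² T_xM` is the same thing as an alternating bilinear form on the cotangent space `T_x^*M`. -/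
abbrev BivectorField (E : Type*) [NormedAddCommGroup E] [NormedSpace ℝ E]
    (M : Type*) [TopologicalSpace M] [ChartedSpace E M] :=
  (x : M) → (TangentSpace 𝓘(ℝ, E) x →L[ℝ] ℝ) [⋀^Fin 2]→L[ℝ] ℝ

variable {E : Type*} [NormedAddCommGroup E] [NormedSpace ℝ E]
  {M : Type*} [TopologicalSpace M] [ChartedSpace E M]

/-- The expression of a form in the chart at `x₀`: its pullback by the inverse of the chart.
It is meaningful on the (open) target of the chart. -/
def DiffForm.inChart {k : ℕ} (σ : DiffForm E M k) (x₀ : M) (y : E) : E [⋀^Fin k]→L[ℝ] ℝ :=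
  (σ ((chartAt E x₀).symm y)).compContinuousLinearMap
    (mfderiv 𝓘(ℝ, E) 𝓘(ℝ, E) (chartAt E x₀).symm y)

/-- The expression of a bivector field in the chart at `x₀`: its pushforward by the chart.
It is meaningful on the (open) target of the chart. -/
def BivectorField.inChart (π : BivectorField E M) (x₀ : M) (y : E) :
    (E →L[ℝ] ℝ) [⋀^Fin 2]→L[ℝ] ℝ :=
  (π ((chartAt E x₀).symm y)).compContinuousLinearMap
    (ContinuousLinearMap.precomp ℝ
      (mfderiv 𝓘(ℝ, E) 𝓘(ℝ, E) (chartAt E x₀) ((chartAt E x₀).symm y)))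

/-- A form is smooth if it is smooth in charts. -/
def DiffForm.IsSmooth {k : ℕ} (σ : DiffForm E M k) : Prop :=
  ∀ x₀ : M, ContDiffOn ℝ ∞ (σ.inChart x₀) (chartAt E x₀).target

/-- A smooth `ε`-dependent form, `ε ∈ ℝ`: in charts it is smooth jointly in the point and in `ε`. -/
def IsSmoothFormFamily {k : ℕ} (σ : ℝ → DiffForm E M k) : Prop :=
  ∀ x₀ : M, ContDiffOn ℝ ∞ (fun p : E × ℝ ↦ (σ p.2).inChart x₀ p.1)
    ((chartAt E x₀).target ×ˢ Set.univ)

/-- A smooth `ε`-dependent bivector field, `ε ∈ ℝ`: in charts it is smooth jointly in the point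
and in `ε`. -/
def IsSmoothBivectorFamily (j : ℝ → BivectorField E M) : Prop :=
  ∀ x₀ : M, ContDiffOn ℝ ∞ (fun p : E × ℝ ↦ (j p.2).inChart x₀ p.1)
    ((chartAt E x₀).target ×ˢ Set.univ)

/-- The exterior derivative of a form on `M`: at `x`, it is computed in the chart at `x` and
pulled back to the tangent space at `x`. -/
def DiffForm.d {k : ℕ} (σ : DiffForm E M k) : DiffForm E M (k + 1) := fun x ↦
  (extDeriv (σ.inChart x) (chartAt E x x)).compContinuousLinearMap
    (mfderiv 𝓘(ℝ, E) 𝓘(ℝ, E) (chartAt E x) x)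

/-- The pullback of a form by a map. -/
def DiffForm.pullback {k : ℕ} (f : M → M) (σ : DiffForm E M k) : DiffForm E M k := fun x ↦
  (σ (f x)).compContinuousLinearMap (mfderiv 𝓘(ℝ, E) 𝓘(ℝ, E) f x)

/-- Two closed forms `σ`, `η` define the same de Rham class: `σ - η` is the exterior derivative
of a smooth form. -/
def DiffForm.SameDeRhamClass {k : ℕ} (σ η : DiffForm E M (k + 1)) : Prop :=
  ∃ α : DiffForm E M k, α.IsSmooth ∧ σ - η = α.d

/-- Non-degeneracy of a `2`-form at every point. -/
def DiffForm.IsNondegenerate (σ : DiffForm E M 2) : Prop :=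
  ∀ (x : M) (v : TangentSpace 𝓘(ℝ, E) x), (∀ w : TangentSpace 𝓘(ℝ, E) x, σ x ![v, w] = 0) → v = 0

/-- A barely-symplectic form: a smooth `ε`-dependent closed `2`-form `Ω ε`, `ε ∈ ℝ`, that is
non-degenerate (hence symplectic) for `ε ≠ 0`. -/
structure IsBarelySymplectic (Ω : ℝ → DiffForm E M 2) : Prop where
  smooth : IsSmoothFormFamily Ω
  closed : ∀ ε : ℝ, (Ω ε).d = 0
  nondegenerate : ∀ ε : ℝ, ε ≠ 0 → (Ω ε).IsNondegenerate

/-- `π` is the Poisson bivector that inverts the `2`-form `σ`. With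
`σ̂ : TM → T^*M, X ↦ σ(X, ·)` and `π̂ : T^*M → TM, β(π̂ α) = π(α, β)`, this says
`-π̂ ∘ σ̂ = id`, that is, `π(σ̂ X, β) = -β(X)`. -/
def IsPoissonBivectorOf (π : BivectorField E M) (σ : DiffForm E M 2) : Prop :=
  ∀ (x : M) (X : TangentSpace 𝓘(ℝ, E) x) (σX β : TangentSpace 𝓘(ℝ, E) x →L[ℝ] ℝ),
    (∀ Y : TangentSpace 𝓘(ℝ, E) x, σX Y = σ x ![X, Y]) → π x ![σX, β] = -β X

/-- For `ε ≠ 0` the Poisson bivector of `Ω ε` is `ε⁻ᵈ j ε`, where `j` is a smooth `ε`-dependent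
bivector field (defined for all `ε ∈ ℝ`). -/
def HasSingularityOfOrder (Ω : ℝ → DiffForm E M 2) (d : ℕ) : Prop :=
  ∃ j : ℝ → BivectorField E M, IsSmoothBivectorFamily j ∧
    ∀ ε : ℝ, ε ≠ 0 → IsPoissonBivectorOf ((ε ^ d)⁻¹ • j ε) (Ω ε)

/-- `Ω` is regular with degeneracy index `d`: `d` is the smallest admissible exponent. -/
def IsRegularWithIndex (Ω : ℝ → DiffForm E M 2) (d : ℕ) : Prop :=
  IsLeast {n : ℕ | HasSingularityOfOrder Ω n} d

/-- The coefficient `Ω_k = (1 / k!) (∂/∂ε)ᵏ Ω_ε |_{ε = 0}` of the power series expansion of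
`Ω_ε` in `ε`. The derivatives are those of the curve `ε ↦ Ω ε x` in the finite-dimensional space
of alternating forms on `T_xM`. -/
def powerCoeff {k : ℕ} (Ω : ℝ → DiffForm E M k) (n : ℕ) : DiffForm E M k := fun x ↦
  (n.factorial : ℝ)⁻¹ •
    iteratedDeriv (F := E [⋀^Fin k]→L[ℝ] ℝ) n (fun ε ↦ Ω ε x) 0

/-- The truncation `Ω_0 + ε Ω_1 + ⋯ + εᵈ Ω_d` of the power series expansion. -/
def truncation {k : ℕ} (Ω : ℝ → DiffForm E M k) (d : ℕ) (ε : ℝ) : DiffForm E M k :=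
  ∑ n ∈ Finset.range (d + 1), ε ^ n • powerCoeff Ω n

end

end BarelySymplectic

open BarelySymplectic

/-! The proof is Moser's deformation argument, arranged so that the singularity of the inverse of
`Ω_ε` at `ε = 0` cancels. Taylor's formula with smooth remainder gives `Ω_ε = Ω_ε^(d) + ε^(d+1)
R_ε`, and the path `σ_t = Ω_ε - (1 - t) ε^(d+1) R_ε` joins the truncation (`t = 0`) to `Ω_ε` (`t =
1`). If `R_ε = dθ_ε` and `σ_t(X_t, ·) = -ε^(d+1) θ_ε`, the time-one map of the flow of `X_t` pulls
`Ω_ε` back to the truncation (`moser_pullback`, `LocalFlow.pullback_eq`).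

Viewed as linear maps, `j_ε Ω_ε = -ε^d`, hence `j_ε σ_t = -ε^d (1 + (1 - t) ε j_ε R_ε)`. The bracket
is close to the identity for small `ε`, so `X_t = ε (1 + (1 - t) ε j_ε R_ε)⁻¹ j_ε θ_ε` is jointly
smooth and solves the equation (`sharp_flat_sub`, `flat_sub_eq`, `exists_moserField`). Of the `d +
1` powers of `ε` in the remainder, `d` pay for the singularity and the last one makes the field
small, so its flow reaches time one.

The cohomological hypothesis provides a primitive of `Ω_ε - Ω_0` for each `ε` separately. A Čech–de
Rham argument on a finite cover by coordinate balls replaces these by a smooth family `α_ε`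
(`exists_cocycle`, `exists_smooth_family_primitive`). Dividing by `ε` repeatedly, after subtracting
the value at `0` each time, turns `α` into `θ` (`d_quot_iterate`).

The flow is built in charts: orbits are fixed points of a contraction on a space of continuous paths
and depend smoothly on parameters by the implicit function theorem (`exists_smooth_flow`). For small
`ε` orbits starting in a small ball stay in a larger one, so uniqueness for ODEs patches the local
flows (`LocalFlow.eq_of_curve`), and the reversed field gives the inverse. -/

namespace BarelySymplectic

noncomputable section

open Set Filter Topology

/-! ### Smoothness of superposition operators on spaces of continuous maps. -/

section Superposition

set_option linter.unusedSectionVars false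

universe u

variable {K : Type*} [TopologicalSpace K] [CompactSpace K]
  {X : Type u} [NormedAddCommGroup X] [NormedSpace ℝ X]

open Classical in
/-- The superposition operator `z ↦ f ∘ z` on continuous maps (`0` where `f ∘ z` is not
continuous). -/
def superpose (K : Type*) [TopologicalSpace K] {X G : Type*} [TopologicalSpace X]
    [TopologicalSpace G] [Zero G] (f : X → G) (z : C(K, X)) : C(K, G) :=
  if h : Continuous (f ∘ z) then ⟨f ∘ z, h⟩ else 0

theorem superpose_apply {X G : Type*} [TopologicalSpace X] [TopologicalSpace G] [Zero G]
    {f : X → G} {O : Set X} (hf : ContinuousOn f O) {z : C(K, X)} (hz : ∀ k, z k ∈ O) (k : K) :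
    superpose K f z k = f (z k) := by
  have h : Continuous (f ∘ z) := hf.comp_continuous z.continuous hz
  simp [superpose, h]

/-- The set of continuous maps with values in an open set. -/
def mapsInto (K : Type*) [TopologicalSpace K] {X : Type*} [TopologicalSpace X] (O : Set X) :
    Set C(K, X) := {z | ∀ k, z k ∈ O}

theorem isOpen_mapsInto {X : Type*} [TopologicalSpace X] {O : Set X} (hO : IsOpen O) :
    IsOpen (mapsInto K O) := by
  have := ContinuousMap.isOpen_setOfPred_mapsTo (X := K) (Y := X) isCompact_univ hO
  simpa [mapsInto, MapsTo] using this

/-- Pointwise application of a continuous family of operators to a continuous map. -/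
def pointwiseApply (K : Type*) [TopologicalSpace K] [CompactSpace K] (X G : Type*)
    [NormedAddCommGroup X] [NormedSpace ℝ X] [NormedAddCommGroup G] [NormedSpace ℝ G] :
    C(K, X →L[ℝ] G) →L[ℝ] C(K, X) →L[ℝ] C(K, G) :=
  LinearMap.mkContinuous₂
    (LinearMap.mk₂ ℝ (fun (A : C(K, X →L[ℝ] G)) (h : C(K, X)) ↦
      (⟨fun k ↦ A k (h k), A.continuous.clm_apply h.continuous⟩ : C(K, G)))
      (fun _ _ _ ↦ by ext; simp) (fun _ _ _ ↦ by ext; simp) (fun _ _ _ ↦ by ext; simp)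
      (fun _ _ _ ↦ by ext; simp)) 1
    (fun A h ↦ by
      rw [ContinuousMap.norm_le _ (by positivity)]
      intro k
      simp only [LinearMap.mk₂_apply, ContinuousMap.coe_mk, one_mul]
      exact (A k).le_of_opNorm_le_of_le (A.norm_coe_le_norm k) (h.norm_coe_le_norm k))

@[simp]
theorem pointwiseApply_apply {G : Type*} [NormedAddCommGroup G] [NormedSpace ℝ G]
    (A : C(K, X →L[ℝ] G)) (h : C(K, X)) (k : K) :
    pointwiseApply K X G A h k = A k (h k) := rfl

/-- Near each point `k` the estimate holds for all nearby maps and points at once; compactness of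
`K` makes it uniform in `k`, which is closeness in the sup norm. -/
theorem continuousOn_superpose {X G : Type*} [NormedAddCommGroup X] [NormedAddCommGroup G]
    {f : X → G} {O : Set X} (hO : IsOpen O) (hf : ContinuousOn f O) :
    ContinuousOn (superpose K f) (mapsInto K O) := by
  intro z hz
  refine ContinuousAt.continuousWithinAt ?_
  rw [ContinuousAt, Metric.tendsto_nhds]
  intro η hη
  have key : ∀ k ∈ (univ : Set K), ∀ᶠ q : C(K, X) × K in 𝓝 z ×ˢ 𝓝 k,
      dist (f (q.1 q.2)) (f (z q.2)) < η / 2 := by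
    intro k _
    have h1 : Tendsto (fun q : C(K, X) × K ↦ q.1 q.2) (𝓝 z ×ˢ 𝓝 k) (𝓝 (z k)) := by
      rw [← nhds_prod_eq]
      exact (ContinuousEval.continuous_eval.tendsto (z, k))
    have h2 : Tendsto (fun q : C(K, X) × K ↦ z q.2) (𝓝 z ×ˢ 𝓝 k) (𝓝 (z k)) :=
      (z.continuous.tendsto k).comp tendsto_snd
    have hc := (hf.continuousAt (hO.mem_nhds (hz k))).tendsto
    have := (hc.comp h1).dist (hc.comp h2)
    rw [dist_self] at this
    exact this.eventually_lt_const (by positivity)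
  have key2 := isCompact_univ.eventually_forall_of_forall_eventually
    (P := fun (q : C(K, X)) (k : K) ↦ dist (f (q k)) (f (z k)) < η / 2)
    (fun k hk ↦ by rw [nhds_prod_eq]; exact key k hk)
  filter_upwards [key2, (isOpen_mapsInto hO).mem_nhds hz] with w hw hwO
  refine lt_of_le_of_lt ((ContinuousMap.dist_le (by positivity)).2 fun k ↦ ?_) (half_lt_self hη)
  rw [superpose_apply hf hwO, superpose_apply hf hz]
  exact (hw k (mem_univ k)).le

theorem hasFDerivAt_superpose {G : Type*} [NormedAddCommGroup G] [NormedSpace ℝ G]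
    {f : X → G} {O : Set X} (hO : IsOpen O) (hf : ContDiffOn ℝ 1 f O) {z : C(K, X)}
    (hz : z ∈ mapsInto K O) :
    HasFDerivAt (superpose K f) (pointwiseApply K X G (superpose K (fderiv ℝ f) z)) z := by
  have hf' : ContinuousOn (fderiv ℝ f) O := hf.continuousOn_fderiv_of_isOpen hO (le_refl _)
  rw [hasFDerivAt_iff_isLittleO_nhds_zero, Asymptotics.isLittleO_iff]
  intro η hη
  have key : ∀ k ∈ (univ : Set K), ∀ᶠ q : C(K, X) × K in 𝓝 0 ×ˢ 𝓝 k,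
      ‖f (z q.2 + q.1 q.2) - f (z q.2) - fderiv ℝ f (z q.2) (q.1 q.2)‖ ≤ η * ‖q.1 q.2‖ := by
    intro k _
    have hk : O ∈ 𝓝 (z k) := hO.mem_nhds (hz k)
    have h1 : Tendsto (fun q : C(K, X) × K ↦ q.1 q.2) (𝓝 0 ×ˢ 𝓝 k) (𝓝 0) := by
      rw [← nhds_prod_eq]
      exact (ContinuousEval.continuous_eval.tendsto ((0 : C(K, X)), k))
    have h2 : Tendsto (fun q : C(K, X) × K ↦ z q.2) (𝓝 0 ×ˢ 𝓝 k) (𝓝 (z k)) :=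
      (z.continuous.tendsto k).comp tendsto_snd
    have h3 : Tendsto (fun q : C(K, X) × K ↦ z q.2 + q.1 q.2) (𝓝 0 ×ˢ 𝓝 k) (𝓝 (z k)) := by
      simpa using h2.add h1
    -- Strict differentiability is needed because the base point `z q.2` moves with `q`. Half of `η`
    -- bounds the remainder taken with the derivative at `z k`, the other half the change of
    -- derivative from `z k` to `z q.2`.
    have hs : HasStrictFDerivAt f (fderiv ℝ f (z k)) (z k) :=
      (hf.contDiffAt hk).hasStrictFDerivAt one_ne_zero
    have hs' := (Asymptotics.isLittleO_iff.1 hs.isLittleO) (half_pos hη)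
    have e1 := (h3.prodMk_nhds h2).eventually hs'
    have e2 : ∀ᶠ q : C(K, X) × K in 𝓝 0 ×ˢ 𝓝 k,
        dist (fderiv ℝ f (z q.2)) (fderiv ℝ f (z k)) < η / 2 :=
      h2.eventually (Metric.tendsto_nhds.1 (hf'.continuousAt hk).tendsto _ (half_pos hη))
    filter_upwards [e1, e2] with q h4 h5
    simp only [add_sub_cancel_left] at h4
    have h6 : ‖(fderiv ℝ f (z k) - fderiv ℝ f (z q.2)) (q.1 q.2)‖ ≤ η / 2 * ‖q.1 q.2‖ := by
      refine ContinuousLinearMap.le_of_opNorm_le _ ?_ _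
      rw [← dist_eq_norm, dist_comm]
      exact h5.le
    calc _ = ‖(f (z q.2 + q.1 q.2) - f (z q.2) - fderiv ℝ f (z k) (q.1 q.2)) +
          (fderiv ℝ f (z k) - fderiv ℝ f (z q.2)) (q.1 q.2)‖ := by
            congr 1
            simp
      _ ≤ _ := (norm_add_le _ _).trans (by linarith)
  have key2 := isCompact_univ.eventually_forall_of_forall_eventually
    (P := fun (q : C(K, X)) (k : K) ↦
      ‖f (z k + q k) - f (z k) - fderiv ℝ f (z k) (q k)‖ ≤ η * ‖q k‖)
    (fun k hk ↦ by rw [nhds_prod_eq]; exact key k hk)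
  have hadd : Tendsto (fun h : C(K, X) ↦ z + h) (𝓝 0) (𝓝 z) := by
    simpa using (tendsto_const_nhds (x := z)).add (tendsto_id (x := 𝓝 (0 : C(K, X))))
  filter_upwards [key2, hadd ((isOpen_mapsInto hO).mem_nhds hz)] with h hh hhO
  rw [ContinuousMap.norm_le _ (by positivity)]
  intro k
  have e : ∀ k, superpose K f (z + h) k = f (z k + h k) := superpose_apply hf.continuousOn hhO
  simp only [ContinuousMap.sub_apply, pointwiseApply_apply, e,
    superpose_apply hf.continuousOn hz, superpose_apply hf' hz]
  exact (hh k (mem_univ k)).trans (by gcongr; exact h.norm_coe_le_norm k)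

/-- The derivative of a superposition operator is the superposition operator of `fderiv ℝ f`,
followed by the bounded linear map `pointwiseApply`. The induction therefore runs over all target
spaces. -/
theorem contDiffOn_superpose_nat (n : ℕ) {G : Type u} [NormedAddCommGroup G] [NormedSpace ℝ G]
    {f : X → G} {O : Set X} (hO : IsOpen O) (hf : ContDiffOn ℝ n f O) :
    ContDiffOn ℝ n (superpose K f) (mapsInto K O) := by
  induction n generalizing G with
  | zero =>
    exact contDiffOn_zero.2 (continuousOn_superpose hO hf.continuousOn)
  | succ n ih =>
    push_cast at hf ⊢
    have h1 : ContDiffOn ℝ 1 f O := hf.of_le (by simp)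
    rw [contDiffOn_succ_iff_hasFDerivWithinAt_of_uniqueDiffOn (isOpen_mapsInto hO).uniqueDiffOn]
    refine ⟨by simp, fun z ↦ pointwiseApply K X G (superpose K (fderiv ℝ f) z), ?_,
      fun z hz ↦ (hasFDerivAt_superpose hO h1 hz).hasFDerivWithinAt⟩
    exact (pointwiseApply K X G).contDiff.comp_contDiffOn
      (ih (((contDiffOn_succ_iff_fderiv_of_isOpen hO).1 hf).2.2))

theorem contDiffOn_superpose {G : Type u} [NormedAddCommGroup G] [NormedSpace ℝ G]
    {f : X → G} {O : Set X} (hO : IsOpen O) (hf : ContDiffOn ℝ ∞ f O) :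
    ContDiffOn ℝ ∞ (superpose K f) (mapsInto K O) :=
  contDiffOn_infty.2 fun n ↦ contDiffOn_superpose_nat n hO (contDiffOn_infty.1 hf n)

end Superposition

/-! ### Integrals depending smoothly on a parameter. -/

section ParametricIntegral

set_option linter.unusedSectionVars false

universe u

variable {P : Type u} [NormedAddCommGroup P] [NormedSpace ℝ P]
  {G : Type u} [NormedAddCommGroup G] [NormedSpace ℝ G]

/-- Integration of a continuous function over the unit interval, up to the time `s`. -/
def primitiveCLM (G : Type*) [NormedAddCommGroup G] [NormedSpace ℝ G] :
    C(Icc (0 : ℝ) 1, G) →L[ℝ] C(Icc (0 : ℝ) 1, G) :=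
  LinearMap.mkContinuous
    { toFun := fun z ↦ ⟨fun s ↦ ∫ t in (0 : ℝ)..s, IccExtend zero_le_one z t, by
        have := intervalIntegral.continuous_primitive (μ := MeasureTheory.volume)
          (f := IccExtend zero_le_one z)
          (fun a b ↦ (z.continuous.Icc_extend').intervalIntegrable a b) 0
        exact this.comp continuous_subtype_val⟩
      map_add' := fun z w ↦ by
        ext s
        exact intervalIntegral.integral_add ((z.continuous.Icc_extend').intervalIntegrable _ _)
          ((w.continuous.Icc_extend').intervalIntegrable _ _)
      map_smul' := fun c z ↦ by
        ext s
        exact intervalIntegral.integral_smul c _ } 1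
    (fun z ↦ by
      rw [ContinuousMap.norm_le _ (by positivity)]
      intro s
      have := intervalIntegral.norm_integral_le_of_norm_le_const (a := 0) (b := (s : ℝ))
        (f := IccExtend zero_le_one z) (C := ‖z‖)
        (fun t _ ↦ z.norm_coe_le_norm (projIcc 0 1 zero_le_one t))
      rw [one_mul]
      refine this.trans ?_
      rw [sub_zero, abs_of_nonneg s.2.1]
      exact mul_le_of_le_one_right (norm_nonneg _) s.2.2)

theorem primitiveCLM_apply (z : C(Icc (0 : ℝ) 1, G)) (s : Icc (0 : ℝ) 1) :
    primitiveCLM G z s = ∫ t in (0 : ℝ)..s, IccExtend zero_le_one z t := rfl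

theorem norm_primitiveCLM_le : ‖primitiveCLM G‖ ≤ 1 :=
  LinearMap.mkContinuous_norm_le _ zero_le_one _

theorem primitiveCLM_apply_eq {z : C(Icc (0 : ℝ) 1, G)} {w : ℝ → G} (s : Icc (0 : ℝ) 1)
    (h : ∀ t : Icc (0 : ℝ) 1, z t = w t) : primitiveCLM G z s = ∫ t in (0 : ℝ)..s, w t := by
  rw [primitiveCLM_apply]
  refine intervalIntegral.integral_congr fun t ht ↦ ?_
  rw [uIcc_of_le s.2.1] at ht
  have ht' : t ∈ Icc (0 : ℝ) 1 := ⟨ht.1, ht.2.trans s.2.2⟩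
  rw [IccExtend_of_mem _ _ ht', h]

/-- The path `t ↦ (p, t)`, depending affinely on `p`. -/
def levelPath (p : P) : C(Icc (0 : ℝ) 1, P × ℝ) := ⟨fun t ↦ (p, t), by fun_prop⟩

theorem hasFDerivAt_levelPath (p : P) :
    HasFDerivAt (levelPath (P := P))
      ((ContinuousLinearMap.inl ℝ P ℝ).compLeftContinuous ℝ (Icc (0 : ℝ) 1) ∘L
        ContinuousLinearMap.const ℝ (Icc (0 : ℝ) 1)) p := by
  have : (levelPath (P := P)) = fun p ↦
      ((ContinuousLinearMap.inl ℝ P ℝ).compLeftContinuous ℝ (Icc (0 : ℝ) 1) ∘L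
        ContinuousLinearMap.const ℝ (Icc (0 : ℝ) 1)) p + levelPath 0 := by
    ext p t <;> simp [levelPath]
  rw [this]
  exact (ContinuousLinearMap.hasFDerivAt _).add_const _

theorem contDiff_levelPath : ContDiff ℝ ∞ (levelPath (P := P)) := by
  have : (levelPath (P := P)) = fun p ↦
      ((ContinuousLinearMap.inl ℝ P ℝ).compLeftContinuous ℝ (Icc (0 : ℝ) 1) ∘L
        ContinuousLinearMap.const ℝ (Icc (0 : ℝ) 1)) p + levelPath 0 := by
    ext p t <;> simp [levelPath]
  rw [this]
  exact (ContinuousLinearMap.contDiff _).add contDiff_const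

theorem integral_eq_primitiveCLM {F : P × ℝ → G} {O : Set (P × ℝ)} (hF : ContinuousOn F O) {p : P}
    (hp : ∀ t ∈ Icc (0 : ℝ) 1, (p, t) ∈ O) :
    ∫ t in (0 : ℝ)..1, F (p, t) =
      primitiveCLM G (superpose (Icc (0 : ℝ) 1) F (levelPath p)) 1 :=
  (primitiveCLM_apply_eq (w := fun t ↦ F (p, t)) 1
    (fun t ↦ superpose_apply hF (z := levelPath p) (fun k ↦ hp k k.2) t)).symm

/-- The integral is the composition of the affine map `levelPath`, a superposition operator and a
continuous linear functional, so its smoothness needs no domination estimates. -/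
theorem contDiffOn_integral {F : P × ℝ → G} {O : Set (P × ℝ)} (hO : IsOpen O)
    (hF : ContDiffOn ℝ ∞ F O) {U : Set P} (hU : ∀ p ∈ U, ∀ t ∈ Icc (0 : ℝ) 1, (p, t) ∈ O) :
    ContDiffOn ℝ ∞ (fun p ↦ ∫ t in (0 : ℝ)..1, F (p, t)) U := by
  refine ContDiffOn.congr (f := fun p ↦
    (ContinuousMap.evalCLM ℝ (1 : Icc (0 : ℝ) 1) ∘L primitiveCLM G)
      (superpose (Icc (0 : ℝ) 1) F (levelPath p))) ?_
    (fun p hp ↦ integral_eq_primitiveCLM hF.continuousOn (hU p hp))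
  exact (ContinuousLinearMap.contDiff _).comp_contDiffOn
    ((contDiffOn_superpose hO hF).comp contDiff_levelPath.contDiffOn
      (fun p hp k ↦ hU p hp k k.2))

theorem hasFDerivAt_integral {F : P × ℝ → G} {O : Set (P × ℝ)} (hO : IsOpen O)
    (hF : ContDiffOn ℝ ∞ F O) {U : Set P} (hUo : IsOpen U)
    (hU : ∀ p ∈ U, ∀ t ∈ Icc (0 : ℝ) 1, (p, t) ∈ O) {p : P} (hp : p ∈ U) :
    DifferentiableAt ℝ (fun p ↦ ∫ t in (0 : ℝ)..1, F (p, t)) p ∧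
    ∀ v, fderiv ℝ (fun p ↦ ∫ t in (0 : ℝ)..1, F (p, t)) p v =
      ∫ t in (0 : ℝ)..1, fderiv ℝ F (p, t) (v, 0) := by
  have h1 : ContDiffOn ℝ 1 F O := hF.of_le (by simp)
  have hmem : levelPath p ∈ mapsInto (Icc (0 : ℝ) 1) O := fun k ↦ hU p hp k k.2
  have hd := ((ContinuousMap.evalCLM ℝ (1 : Icc (0 : ℝ) 1) ∘L
    primitiveCLM G).hasFDerivAt.comp p
      ((hasFDerivAt_superpose hO h1 hmem).comp p (hasFDerivAt_levelPath p)))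
  have he : (fun p ↦ ∫ t in (0 : ℝ)..1, F (p, t)) =ᶠ[𝓝 p] ((ContinuousMap.evalCLM ℝ
      (1 : Icc (0 : ℝ) 1) ∘L primitiveCLM G) ∘ superpose (Icc (0 : ℝ) 1) F ∘ levelPath) := by
    filter_upwards [hUo.mem_nhds hp] with q hq
    exact integral_eq_primitiveCLM hF.continuousOn (hU q hq)
  have hd' := hd.congr_of_eventuallyEq he
  refine ⟨hd'.differentiableAt, fun v ↦ ?_⟩
  rw [hd'.fderiv]
  refine primitiveCLM_apply_eq (w := fun t ↦ fderiv ℝ F (p, t) (v, 0)) 1 fun t ↦ ?_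
  have hc : ContinuousOn (fderiv ℝ F) O := h1.continuousOn_fderiv_of_isOpen hO (le_refl _)
  have e : superpose (Icc (0 : ℝ) 1) (fderiv ℝ F) (levelPath p) t = fderiv ℝ F (p, t) :=
    superpose_apply hc hmem t
  change superpose (Icc (0 : ℝ) 1) (fderiv ℝ F) (levelPath p) t (v, 0) = _
  rw [e]

end ParametricIntegral

/-! ### Hadamard's lemma. -/

section Hadamard

universe u

variable {E : Type u} [NormedAddCommGroup E] [NormedSpace ℝ E]
  {G : Type u} [NormedAddCommGroup G] [NormedSpace ℝ G] [CompleteSpace G]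

/-- **Hadamard's lemma** with parameters. -/
theorem contDiffOn_dslope {f : E × ℝ → G} {U : Set E} (hU : IsOpen U)
    (hf : ContDiffOn ℝ ∞ f (U ×ˢ univ)) :
    ContDiffOn ℝ ∞ (fun p : E × ℝ ↦ dslope (fun ε ↦ f (p.1, ε)) 0 p.2) (U ×ˢ univ) := by
  have hO : IsOpen (U ×ˢ (univ : Set ℝ)) := hU.prod isOpen_univ
  -- By the fundamental theorem of calculus `f(x, ε) - f(x, 0) = ε ∫₀¹ ∂_ε f(x, tε) dt`, so the
  -- slope is the integral of `F` over `t`, also at `ε = 0`.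
  set F : (E × ℝ) × ℝ → G := fun q ↦ fderiv ℝ f (q.1.1, q.2 * q.1.2) (0, 1) with hFdef
  have hF : ContDiffOn ℝ ∞ F ((U ×ˢ univ) ×ˢ univ) := by
    have h1 : ContDiffOn ℝ ∞ (fderiv ℝ f) (U ×ˢ univ) :=
      ((contDiffOn_infty_iff_fderiv_of_isOpen hO).1 hf).2
    have h2 : ContDiff ℝ ∞ (fun q : (E × ℝ) × ℝ ↦ (q.1.1, q.2 * q.1.2)) := by fun_prop
    have h3 := h1.comp h2.contDiffOn (s := (U ×ˢ univ) ×ˢ univ) (fun q hq ↦ ⟨hq.1.1, mem_univ _⟩)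
    exact h3.clm_apply contDiffOn_const
  refine (contDiffOn_integral (hO.prod isOpen_univ) hF (U := U ×ˢ univ)
    (fun p hp t _ ↦ ⟨hp, mem_univ _⟩)).congr ?_
  rintro ⟨x, ε⟩ ⟨hx, -⟩
  have hder : ∀ s : ℝ, HasDerivAt (fun ε ↦ f (x, ε)) (fderiv ℝ f (x, s) (0, 1)) s := by
    intro s
    have : DifferentiableAt ℝ f (x, s) :=
      (hf.contDiffAt (hO.mem_nhds (mk_mem_prod hx (mem_univ s)))).differentiableAt (by simp)
    exact HasFDerivAt.comp_hasDerivAt (f := fun s ↦ (x, s)) s this.hasFDerivAt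
      ((hasDerivAt_const s x).prodMk (hasDerivAt_id s))
  simp only [hFdef]
  rcases eq_or_ne ε 0 with rfl | hε
  · simp [dslope_same, (hder 0).deriv]
  · rw [dslope_of_ne _ hε, slope_def_module]
    have hcont : Continuous fun s : ℝ ↦ fderiv ℝ f (x, s) (0, 1) := by
      have h1 : ContinuousOn (fderiv ℝ f) (U ×ˢ univ) :=
        hf.continuousOn_fderiv_of_isOpen hO (by simp)
      have := h1.comp_continuous (f := fun s : ℝ ↦ (x, s)) (by fun_prop)
        (fun s ↦ ⟨hx, mem_univ s⟩)
      exact this.clm_apply continuous_const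
    have := intervalIntegral.integral_eq_sub_of_hasDerivAt (a := 0) (b := ε)
      (fun s _ ↦ hder s) (hcont.intervalIntegrable _ _)
    rw [← this]
    have h2 := intervalIntegral.integral_comp_mul_right (a := 0) (b := 1)
      (fun s ↦ fderiv ℝ f (x, s) (0, 1)) hε
    simp only [zero_mul, one_mul] at h2
    simp [h2]

end Hadamard

/-! ### Fixed points of smooth families of contractions. -/

section FixedPoint

/-- The fixed point of a smooth family of contractions is a smooth function of the parameter. -/
theorem exists_contDiffOn_fixedPoint {P Z : Type*} [NormedAddCommGroup P] [NormedSpace ℝ P]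
    [CompleteSpace P] [NormedAddCommGroup Z] [NormedSpace ℝ Z] [CompleteSpace Z]
    {T : P × Z → Z} {U : Set P} (hU : IsOpen U) (hT : ContDiffOn ℝ ∞ T (U ×ˢ univ))
    (hL : ∀ p ∈ U, LipschitzWith (1 / 2) fun z ↦ T (p, z)) :
    ∃ ζ : P → Z, ContDiffOn ℝ ∞ ζ U ∧ (∀ p ∈ U, T (p, ζ p) = ζ p) ∧
      ∀ p ∈ U, ∀ z, T (p, z) = z → z = ζ p := by
  have hC : ∀ p ∈ U, ContractingWith (1 / 2) fun z ↦ T (p, z) := fun p hp ↦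
    ⟨by rw [← NNReal.coe_lt_coe]; norm_num, hL p hp⟩
  have hex : ∀ p, ∃ z, p ∈ U → T (p, z) = z := by
    intro p
    by_cases hp : p ∈ U
    · exact ⟨_, fun _ ↦ (hC p hp).fixedPoint_isFixedPt⟩
    · exact ⟨0, fun h ↦ (hp h).elim⟩
  choose ζ hζ using hex
  have huniq : ∀ p ∈ U, ∀ z, T (p, z) = z → z = ζ p := fun p hp z hz ↦
    (hC p hp).fixedPoint_unique' hz (hζ p hp)
  refine ⟨ζ, fun p hp ↦ ContDiffAt.contDiffWithinAt ?_, hζ, huniq⟩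
  -- The fixed points are the zeros of `F`. The Lipschitz constant bounds `∂T/∂z` by `1/2`, so
  -- `∂F/∂z = 1 - ∂T/∂z` is invertible by the Neumann series and the implicit function theorem
  -- applies.
  set F : P × Z → Z := fun q ↦ q.2 - T q with hF
  have hTd : ContDiffAt ℝ ∞ T (p, ζ p) :=
    hT.contDiffAt ((hU.prod isOpen_univ).mem_nhds (mk_mem_prod hp (mem_univ _)))
  have hFd : ContDiffAt ℝ ∞ F (p, ζ p) := contDiffAt_snd.sub hTd
  have hdiff : DifferentiableAt ℝ T (p, ζ p) := hTd.differentiableAt (by simp)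
  have hpart : HasFDerivAt (fun z ↦ T (p, z))
      (fderiv ℝ T (p, ζ p) ∘L ContinuousLinearMap.inr ℝ P Z) (ζ p) :=
    HasFDerivAt.comp (f := fun z ↦ (p, z)) (ζ p) hdiff.hasFDerivAt
      (hasFDerivAt_prodMk_right p (ζ p))
  have hnorm : ‖fderiv ℝ T (p, ζ p) ∘L ContinuousLinearMap.inr ℝ P Z‖ < 1 := by
    rw [← hpart.fderiv]
    refine (norm_fderiv_le_of_lipschitz ℝ (hL p hp)).trans_lt ?_
    norm_num
  have hinv : (fderiv ℝ F (p, ζ p) ∘L ContinuousLinearMap.inr ℝ P Z).IsInvertible := by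
    have h1 : fderiv ℝ F (p, ζ p) =
        ContinuousLinearMap.snd ℝ P Z - fderiv ℝ T (p, ζ p) := by
      rw [hF]
      exact (hasFDerivAt_snd.sub hdiff.hasFDerivAt).fderiv
    have h2 : fderiv ℝ F (p, ζ p) ∘L ContinuousLinearMap.inr ℝ P Z =
        1 - fderiv ℝ T (p, ζ p) ∘L ContinuousLinearMap.inr ℝ P Z := by
      rw [h1, ContinuousLinearMap.sub_comp, ContinuousLinearMap.snd_comp_inr]
      rfl
    rw [h2]
    exact ⟨ContinuousLinearEquiv.unitsEquiv ℝ Z (Units.oneSub _ hnorm), by ext; rfl⟩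
  have hψ := hFd.contDiffAt_implicitFunction (by simp) hinv
  have hψ2 := hFd.eventually_apply_implicitFunction (by simp) hinv
  refine hψ.congr_of_eventuallyEq ?_
  have hψ2' : ∀ᶠ x in 𝓝 p, F (x, hFd.implicitFunction (by simp) hinv x) = F (p, ζ p) := hψ2
  -- The implicit function also consists of fixed points, so uniqueness identifies it with `ζ` near
  -- `p`.
  filter_upwards [hψ2', hU.mem_nhds hp] with x hx hxU
  refine (huniq x hxU _ ?_).symm
  have h0 : F (p, ζ p) = 0 := by simp [hF, hζ p hp]
  rw [h0] at hx
  exact (sub_eq_zero.1 hx).symm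

end FixedPoint

/-! ### Smooth flows of small compactly supported fields. -/

section Flow

universe u

variable {E : Type u} [NormedAddCommGroup E] [NormedSpace ℝ E]

/-- The path `s ↦ (z s, ε, τ s)`, as a function of `((x, ε, τ), z)`. -/
def liftPath (q : (E × ℝ × ℝ) × C(Icc (0 : ℝ) 1, E)) : C(Icc (0 : ℝ) 1, E × ℝ × ℝ) :=
  ⟨fun s ↦ (q.2 s, q.1.2.1, q.1.2.2 * s), by fun_prop⟩

theorem contDiff_liftPath : ContDiff ℝ ∞ (liftPath (E := E)) := by
  have h : (liftPath (E := E)) = fun q ↦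
      (ContinuousLinearMap.inl ℝ E (ℝ × ℝ)).compLeftContinuous ℝ (Icc (0 : ℝ) 1) q.2 +
      (ContinuousLinearMap.const ℝ (Icc (0 : ℝ) 1) ((0, q.1.2.1, 0) : E × ℝ × ℝ) +
      q.1.2.2 • (⟨fun s ↦ (0, 0, (s : ℝ)), by fun_prop⟩ : C(Icc (0 : ℝ) 1, E × ℝ × ℝ))) := by
    ext q s <;> simp [liftPath]
  rw [h]
  refine ((ContinuousLinearMap.contDiff _).comp contDiff_snd).add
    (((ContinuousLinearMap.contDiff _).comp ?_).add ?_)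
  · fun_prop
  · fun_prop

/-- A compactly supported smooth time-dependent vector field `ε G(·, ε, t)` with a small factor `ε`
has a smooth flow on the time interval `(-2, 2)`. -/
theorem exists_smooth_flow [FiniteDimensional ℝ E] {G : E × ℝ × ℝ → E} (hG : ContDiff ℝ ∞ G)
    (hc : HasCompactSupport G) :
    ∃ ε₀ : ℝ, 0 < ε₀ ∧ ∃ φ : E × ℝ × ℝ → E,
      ContDiffOn ℝ ∞ φ (univ ×ˢ Ioo (-ε₀) ε₀ ×ˢ Ioo (-2) 2) ∧
      ∀ x, ∀ ε ∈ Ioo (-ε₀) ε₀, φ (x, ε, 0) = x ∧ ∀ t ∈ Ioo (-2 : ℝ) 2,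
        HasDerivAt (fun t ↦ φ (x, ε, t)) (ε • G (φ (x, ε, t), ε, t)) t := by
  have : CompleteSpace E := FiniteDimensional.complete ℝ E
  obtain ⟨C, hC⟩ := hG.lipschitzWith_of_hasCompactSupport hc (by simp)
  -- With `|τ| ≤ 2` and `|ε| ≤ ε₀` the Picard operator below has Lipschitz constant at most `2 ε₀ C
  -- ≤ 1/2`.
  set ε₀ : ℝ := 1 / (4 * (C + 1)) with hε₀
  have hε₀pos : 0 < ε₀ := by positivity
  set U : Set (E × ℝ × ℝ) := univ ×ˢ Ioo (-ε₀) ε₀ ×ˢ Ioo (-2) 2 with hU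
  have hUo : IsOpen U := isOpen_univ.prod (isOpen_Ioo.prod isOpen_Ioo)
  -- Picard's operator for the orbit on `[0, τ]` rescaled to the unit interval. The time `τ` becomes
  -- a parameter like `x` and `ε`, so smoothness in all three comes from a single fixed point
  -- theorem.
  set T : (E × ℝ × ℝ) × C(Icc (0 : ℝ) 1, E) → C(Icc (0 : ℝ) 1, E) := fun q ↦
    ContinuousLinearMap.const ℝ (Icc (0 : ℝ) 1) q.1.1 +
      (q.1.2.2 * q.1.2.1) • primitiveCLM E (superpose (Icc (0 : ℝ) 1) G (liftPath q)) with hT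
  have hTs : ContDiff ℝ ∞ T := by
    have h1 : ContDiff ℝ ∞ (superpose (Icc (0 : ℝ) 1) G) := by
      have := contDiffOn_superpose (K := Icc (0 : ℝ) 1) isOpen_univ hG.contDiffOn
      rw [← contDiffOn_univ]
      exact this.mono fun z _ k ↦ mem_univ _
    have h2 := h1.comp (contDiff_liftPath (E := E))
    refine ((ContinuousLinearMap.const ℝ (Icc (0 : ℝ) 1)).contDiff.comp
      (contDiff_fst.comp contDiff_fst)).add (ContDiff.smul
      (f := fun q : (E × ℝ × ℝ) × C(Icc (0 : ℝ) 1, E) ↦ q.1.2.2 * q.1.2.1) (by fun_prop)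
      ((primitiveCLM E).contDiff.comp h2))
  have hTapp : ∀ (q) (s : Icc (0 : ℝ) 1) (w : ℝ → E), (∀ t : Icc (0 : ℝ) 1, q.2 t = w t) →
      T q s = q.1.1 + (q.1.2.2 * q.1.2.1) •
        ∫ t in (0 : ℝ)..s, G (w t, q.1.2.1, q.1.2.2 * t) := by
    intro q s w hw
    have := primitiveCLM_apply_eq (z := superpose (Icc (0 : ℝ) 1) G (liftPath q))
      (w := fun t ↦ G (w t, q.1.2.1, q.1.2.2 * t)) s (fun t ↦ by
        rw [superpose_apply hG.continuous.continuousOn (fun k ↦ mem_univ _)]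
        simp [liftPath, hw])
    rw [← this]
    rfl
  have hTL : ∀ p ∈ U, LipschitzWith (1 / 2) fun z ↦ T (p, z) := by
    rintro ⟨x, ε, τ⟩ ⟨-, hε, hτ⟩
    refine LipschitzWith.of_dist_le_mul fun z w ↦ ?_
    have h1 : ‖superpose (Icc (0 : ℝ) 1) G (liftPath ((x, ε, τ), z)) -
        superpose (Icc (0 : ℝ) 1) G (liftPath ((x, ε, τ), w))‖ ≤ C * ‖z - w‖ := by
      rw [ContinuousMap.norm_le _ (by positivity)]
      intro k
      rw [ContinuousMap.sub_apply, superpose_apply hG.continuous.continuousOn (fun k ↦ mem_univ _),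
        superpose_apply hG.continuous.continuousOn (fun k ↦ mem_univ _), ← dist_eq_norm]
      refine (hC.dist_le_mul _ _).trans ?_
      gcongr
      simp only [liftPath, ContinuousMap.coe_mk, Prod.dist_eq, dist_self]
      simp only [sup_of_le_left, dist_nonneg]
      rw [← dist_eq_norm]
      exact ContinuousMap.dist_apply_le_dist k
    rw [dist_eq_norm, dist_eq_norm]
    simp only [hT, add_sub_add_left_eq_sub, ← smul_sub, ← map_sub, norm_smul]
    have h2 := (primitiveCLM E).le_of_opNorm_le_of_le norm_primitiveCLM_le h1
    have h3 : ‖τ * ε‖ ≤ 2 * ε₀ := by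
      rw [norm_mul, Real.norm_eq_abs, Real.norm_eq_abs]
      exact mul_le_mul (abs_le.2 ⟨hτ.1.le, hτ.2.le⟩) (abs_le.2 ⟨hε.1.le, hε.2.le⟩)
        (abs_nonneg _) (by norm_num)
    have h4 : 2 * ε₀ * C ≤ 1 / 2 := by
      rw [hε₀]
      field_simp
      nlinarith [C.2]
    calc _ ≤ (2 * ε₀) * (1 * (C * ‖z - w‖)) := by gcongr
      _ = (2 * ε₀ * C) * ‖z - w‖ := by ring
      _ ≤ _ := by
        gcongr
        simpa using h4
  obtain ⟨ζ, hζs, hζ, huniq⟩ := exists_contDiffOn_fixedPoint hUo hTs.contDiffOn hTL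
  set φ : E × ℝ × ℝ → E := fun p ↦ ζ p 1 with hφ
  have hφs : ContDiffOn ℝ ∞ φ U :=
    ContDiff.comp_contDiffOn (g := ContinuousMap.evalCLM ℝ (1 : Icc (0 : ℝ) 1))
      (ContinuousLinearMap.contDiff _) hζs
  -- The rescaled orbit up to time `τ`, cut at `s` and rescaled again, solves the fixed point
  -- equation for time `τ s`; hence the whole path `ζ (x, ε, τ)` is traced by its endpoints `φ`.
  have hresc : ∀ x ε τ, (x, ε, τ) ∈ U → ∀ s : Icc (0 : ℝ) 1,
      (x, ε, τ * s) ∈ U ∧ ζ (x, ε, τ) s = φ (x, ε, τ * s) := by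
    rintro x ε τ hp s
    have hp' : (x, ε, τ * s) ∈ U := by
      refine ⟨hp.1, hp.2.1, ?_⟩
      have h1 := abs_lt.2 hp.2.2
      refine abs_lt.1 ?_
      rw [abs_mul, abs_of_nonneg s.2.1]
      exact (mul_le_of_le_one_right (abs_nonneg _) s.2.2).trans_lt h1
    refine ⟨hp', ?_⟩
    set w : C(Icc (0 : ℝ) 1, E) := ⟨fun t ↦ ζ (x, ε, τ) (s * t), by fun_prop⟩ with hw
    set W : ℝ → E := IccExtend zero_le_one (ζ (x, ε, τ)) with hW
    have hWapp : ∀ t : Icc (0 : ℝ) 1, ζ (x, ε, τ) t = W t := fun t ↦ by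
      rw [hW, IccExtend_val]
    have hfix : T ((x, ε, τ * s), w) = w := by
      ext t
      have e1 := hTapp ((x, ε, τ * s), w) t (fun t ↦ W (s * t)) (fun t ↦ by
        simp only [hw, ContinuousMap.coe_mk]
        rw [hWapp]
        simp)
      have e2 := hTapp ((x, ε, τ), ζ (x, ε, τ)) (s * t) W hWapp
      rw [hζ _ hp] at e2
      rw [e1]
      simp only [hw, ContinuousMap.coe_mk]
      rw [e2]
      simp only [mul_right_comm τ (s : ℝ) ε, mul_smul (τ * ε) (s : ℝ), mul_assoc τ (s : ℝ)]
      have := intervalIntegral.smul_integral_comp_mul_left (a := 0) (b := t)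
        (fun u ↦ G (W u, ε, τ * u)) (s : ℝ)
      rw [this]
      simp
    have := huniq _ hp' w hfix
    simp only [hφ, ← this]
    simp [hw]
  have hφint : ∀ x ε t, (x, ε, t) ∈ U →
      φ (x, ε, t) = x + ε • ∫ u in (0 : ℝ)..t, G (φ (x, ε, u), ε, u) := by
    intro x ε t hp
    have e1 := hTapp ((x, ε, t), ζ (x, ε, t)) 1 (fun s ↦ φ (x, ε, t * s))
      (fun s ↦ (hresc x ε t hp s).2)
    rw [hζ _ hp] at e1
    have := intervalIntegral.smul_integral_comp_mul_left (a := 0) (b := 1)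
        (fun u ↦ G (φ (x, ε, u), ε, u)) t
    simp only [mul_zero, mul_one] at this
    simp only [hφ] at e1 this ⊢
    rw [e1, ← this, smul_smul, mul_comm ε t]
    simp
  refine ⟨ε₀, hε₀pos, φ, hφs, fun x ε hε ↦ ⟨?_, fun t ht ↦ ?_⟩⟩
  · rw [hφint x ε 0 ⟨mem_univ _, hε, by simp⟩]
    simp
  · have hcont : ContinuousOn (fun u ↦ G (φ (x, ε, u), ε, u)) (Ioo (-2) 2) := by
      have h1 : ContinuousOn (fun u : ℝ ↦ φ (x, ε, u)) (Ioo (-2) 2) :=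
        hφs.continuousOn.comp (f := fun u : ℝ ↦ (x, ε, u)) (by fun_prop)
          (fun u hu ↦ ⟨mem_univ _, hε, hu⟩)
      exact hG.continuous.comp_continuousOn
        (h1.prodMk (continuousOn_const.prodMk continuousOn_id))
    have hsub : uIcc 0 t ⊆ Ioo (-2 : ℝ) 2 := by
      intro u hu
      have h0 : (0 : ℝ) ∈ Ioo (-2 : ℝ) 2 := by simp
      exact (ordConnected_Ioo.uIcc_subset h0 ht) hu
    have hd := intervalIntegral.integral_hasDerivAt_right
      (hcont.mono hsub).intervalIntegrable
      (hcont.stronglyMeasurableAtFilter isOpen_Ioo t ht)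
      (hcont.continuousAt (isOpen_Ioo.mem_nhds ht))
    refine ((hd.const_smul ε).const_add x).congr_of_eventuallyEq ?_
    filter_upwards [isOpen_Ioo.mem_nhds ht] with u hu
    exact hφint x ε u ⟨mem_univ _, hε, hu⟩

end Flow

/-! ### Composition with a continuous linear map. -/

section LinearPostcomposition

variable {X F G : Type*} [NormedAddCommGroup X] [NormedSpace ℝ X] [NormedAddCommGroup F]
  [NormedSpace ℝ F] [NormedAddCommGroup G] [NormedSpace ℝ G]

theorem HasFDerivAt.clm_map {f : X → F} {f' : X →L[ℝ] F} {x : X} (hf : HasFDerivAt f f' x)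
    (L : F →L[ℝ] G) : HasFDerivAt (fun y ↦ L (f y)) (L ∘L f') x :=
  L.hasFDerivAt.comp x hf

theorem HasDerivAt.clm_map {f : ℝ → F} {f' : F} {x : ℝ} (hf : HasDerivAt f f' x)
    (L : F →L[ℝ] G) : HasDerivAt (fun y ↦ L (f y)) (L f') x :=
  L.hasFDerivAt.comp_hasDerivAt x hf

theorem integral_clm_map [CompleteSpace F] [CompleteSpace G] {f : ℝ → F} {a b : ℝ}
    (hf : IntervalIntegrable f MeasureTheory.volume a b) (L : F →L[ℝ] G) :
    L (∫ t in a..b, f t) = ∫ t in a..b, L (f t) :=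
  (L.intervalIntegral_comp_comm hf).symm

theorem contDiffOn_clm_map {f : X → F} {s : Set X} {n : ℕ∞ω} (hf : ContDiffOn ℝ n f s)
    (L : F →L[ℝ] G) : ContDiffOn ℝ n (fun y ↦ L (f y)) s :=
  L.contDiff.comp_contDiffOn hf

end LinearPostcomposition

/-! ### Alternating maps in low degree and their pullbacks. -/

section AlternatingMaps

variable {E : Type*} [NormedAddCommGroup E] [NormedSpace ℝ E] [FiniteDimensional ℝ E]

instance finiteDimensional_multilinear (k : ℕ) :
    FiniteDimensional ℝ (ContinuousMultilinearMap ℝ (fun _ : Fin k ↦ E) ℝ) :=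
  FiniteDimensional.of_injective
    (ContinuousMultilinearMap.toMultilinearMapLinear (R' := ℝ) (A := ℝ)
      (M₁ := fun _ : Fin k ↦ E) (M₂ := ℝ)) ContinuousMultilinearMap.toMultilinearMap_injective

omit [FiniteDimensional ℝ E] in
theorem contDiff_multilinear_comp {F : Type*} [NormedAddCommGroup F] [NormedSpace ℝ F] (k : ℕ) :
    ContDiff ℝ ∞ (fun p : (F [⋀^Fin k]→L[ℝ] ℝ) × (E →L[ℝ] F) ↦
      (p.1.compContinuousLinearMap p.2).toContinuousMultilinearMap) := by
  have h1 : ContDiff ℝ ∞ (fun p : (F [⋀^Fin k]→L[ℝ] ℝ) × (E →L[ℝ] F) ↦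
      ContinuousMultilinearMap.compContinuousLinearMapContinuousMultilinear ℝ
        (fun _ : Fin k ↦ E) (fun _ : Fin k ↦ F) ℝ (fun _ ↦ p.2)) :=
    (ContinuousMultilinearMap.contDiff _).comp (contDiff_pi.2 fun _ ↦ contDiff_snd)
  have h2 : ContDiff ℝ ∞ (fun p : (F [⋀^Fin k]→L[ℝ] ℝ) × (E →L[ℝ] F) ↦
      p.1.toContinuousMultilinearMap) :=
    (ContinuousAlternatingMap.toContinuousMultilinearMapCLM ℝ (𝕜 := ℝ) (E := F) (F := ℝ)
      (ι := Fin k)).contDiff.comp contDiff_fst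
  exact h1.clm_apply h2

/-- Pullback of an alternating map is jointly smooth in the map and in the linear map. -/
theorem contDiff_compContinuousLinearMap {F : Type*} [NormedAddCommGroup F] [NormedSpace ℝ F]
    (k : ℕ) :
    ContDiff ℝ ∞ (fun p : (F [⋀^Fin k]→L[ℝ] ℝ) × (E →L[ℝ] F) ↦
      p.1.compContinuousLinearMap p.2) := by
  -- The inclusion of alternating maps into multilinear maps has a linear left inverse, continuous
  -- because the multilinear maps form a finite-dimensional space; it carries smoothness back to
  -- alternating maps.
  obtain ⟨L, hL⟩ := LinearMap.exists_leftInverse_of_injective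
    (ContinuousAlternatingMap.toContinuousMultilinearMapLinear (R := ℝ) (A := ℝ)
      (M := E) (N := ℝ) (ι := Fin k)) (LinearMap.ker_eq_bot.2
        ContinuousAlternatingMap.toContinuousMultilinearMap_injective)
  have h := (LinearMap.toContinuousLinearMap L).contDiff (n := ∞).comp
    (contDiff_multilinear_comp (E := E) (F := F) k)
  convert! h using 1
  ext1 p
  exact (LinearMap.congr_fun hL (p.1.compContinuousLinearMap p.2)).symm

/-- The linear map `v ↦ σ(v, ·)` of an alternating bilinear form `σ`. -/
def flat (E : Type*) [NormedAddCommGroup E] [NormedSpace ℝ E] :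
    (E [⋀^Fin 2]→L[ℝ] ℝ) →L[ℝ] E →L[ℝ] E →L[ℝ] ℝ :=
  ContinuousLinearMap.compL ℝ E (E [⋀^Fin 1]→L[ℝ] ℝ) (E →L[ℝ] ℝ)
    ((ContinuousAlternatingMap.ofSubsingletonLIE (𝕜 := ℝ) (E := E) (ι := Fin 1)
      (F := ℝ) 0).symm.toContinuousLinearEquiv :
      (E [⋀^Fin 1]→L[ℝ] ℝ) →L[ℝ] (E →L[ℝ] ℝ)) ∘L
    (ContinuousAlternatingMap.curryLeftLI (𝕜 := ℝ) (E := E) (F := ℝ) (n := 1)).toContinuousLinearMap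

/-- The covector of an alternating `1`-form. -/
def covector (E : Type*) [NormedAddCommGroup E] [NormedSpace ℝ E] :
    (E [⋀^Fin 1]→L[ℝ] ℝ) →L[ℝ] (E →L[ℝ] ℝ) :=
  ((ContinuousAlternatingMap.ofSubsingletonLIE (𝕜 := ℝ) (E := E) (ι := Fin 1)
      (F := ℝ) 0).symm.toContinuousLinearEquiv :
      (E [⋀^Fin 1]→L[ℝ] ℝ) →L[ℝ] (E →L[ℝ] ℝ))

omit [FiniteDimensional ℝ E] in
theorem covector_apply (θ : E [⋀^Fin 1]→L[ℝ] ℝ) (v : E) : covector E θ v = θ ![v] := by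
  have : θ = ContinuousAlternatingMap.ofSubsingleton ℝ E ℝ (0 : Fin 1) (covector E θ) :=
    ((ContinuousAlternatingMap.ofSubsingletonLIE (𝕜 := ℝ) (E := E) (ι := Fin 1)
      (F := ℝ) 0).apply_symm_apply θ).symm
  conv_rhs => rw [this]
  rfl

omit [FiniteDimensional ℝ E] in
theorem flat_apply (σ : E [⋀^Fin 2]→L[ℝ] ℝ) (v w : E) : flat E σ v w = σ ![v, w] :=
  covector_apply (σ.curryLeft v) w

omit [FiniteDimensional ℝ E] in
theorem flat_swap (σ : E [⋀^Fin 2]→L[ℝ] ℝ) (v w : E) : flat E σ w v = -flat E σ v w := by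
  rw [flat_apply, flat_apply]
  have := σ.toAlternatingMap.map_swap ![v, w] (i := 0) (j := 1) (by simp)
  rw [← ContinuousAlternatingMap.coe_toAlternatingMap, ← this]
  congr 1
  ext i
  fin_cases i <;> simp

omit [FiniteDimensional ℝ E] in
theorem alternatizeUncurryFin_one (D : E →L[ℝ] E [⋀^Fin 1]→L[ℝ] ℝ) (v w : E) :
    ContinuousAlternatingMap.alternatizeUncurryFin D ![v, w] = D v ![w] - D w ![v] := by
  rw [ContinuousAlternatingMap.alternatizeUncurryFin_apply, Fin.sum_univ_two]
  have h0 : (0 : Fin 2).removeNth ![v, w] = ![w] := by ext i; fin_cases i; rfl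
  have h1 : (1 : Fin 2).removeNth ![v, w] = ![v] := by ext i; fin_cases i; rfl
  simp [h0, h1, sub_eq_add_neg]

omit [FiniteDimensional ℝ E] in
theorem alternatizeUncurryFin_two (D : E →L[ℝ] E [⋀^Fin 2]→L[ℝ] ℝ) (u v w : E) :
    ContinuousAlternatingMap.alternatizeUncurryFin D ![u, v, w] =
      D u ![v, w] - D v ![u, w] + D w ![u, v] := by
  rw [ContinuousAlternatingMap.alternatizeUncurryFin_apply, Fin.sum_univ_three]
  have h0 : (0 : Fin 3).removeNth ![u, v, w] = ![v, w] := by ext i; fin_cases i <;> rfl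
  have h1 : (1 : Fin 3).removeNth ![u, v, w] = ![u, w] := by ext i; fin_cases i <;> rfl
  have h2 : (2 : Fin 3).removeNth ![u, v, w] = ![u, v] := by ext i; fin_cases i <;> rfl
  simp [h0, h1, h2, sub_eq_add_neg]

end AlternatingMaps

/-! ### The Poincaré lemma with a parameter. -/

section Poincare

universe u

variable {E : Type u} [NormedAddCommGroup E] [NormedSpace ℝ E] [FiniteDimensional ℝ E]

omit [FiniteDimensional ℝ E] in
-- This is Cartan's formula for a closed form and a constant field `z`, where the Lie derivative is
-- `d ι_z`: expand the vanishing alternation on `(z, v)` and isolate the term in which `z` is the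
-- direction of differentiation.
theorem alternatizeUncurryFin_curryLeft_flip {k : ℕ} (D : E →L[ℝ] E [⋀^Fin (k + 1)]→L[ℝ] ℝ)
    (hD : ContinuousAlternatingMap.alternatizeUncurryFin D = 0) (z : E)
    (M : E →L[ℝ] E [⋀^Fin k]→L[ℝ] ℝ) (hM : ∀ u, M u = (D u).curryLeft z) :
    ContinuousAlternatingMap.alternatizeUncurryFin M = D z := by
  ext v
  have h := DFunLike.congr_fun hD (Matrix.vecCons z v)
  rw [ContinuousAlternatingMap.alternatizeUncurryFin_apply, Fin.sum_univ_succ] at h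
  rw [ContinuousAlternatingMap.alternatizeUncurryFin_apply]
  have h0 : (0 : Fin (k + 2)).removeNth (Matrix.vecCons z v) = v := by
    ext i
    simp [Fin.removeNth]
  have hs : ∀ i : Fin (k + 1), (i.succ).removeNth (Matrix.vecCons z v) =
      Matrix.vecCons z (i.removeNth v) := by
    intro i
    ext j
    refine Fin.cases ?_ (fun j ↦ ?_) j <;> simp [Fin.removeNth]
  simp only [Fin.val_zero, pow_zero, Matrix.cons_val_zero, h0, hs, one_smul, Fin.val_succ,
    Matrix.cons_val_succ, ContinuousAlternatingMap.coe_zero, Pi.zero_apply, pow_succ, mul_neg,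
    mul_one, neg_smul, Finset.sum_neg_distrib] at h
  simp only [hM, ContinuousAlternatingMap.curryLeft_apply_apply]
  linarith

omit [FiniteDimensional ℝ E] in
/-- **Poincaré lemma** on a ball, with a parameter. -/
theorem exists_smooth_primitive {k : ℕ} {c : E} {r : ℝ} {σ : E × ℝ → E [⋀^Fin (k + 1)]→L[ℝ] ℝ}
    (hσ : ContDiffOn ℝ ∞ σ (Metric.ball c r ×ˢ univ))
    (hcl : ∀ ε, ∀ x ∈ Metric.ball c r, extDeriv (fun y ↦ σ (y, ε)) x = 0) :
    ∃ α : E × ℝ → E [⋀^Fin k]→L[ℝ] ℝ, ContDiffOn ℝ ∞ α (Metric.ball c r ×ˢ univ) ∧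
      ∀ ε, ∀ x ∈ Metric.ball c r, extDeriv (fun y ↦ α (y, ε)) x = σ (x, ε) := by
  set B := Metric.ball c r with hB
  have hBo : IsOpen B := Metric.isOpen_ball
  have hseg : ∀ x ∈ B, ∀ t ∈ Icc (0 : ℝ) 1, c + t • (x - c) ∈ B := by
    intro x hx t ht
    have hc : c ∈ B := Metric.mem_ball_self (dist_nonneg.trans_lt (Metric.mem_ball.1 hx))
    exact (convex_ball c r).add_smul_sub_mem hc hx ht
  have hcurry : ContDiff ℝ ∞ (fun η : E [⋀^Fin (k + 1)]→L[ℝ] ℝ ↦ η.curryLeft) :=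
    LinearIsometry.contDiff (𝕜 := ℝ) (E := E [⋀^Fin (k + 1)]→L[ℝ] ℝ)
      (F := E →L[ℝ] E [⋀^Fin k]→L[ℝ] ℝ)
      (ContinuousAlternatingMap.curryLeftLI (𝕜 := ℝ) (E := E) (F := ℝ) (n := k)) (n := ∞)
  -- Integrand of the cone homotopy: `t^k` times the contraction of `σ` at `c + t (x - c)` with `x -
  -- c`.
  set F : (E × ℝ) × ℝ → E [⋀^Fin k]→L[ℝ] ℝ := fun q ↦
    q.2 ^ k • (σ (c + q.2 • (q.1.1 - c), q.1.2)).curryLeft (q.1.1 - c) with hF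
  set O : Set ((E × ℝ) × ℝ) := (fun q ↦ c + q.2 • (q.1.1 - c)) ⁻¹' B with hO
  have hOo : IsOpen O := hBo.preimage (by fun_prop)
  have hFs : ContDiffOn ℝ ∞ F O := by
    have h1 : ContDiffOn ℝ ∞ (fun q : (E × ℝ) × ℝ ↦ σ (c + q.2 • (q.1.1 - c), q.1.2)) O :=
      hσ.comp (f := fun q : (E × ℝ) × ℝ ↦ (c + q.2 • (q.1.1 - c), q.1.2))
        (by fun_prop) (fun q hq ↦ ⟨hq, mem_univ _⟩)
    have h2 : ContDiffOn ℝ ∞ (fun q : (E × ℝ) × ℝ ↦ q.2 ^ k) O := by fun_prop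
    have h3 : ContDiffOn ℝ ∞ (fun q : (E × ℝ) × ℝ ↦ q.1.1 - c) O := by fun_prop
    exact h2.smul ((hcurry.comp_contDiffOn h1).clm_apply h3)
  refine ⟨fun p ↦ ∫ t in (0 : ℝ)..1, F (p, t),
    contDiffOn_integral hOo hFs (fun p hp t ht ↦ hseg p.1 hp.1 t ht), fun ε x hx ↦ ?_⟩
  set Fε : E × ℝ → E [⋀^Fin k]→L[ℝ] ℝ := fun q ↦ F ((q.1, ε), q.2) with hFε
  set Oε : Set (E × ℝ) := (fun q ↦ c + q.2 • (q.1 - c)) ⁻¹' B with hOε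
  have hOεo : IsOpen Oε := hBo.preimage (by fun_prop)
  have hFεs : ContDiffOn ℝ ∞ Fε Oε :=
    hFs.comp (f := fun q : E × ℝ ↦ ((q.1, ε), q.2)) (by fun_prop) (fun q hq ↦ hq)
  obtain ⟨hd, hfd⟩ := hasFDerivAt_integral hOεo hFεs hBo (fun x hx t ht ↦ hseg x hx t ht) hx
  have hmem : ∀ t ∈ Icc (0 : ℝ) 1, (x, t) ∈ Oε := fun t ht ↦ hseg x hx t ht
  set L : ℝ → E →L[ℝ] E [⋀^Fin k]→L[ℝ] ℝ := fun t ↦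
    fderiv ℝ Fε (x, t) ∘L ContinuousLinearMap.inl ℝ E ℝ with hL
  have hLc : ContinuousOn L (uIcc 0 1) := by
    rw [uIcc_of_le zero_le_one]
    have h1 : ContinuousOn (fderiv ℝ Fε) Oε := hFεs.continuousOn_fderiv_of_isOpen hOεo (by simp)
    have h2 := h1.comp (f := fun t : ℝ ↦ (x, t)) (s := Icc 0 1) (by fun_prop) hmem
    exact h2.clm_comp continuousOn_const
  have hfL : fderiv ℝ (fun y ↦ ∫ t in (0 : ℝ)..1, Fε (y, t)) x = ∫ t in (0 : ℝ)..1, L t := by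
    ext1 v
    rw [hfd v, ContinuousLinearMap.intervalIntegral_apply hLc.intervalIntegrable]
    simp [hL]
  set σε : E → E [⋀^Fin (k + 1)]→L[ℝ] ℝ := fun y ↦ σ (y, ε) with hσε
  have hσεs : ContDiffOn ℝ ∞ σε B :=
    hσ.comp (f := fun y : E ↦ (y, ε)) (by fun_prop) (fun q hq ↦ ⟨hq, mem_univ _⟩)
  have hσεd : ∀ y ∈ B, HasFDerivAt σε (fderiv ℝ σε y) y := fun y hy ↦
    ((hσεs.contDiffAt (hBo.mem_nhds hy)).differentiableAt (by simp)).hasFDerivAt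
  have hγ : ∀ t, HasDerivAt (fun t : ℝ ↦ c + t • (x - c)) (x - c) t := fun t ↦ by
    simpa using ((hasDerivAt_id t).smul_const (x - c)).const_add c
  -- The exterior derivative of the integrand is a total `t`-derivative; its integral is the
  -- difference of `t^(k+1) σ` at the endpoints, namely `σ(x)`.
  have hkey : ∀ t ∈ uIcc (0 : ℝ) 1,
      HasDerivAt (fun t : ℝ ↦ t ^ (k + 1) • σε (c + t • (x - c)))
        (ContinuousAlternatingMap.alternatizeUncurryFinCLM ℝ E ℝ (L t)) t := by
    intro t ht
    rw [uIcc_of_le zero_le_one] at ht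
    set y := c + t • (x - c) with hy
    have hyB : y ∈ B := hseg x hx t ht
    have h1 : HasFDerivAt (fun x' : E ↦ c + t • (x' - c)) (t • ContinuousLinearMap.id ℝ E) x :=
      (((hasFDerivAt_id x).sub_const c).const_smul t).const_add c
    have h2 : HasFDerivAt (fun x' : E ↦ (σε (c + t • (x' - c))).curryLeft)
        ((ContinuousAlternatingMap.curryLeftLI (𝕜 := ℝ) (E := E) (F := ℝ)
          (n := k)).toContinuousLinearMap ∘L (fderiv ℝ σε y ∘L (t • ContinuousLinearMap.id ℝ E)))
        x :=
      HasFDerivAt.clm_map (G := E →L[ℝ] E [⋀^Fin k]→L[ℝ] ℝ) ((hσεd y hyB).comp x h1)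
        (ContinuousAlternatingMap.curryLeftLI (𝕜 := ℝ) (E := E) (F := ℝ)
          (n := k)).toContinuousLinearMap
    have h3 := (h2.clm_apply ((hasFDerivAt_id x).sub_const c)).const_smul (t ^ k)
    have h4 : HasFDerivAt (fun x' ↦ Fε (x', t)) (L t) x :=
      HasFDerivAt.comp (f := fun x' : E ↦ (x', t)) x
        ((hFεs.contDiffAt (hOεo.mem_nhds (hmem t ht))).differentiableAt (by simp)).hasFDerivAt
        (hasFDerivAt_prodMk_left x t)
    have h5 := h4.unique h3
    set M : E →L[ℝ] E [⋀^Fin k]→L[ℝ] ℝ :=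
      ((ContinuousAlternatingMap.curryLeftLI (𝕜 := ℝ) (E := E) (F := ℝ)
          (n := k)).toContinuousLinearMap ∘L fderiv ℝ σε y).flip (x - c) with hM
    -- The product rule: `M` differentiates `σ`, and the other term differentiates the inserted
    -- vector `x - c`. After alternation, closedness turns the first into the derivative of `σ`
    -- along `x - c`, and the second gives `(k + 1) σ`.
    have h6 : L t = t ^ (k + 1) • M + t ^ k • (σε y).curryLeft := by
      rw [h5]
      ext u v
      simp [hM, hy, pow_succ]
      ring
    have h7 := alternatizeUncurryFin_curryLeft_flip (fderiv ℝ σε y) (hcl ε y hyB) (x - c) M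
      (fun u ↦ rfl)
    have h8 := ContinuousAlternatingMap.alternatizeUncurryFin_curryLeft (σε y)
    rw [h6, map_add, map_smul, map_smul, ContinuousAlternatingMap.alternatizeUncurryFinCLM_apply,
      ContinuousAlternatingMap.alternatizeUncurryFinCLM_apply, h7, h8]
    have h9 := (hasDerivAt_pow (k + 1) t).smul ((hσεd y hyB).comp_hasDerivAt t (hγ t))
    convert! h9 using 1
    simp only [Nat.add_sub_cancel, ← Nat.cast_smul_eq_nsmul ℝ, smul_smul]
    congr 2
    push_cast
    ring
  have hint := intervalIntegral.integral_eq_sub_of_hasDerivAt hkey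
    (((ContinuousAlternatingMap.alternatizeUncurryFinCLM ℝ E ℝ).continuous.comp_continuousOn
      hLc).intervalIntegrable)
  change ContinuousAlternatingMap.alternatizeUncurryFin
    (fderiv ℝ (fun y ↦ ∫ t in (0 : ℝ)..1, Fε (y, t)) x) = _
  have hcomm := integral_clm_map (F := E →L[ℝ] E [⋀^Fin k]→L[ℝ] ℝ)
    (G := E [⋀^Fin (k + 1)]→L[ℝ] ℝ) hLc.intervalIntegrable
    (ContinuousAlternatingMap.alternatizeUncurryFinCLM ℝ E ℝ)
  rw [hfL, ← ContinuousAlternatingMap.alternatizeUncurryFinCLM_apply]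
  refine (hcomm.trans hint).trans ?_
  simp [hσε]

end Poincare

/-! ### The variational equation and Moser's argument in a vector space. -/

section Moser

variable {E : Type*} [NormedAddCommGroup E] [NormedSpace ℝ E]

/-- The variational equation of a flow. -/
theorem hasDerivAt_fderiv_flow {φ X : E × ℝ → E} {U : Set E} {I : Set ℝ} (hU : IsOpen U)
    (hI : IsOpen I) (hφ : ContDiffOn ℝ ∞ φ (U ×ˢ I))
    (hX : ∀ x ∈ U, ∀ t ∈ I, HasDerivAt (fun t ↦ φ (x, t)) (X (φ (x, t), t)) t)
    {x : E} (hx : x ∈ U) {t : ℝ} (ht : t ∈ I) (hXd : DifferentiableAt ℝ X (φ (x, t), t)) (v : E) :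
    HasDerivAt (fun t ↦ fderiv ℝ φ (x, t) (v, 0))
      (fderiv ℝ X (φ (x, t), t) (fderiv ℝ φ (x, t) (v, 0), 0)) t := by
  have hUI : IsOpen (U ×ˢ I) := hU.prod hI
  have hφd : ∀ y ∈ U, ∀ s ∈ I, HasFDerivAt φ (fderiv ℝ φ (y, s)) (y, s) := fun y hy s hs ↦
    ((hφ.contDiffAt (hUI.mem_nhds (mk_mem_prod hy hs))).differentiableAt (by simp)).hasFDerivAt
  have hc := hφ.contDiffAt (hUI.mem_nhds (mk_mem_prod hx ht))
  have h2 : HasFDerivAt (fderiv ℝ φ) (fderiv ℝ (fderiv ℝ φ) (x, t)) (x, t) :=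
    ((hc.fderiv_right (m := 1) (by norm_cast)).differentiableAt (by simp)).hasFDerivAt
  have hsymm : IsSymmSndFDerivAt ℝ φ (x, t) :=
    hc.isSymmSndFDerivAt (by simpa using ENat.LEInfty.out)
  have h3 : HasDerivAt (fun t ↦ fderiv ℝ φ (x, t) (v, 0))
      (fderiv ℝ (fderiv ℝ φ) (x, t) (0, 1) (v, 0)) t := by
    have := HasFDerivAt.comp_hasDerivAt (f := fun s : ℝ ↦ (x, s)) t h2
      ((hasDerivAt_const t x).prodMk (hasDerivAt_id t))
    exact ((ContinuousLinearMap.apply ℝ E ((v, 0) : E × ℝ)).hasFDerivAt.comp_hasDerivAt t this)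
  convert! h3 using 1
  -- Exchanging the mixed derivatives reduces the claim to differentiating `∂φ/∂t = X(φ, t)` in
  -- space.
  rw [hsymm.eq (0, 1) (v, 0)]
  have h4 : HasFDerivAt (fun y ↦ fderiv ℝ φ (y, t) (0, 1))
      ((ContinuousLinearMap.apply ℝ E ((0, 1) : E × ℝ)) ∘L
        (fderiv ℝ (fderiv ℝ φ) (x, t) ∘L ContinuousLinearMap.inl ℝ E ℝ)) x :=
    (ContinuousLinearMap.apply ℝ E ((0, 1) : E × ℝ)).hasFDerivAt.comp x
      (HasFDerivAt.comp (f := fun y : E ↦ (y, t)) x h2 (hasFDerivAt_prodMk_left x t))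
  have h5 : HasFDerivAt (fun y ↦ X (φ (y, t), t))
      (fderiv ℝ X (φ (x, t), t) ∘L ((fderiv ℝ φ (x, t) ∘L ContinuousLinearMap.inl ℝ E ℝ).prod 0))
      x := by
    have h6 := HasFDerivAt.comp (f := fun y : E ↦ (y, t)) x (hφd x hx t ht)
      (hasFDerivAt_prodMk_left x t)
    exact HasFDerivAt.comp (f := fun y : E ↦ (φ (y, t), t)) x hXd.hasFDerivAt
      (h6.prodMk (hasFDerivAt_const t x))
  have h6 : (fun y ↦ fderiv ℝ φ (y, t) (0, 1)) =ᶠ[𝓝 x] fun y ↦ X (φ (y, t), t) := by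
    filter_upwards [hU.mem_nhds hx] with y hy
    have := HasFDerivAt.comp_hasDerivAt (f := fun s : ℝ ↦ (y, s)) t (hφd y hy t ht)
      ((hasDerivAt_const t y).prodMk (hasDerivAt_id t))
    exact this.unique (hX y hy t ht)
  have h7 := h4.unique (h5.congr_of_eventuallyEq h6)
  have h8 := DFunLike.congr_fun h7 v
  simp only [ContinuousLinearMap.comp_apply, ContinuousLinearMap.inl_apply,
    ContinuousLinearMap.apply_apply, ContinuousLinearMap.prod_apply,
    zero_apply] at h8
  exact h8.symm

/-- **Moser's argument**: the flow of `X` transports `σ_0` to `σ_1` if `σ_t` is closed,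
`∂_t σ_t = dθ` and `σ_t(X_t, ·) = -θ`. -/
theorem moser_pullback {φ X : E × ℝ → E} {U B : Set E} {I : Set ℝ} (hU : IsOpen U)
    (hB : IsOpen B) (hI : IsOpen I) (hI01 : Icc 0 1 ⊆ I)
    (hφ : ContDiffOn ℝ ∞ φ (U ×ˢ I))
    (hφX : ∀ x ∈ U, ∀ t ∈ I, HasDerivAt (fun t ↦ φ (x, t)) (X (φ (x, t), t)) t)
    (hφ0 : ∀ x ∈ U, φ (x, 0) = x) (hφB : ∀ x ∈ U, ∀ t ∈ Icc (0 : ℝ) 1, φ (x, t) ∈ B)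
    (hXd : Differentiable ℝ X)
    {σ : E × ℝ → E [⋀^Fin 2]→L[ℝ] ℝ} (hσ : ContDiffOn ℝ ∞ σ (B ×ˢ univ))
    (hcl : ∀ t, ∀ x ∈ B, extDeriv (fun y ↦ σ (y, t)) x = 0)
    {θ : E → E [⋀^Fin 1]→L[ℝ] ℝ} (hθ : ContDiffOn ℝ ∞ θ B)
    (hσt : ∀ t, ∀ x ∈ B, HasDerivAt (fun t ↦ σ (x, t)) (extDeriv θ x) t)
    (hσX : ∀ t ∈ Icc (0 : ℝ) 1, ∀ x ∈ B, ∀ w, σ (x, t) ![X (x, t), w] = -θ x ![w])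
    {x : E} (hx : x ∈ U) :
    (σ (φ (x, 1), 1)).compContinuousLinearMap (fderiv ℝ (fun y ↦ φ (y, 1)) x) = σ (x, 0) := by
  have hUI : IsOpen (U ×ˢ I) := hU.prod hI
  have hBu : IsOpen (B ×ˢ (univ : Set ℝ)) := hB.prod isOpen_univ
  have hpart : ∀ t ∈ I, fderiv ℝ (fun y ↦ φ (y, t)) x =
      fderiv ℝ φ (x, t) ∘L ContinuousLinearMap.inl ℝ E ℝ := fun t ht ↦
    (HasFDerivAt.comp (f := fun y : E ↦ (y, t)) x
      ((hφ.contDiffAt (hUI.mem_nhds (mk_mem_prod hx ht))).differentiableAt (by simp)).hasFDerivAt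
      (hasFDerivAt_prodMk_left x t)).fderiv
  ext vw
  set v := vw 0
  set w := vw 1
  have hvw : vw = ![v, w] := by ext i; fin_cases i <;> rfl
  -- The pulled-back form `φ_t^* σ_t` evaluated on fixed vectors; it suffices that this is constant
  -- on `[0, 1]`.
  set h : ℝ → ℝ := fun t ↦ flat E (σ (φ (x, t), t)) (fderiv ℝ φ (x, t) (v, 0))
    (fderiv ℝ φ (x, t) (w, 0)) with hh
  have hder : ∀ t ∈ Icc (0 : ℝ) 1, HasDerivAt h 0 t := by
    intro t ht
    have htI := hI01 ht
    set y := φ (x, t) with hy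
    have hyB : y ∈ B := hφB x hx t ht
    set a := fderiv ℝ φ (x, t) (v, 0) with ha
    set b := fderiv ℝ φ (x, t) (w, 0) with hb
    have da := hasDerivAt_fderiv_flow hU hI hφ hφX hx htI (hXd _) v
    have db := hasDerivAt_fderiv_flow hU hI hφ hφX hx htI (hXd _) w
    rw [← hy, ← ha] at da
    rw [← hy, ← hb] at db
    set Z := X (y, t) with hZ
    set DX : E →L[ℝ] E := fderiv ℝ X (y, t) ∘L ContinuousLinearMap.inl ℝ E ℝ with hDX
    have hσd : HasFDerivAt σ (fderiv ℝ σ (y, t)) (y, t) :=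
      ((hσ.contDiffAt (hBu.mem_nhds (mk_mem_prod hyB (mem_univ t)))).differentiableAt
        (by simp)).hasFDerivAt
    have dσ : HasDerivAt (fun t ↦ σ (φ (x, t), t)) (fderiv ℝ σ (y, t) (Z, 1)) t :=
      HasFDerivAt.comp_hasDerivAt (f := fun t : ℝ ↦ (φ (x, t), t)) t hσd
        ((hφX x hx t htI).prodMk (hasDerivAt_id t))
    set D : E →L[ℝ] E [⋀^Fin 2]→L[ℝ] ℝ := fderiv ℝ σ (y, t) ∘L ContinuousLinearMap.inl ℝ E ℝ
      with hD
    have hDd : HasFDerivAt (fun y ↦ σ (y, t)) D y :=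
      HasFDerivAt.comp (f := fun y : E ↦ (y, t)) y hσd (hasFDerivAt_prodMk_left y t)
    have ht' : fderiv ℝ σ (y, t) (0, 1) = extDeriv θ y :=
      (HasFDerivAt.comp_hasDerivAt (f := fun s : ℝ ↦ (y, s)) t hσd
        ((hasDerivAt_const t y).prodMk (hasDerivAt_id t))).unique (hσt t y hyB)
    have hsum : fderiv ℝ σ (y, t) (Z, 1) = D Z + extDeriv θ y := by
      rw [← ht', hD]
      simp only [ContinuousLinearMap.comp_apply, ContinuousLinearMap.inl_apply, ← map_add]
      simp
    rw [hsum] at dσ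
    have dflat := HasDerivAt.clm_map (G := E →L[ℝ] E →L[ℝ] ℝ) dσ (flat E)
    have dh := (dflat.clm_apply da).clm_apply db
    have hθd : HasFDerivAt θ (fderiv ℝ θ y) y :=
      ((hθ.contDiffAt (hB.mem_nhds hyB)).differentiableAt (by simp)).hasFDerivAt
    -- The spatial derivative of `σ_t(X_t, ·) = -θ` in the direction `p`.
    have hder : ∀ p q : E, flat E (D p) Z q + flat E (σ (y, t)) (DX p) q =
        -fderiv ℝ θ y p ![q] := by
      intro p q
      have e1 : HasFDerivAt (fun y ↦ flat E (σ (y, t)) (X (y, t))) _ y :=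
        (HasFDerivAt.clm_map (G := E →L[ℝ] E →L[ℝ] ℝ) hDd (flat E)).clm_apply
          (HasFDerivAt.comp (f := fun y : E ↦ (y, t)) y (hXd (y, t)).hasFDerivAt
            (hasFDerivAt_prodMk_left y t))
      have e2 : HasFDerivAt (fun y ↦ -covector E (θ y)) (-(covector E ∘L fderiv ℝ θ y)) y :=
        (HasFDerivAt.clm_map (G := E →L[ℝ] ℝ) hθd (covector E)).neg
      have e3 : (fun y ↦ flat E (σ (y, t)) (X (y, t))) =ᶠ[𝓝 y] fun y ↦ -covector E (θ y) := by
        filter_upwards [hB.mem_nhds hyB] with y' hy'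
        ext q
        rw [flat_apply, hσX t ht y' hy']
        simp [covector_apply]
      have e4 := e1.unique (e2.congr_of_eventuallyEq e3)
      have e5 := DFunLike.congr_fun (DFunLike.congr_fun e4 p) q
      simp only [add_apply, ContinuousLinearMap.comp_apply,
        ContinuousLinearMap.flip_apply, neg_apply, covector_apply] at e5
      rw [add_comm] at e5
      exact e5
    have hclosed : D Z ![a, b] - D a ![Z, b] + D b ![Z, a] = 0 := by
      rw [← alternatizeUncurryFin_two, ← hDd.fderiv]
      exact DFunLike.congr_fun (hcl t y hyB) _
    have hext : flat E (extDeriv θ y) a b = fderiv ℝ θ y a ![b] - fderiv ℝ θ y b ![a] :=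
      (flat_apply _ _ _).trans (alternatizeUncurryFin_one _ a b)
    convert! dh using 1
    -- Here `dh/dt = (D Z)(a, b) + dθ(a, b) + σ(DX a, b) + σ(a, DX b)`. Closedness replaces `(D
    -- Z)(a, b)` by `(D a)(Z, b) - (D b)(Z, a)`; then `f1` and `f2` turn everything except `dθ(a,
    -- b)` into `-dθ(a, b)`.
    have f1 := hder a b
    have f2 := hder b a
    have f3 := flat_swap (σ (y, t)) (DX b) a
    simp only [← flat_apply] at hclosed
    simp only [map_add, add_apply]
    have g1 : DX a = fderiv ℝ X (y, t) (a, 0) := rfl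
    have g2 : DX b = fderiv ℝ X (y, t) (b, 0) := rfl
    rw [← g1, ← g2, ← ha, ← hb, ← hy, hext]
    linarith
  have hconst := constant_of_has_deriv_right_zero (f := h) (a := 0) (b := 1)
    (fun t ht ↦ (hder t ht).continuousAt.continuousWithinAt)
    (fun t ht ↦ (hder t ⟨ht.1, ht.2.le⟩).hasDerivWithinAt) 1 (by simp)
  have h0 : fderiv ℝ φ (x, 0) ∘L ContinuousLinearMap.inl ℝ E ℝ = ContinuousLinearMap.id ℝ E := by
    rw [← hpart 0 (hI01 (by simp))]
    have : (fun y ↦ φ (y, 0)) =ᶠ[𝓝 x] id := by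
      filter_upwards [hU.mem_nhds hx] with y hy using hφ0 y hy
    rw [this.fderiv_eq, fderiv_id]
  have h0' : ∀ u, fderiv ℝ φ (x, 0) (u, 0) = u := fun u ↦ DFunLike.congr_fun h0 u
  simp only [hh, h0', hφ0 x hx, flat_apply] at hconst
  rw [hvw, ← hconst, ContinuousAlternatingMap.compContinuousLinearMap_apply,
    hpart 1 (hI01 (by simp))]
  congr 1
  ext i
  fin_cases i <;> rfl

end Moser

/-! ### Forms in charts and changes of chart. -/

section Charts

variable {E : Type*} [NormedAddCommGroup E] [NormedSpace ℝ E]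
  {M : Type*} [TopologicalSpace M] [ChartedSpace E M]

/-- The derivative of the chart at `x₀`, as a map `E → E`. -/
def chartD (E : Type*) [NormedAddCommGroup E] [NormedSpace ℝ E]
    {M : Type*} [TopologicalSpace M] [ChartedSpace E M] (x₀ x : M) : E →L[ℝ] E :=
  mfderiv 𝓘(ℝ, E) 𝓘(ℝ, E) (chartAt E x₀) x

/-- The derivative of the inverse of the chart at `x₀`, as a map `E → E`. -/
def symmD (x₀ : M) (y : E) : E →L[ℝ] E :=
  mfderiv 𝓘(ℝ, E) 𝓘(ℝ, E) (chartAt E x₀).symm y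

/-- The value of a form, as an alternating map on the model space. -/
def DiffForm.val {k : ℕ} (σ : DiffForm E M k) (x : M) : E [⋀^Fin k]→L[ℝ] ℝ := σ x

theorem DiffForm.inChart_eq {k : ℕ} (σ : DiffForm E M k) (x₀ : M) {y : E} {x : M}
    (h : (chartAt E x₀).symm y = x) :
    σ.inChart x₀ y = (σ.val x).compContinuousLinearMap (symmD x₀ y) := by
  subst h
  rfl

theorem DiffForm.inChart_chart {k : ℕ} (σ : DiffForm E M k) {x₀ x : M}
    (hx : x ∈ (chartAt E x₀).source) :
    σ.inChart x₀ (chartAt E x₀ x) =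
      (σ.val x).compContinuousLinearMap (symmD x₀ (chartAt E x₀ x)) :=
  σ.inChart_eq x₀ ((chartAt E x₀).left_inv hx)

variable [IsManifold 𝓘(ℝ, E) ∞ M]

theorem chartD_comp_symmD {x₀ x : M} (hx : x ∈ (chartAt E x₀).source) :
    chartD E x₀ x ∘L symmD x₀ (chartAt E x₀ x) = ContinuousLinearMap.id ℝ E := by
  have : IsManifold 𝓘(ℝ, E) 1 M := IsManifold.of_le (n := ∞) (by simp)
  have h := (mdifferentiable_chart (I := 𝓘(ℝ, E)) x₀).comp_symm_deriv
    ((chartAt E x₀).map_source hx)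
  rw [(chartAt E x₀).left_inv hx] at h
  exact h

theorem symmD_comp_chartD {x₀ x : M} (hx : x ∈ (chartAt E x₀).source) :
    symmD x₀ (chartAt E x₀ x) ∘L chartD E x₀ x = ContinuousLinearMap.id ℝ E := by
  have : IsManifold 𝓘(ℝ, E) 1 M := IsManifold.of_le (n := ∞) (by simp)
  exact (mdifferentiable_chart (I := 𝓘(ℝ, E)) x₀).symm_comp_deriv hx

theorem DiffForm.val_eq {k : ℕ} (σ : DiffForm E M k) {x₀ x : M}
    (hx : x ∈ (chartAt E x₀).source) :
    σ.val x = (σ.inChart x₀ (chartAt E x₀ x)).compContinuousLinearMap (chartD E x₀ x) := by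
  rw [σ.inChart_chart hx]
  ext v
  simp only [ContinuousAlternatingMap.compContinuousLinearMap_apply]
  congr 1
  ext i
  exact (DFunLike.congr_fun (symmD_comp_chartD hx) (v i)).symm

/-- The transition map from the chart at `x₀` to the chart at `x₁`. -/
def transition (E : Type*) [NormedAddCommGroup E]
    {M : Type*} [TopologicalSpace M] [ChartedSpace E M] (x₀ x₁ : M) (y : E) : E :=
  chartAt E x₁ ((chartAt E x₀).symm y)

omit [NormedSpace ℝ E] [IsManifold 𝓘(ℝ, E) ∞ M] in
theorem transition_chart {x₀ x₁ x : M} (hx : x ∈ (chartAt E x₀).source) :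
    transition E x₀ x₁ (chartAt E x₀ x) = chartAt E x₁ x := by
  rw [transition, (chartAt E x₀).left_inv hx]

theorem contDiffAt_transition {x₀ x₁ x : M} (h₀ : x ∈ (chartAt E x₀).source)
    (h₁ : x ∈ (chartAt E x₁).source) :
    ContDiffAt ℝ ∞ (transition E x₀ x₁) (chartAt E x₀ x) := by
  rw [← contMDiffAt_iff_contDiffAt]
  have e1 : ContMDiffAt 𝓘(ℝ, E) 𝓘(ℝ, E) ∞ (chartAt E x₀).symm (chartAt E x₀ x) :=
    contMDiffAt_symm_of_mem_maximalAtlas (IsManifold.chart_mem_maximalAtlas x₀)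
      ((chartAt E x₀).map_source h₀)
  have e2 : ContMDiffAt 𝓘(ℝ, E) 𝓘(ℝ, E) ∞ (chartAt E x₁)
      ((chartAt E x₀).symm (chartAt E x₀ x)) := by
    rw [(chartAt E x₀).left_inv h₀]
    exact contMDiffAt_of_mem_maximalAtlas (IsManifold.chart_mem_maximalAtlas x₁) h₁
  exact ContMDiffAt.comp _ e2 e1

theorem fderiv_transition {x₀ x₁ x : M} (h₀ : x ∈ (chartAt E x₀).source)
    (h₁ : x ∈ (chartAt E x₁).source) :
    fderiv ℝ (transition E x₀ x₁) (chartAt E x₀ x) =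
      chartD E x₁ x ∘L symmD x₀ (chartAt E x₀ x) := by
  have : IsManifold 𝓘(ℝ, E) 1 M := IsManifold.of_le (n := ∞) (by simp)
  have e1 := (mdifferentiable_chart (I := 𝓘(ℝ, E)) x₀).mdifferentiableAt_symm
    ((chartAt E x₀).map_source h₀)
  have e2 : MDifferentiableAt 𝓘(ℝ, E) 𝓘(ℝ, E) (chartAt E x₁)
      ((chartAt E x₀).symm (chartAt E x₀ x)) := by
    rw [(chartAt E x₀).left_inv h₀]
    exact (mdifferentiable_chart (I := 𝓘(ℝ, E)) x₁).mdifferentiableAt h₁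
  rw [← mfderiv_eq_fderiv]
  have h := mfderiv_comp (chartAt E x₀ x) e2 e1
  rw [(chartAt E x₀).left_inv h₀] at h
  exact h

theorem DiffForm.inChart_transition {k : ℕ} (σ : DiffForm E M k) {x₀ x₁ x : M}
    (h₀ : x ∈ (chartAt E x₀).source) (h₁ : x ∈ (chartAt E x₁).source) :
    σ.inChart x₀ (chartAt E x₀ x) =
      (σ.inChart x₁ (transition E x₀ x₁ (chartAt E x₀ x))).compContinuousLinearMap
        (fderiv ℝ (transition E x₀ x₁) (chartAt E x₀ x)) := by
  rw [transition_chart h₀, fderiv_transition h₀ h₁, σ.inChart_chart h₀, σ.val_eq h₁]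
  rfl

/-- The part of the chart domain at `x₀` (seen in the model space) that corresponds to `S`. -/
def chartSet (E : Type*) [NormedAddCommGroup E] {M : Type*} [TopologicalSpace M]
    [ChartedSpace E M] (x₀ : M) (S : Set M) : Set E :=
  (chartAt E x₀).target ∩ (chartAt E x₀).symm ⁻¹' S

omit [NormedSpace ℝ E] [IsManifold 𝓘(ℝ, E) ∞ M] in
theorem isOpen_chartSet (x₀ : M) {S : Set M} (hS : IsOpen S) : IsOpen (chartSet E x₀ S) :=
  (chartAt E x₀).isOpen_inter_preimage_symm hS

omit [NormedSpace ℝ E] [IsManifold 𝓘(ℝ, E) ∞ M] in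
theorem chart_mem_chartSet {x₀ x : M} {S : Set M} (hx : x ∈ (chartAt E x₀).source) (hS : x ∈ S) :
    chartAt E x₀ x ∈ chartSet E x₀ S :=
  ⟨(chartAt E x₀).map_source hx, by rwa [mem_preimage, (chartAt E x₀).left_inv hx]⟩

omit [NormedSpace ℝ E] [IsManifold 𝓘(ℝ, E) ∞ M] in
theorem exists_of_mem_chartSet {x₀ : M} {S : Set M} {y : E} (hy : y ∈ chartSet E x₀ S) :
    ∃ x ∈ (chartAt E x₀).source, x ∈ S ∧ chartAt E x₀ x = y :=
  ⟨_, (chartAt E x₀).map_target hy.1, hy.2, (chartAt E x₀).right_inv hy.1⟩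

end Charts

/-! ### Smooth families of forms and the exterior derivative. -/

section Families

variable {E : Type*} [NormedAddCommGroup E] [NormedSpace ℝ E]
  {M : Type*} [TopologicalSpace M] [ChartedSpace E M]

/-- A family of forms that is jointly smooth over a subset `S` of the manifold. -/
def SmoothFamilyOn {k : ℕ} (σ : ℝ → DiffForm E M k) (S : Set M) : Prop :=
  ∀ x₀ : M, ContDiffOn ℝ ∞ (fun p : E × ℝ ↦ (σ p.2).inChart x₀ p.1) (chartSet E x₀ S ×ˢ univ)

/-- A form that is smooth over a subset `S` of the manifold. -/
def SmoothFormOn {k : ℕ} (σ : DiffForm E M k) (S : Set M) : Prop :=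
  ∀ x₀ : M, ContDiffOn ℝ ∞ (σ.inChart x₀) (chartSet E x₀ S)

variable {k : ℕ} {σ τ : ℝ → DiffForm E M k} {S T : Set M}

theorem smoothFamilyOn_univ : SmoothFamilyOn σ univ ↔ IsSmoothFormFamily σ := by
  simp [SmoothFamilyOn, IsSmoothFormFamily, chartSet]

theorem smoothFormOn_univ {σ : DiffForm E M k} : SmoothFormOn σ univ ↔ σ.IsSmooth := by
  simp [SmoothFormOn, DiffForm.IsSmooth, chartSet]

theorem SmoothFamilyOn.mono (h : SmoothFamilyOn σ S) (hT : T ⊆ S) : SmoothFamilyOn σ T :=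
  fun x₀ ↦ (h x₀).mono (prod_mono (inter_subset_inter_right _ (preimage_mono hT)) subset_rfl)

theorem SmoothFormOn.mono {σ : DiffForm E M k} (h : SmoothFormOn σ S) (hT : T ⊆ S) :
    SmoothFormOn σ T :=
  fun x₀ ↦ (h x₀).mono (inter_subset_inter_right _ (preimage_mono hT))

theorem SmoothFamilyOn.slice (h : SmoothFamilyOn σ S) (ε : ℝ) : SmoothFormOn (σ ε) S :=
  fun x₀ ↦ (h x₀).comp (f := fun y ↦ (y, ε)) (by fun_prop) (fun _ hy ↦ ⟨hy, mem_univ _⟩)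

theorem SmoothFormOn.family {σ : DiffForm E M k} (h : SmoothFormOn σ S) :
    SmoothFamilyOn (fun _ ↦ σ) S :=
  fun x₀ ↦ (h x₀).comp (f := fun p : E × ℝ ↦ p.1) (by fun_prop) (fun _ hy ↦ hy.1)

theorem inChart_congr {σ τ : DiffForm E M k} {x₀ : M} {y : E}
    (h : σ ((chartAt E x₀).symm y) = τ ((chartAt E x₀).symm y)) :
    σ.inChart x₀ y = τ.inChart x₀ y := by
  rw [DiffForm.inChart, DiffForm.inChart, h]

theorem SmoothFamilyOn.add (hσ : SmoothFamilyOn σ S) (hτ : SmoothFamilyOn τ S) :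
    SmoothFamilyOn (fun ε ↦ σ ε + τ ε) S := fun x₀ ↦ (hσ x₀).add (hτ x₀)

theorem SmoothFamilyOn.sub (hσ : SmoothFamilyOn σ S) (hτ : SmoothFamilyOn τ S) :
    SmoothFamilyOn (fun ε ↦ σ ε - τ ε) S := fun x₀ ↦ (hσ x₀).sub (hτ x₀)

theorem smoothFamilyOn_zero : SmoothFamilyOn (fun _ ↦ (0 : DiffForm E M k)) S := fun x₀ ↦ by
  have : (fun p : E × ℝ ↦ (0 : DiffForm E M k).inChart x₀ p.1) = fun _ ↦ 0 := by
    ext p v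
    rfl
  rw [this]
  exact contDiffOn_const

theorem SmoothFamilyOn.sum {ι : Type*} {s : Finset ι} {σ : ι → ℝ → DiffForm E M k}
    (h : ∀ i ∈ s, SmoothFamilyOn (σ i) S) : SmoothFamilyOn (fun ε ↦ ∑ i ∈ s, σ i ε) S := by
  classical
  induction s using Finset.induction_on with
  | empty => simpa using smoothFamilyOn_zero
  | insert i s hi ih =>
    simp only [Finset.sum_insert hi]
    exact (h i (by simp)).add (ih fun j hj ↦ h j (by simp [hj]))

theorem SmoothFamilyOn.congr (hσ : SmoothFamilyOn σ S) (h : ∀ ε, ∀ x ∈ S, τ ε x = σ ε x) :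
    SmoothFamilyOn τ S :=
  fun x₀ ↦ (hσ x₀).congr fun p hp ↦ inChart_congr (h p.2 _ hp.1.2)

theorem SmoothFamilyOn.of_locally (h : ∀ x ∈ S, ∃ T, IsOpen T ∧ x ∈ T ∧ SmoothFamilyOn σ T) :
    SmoothFamilyOn σ S := by
  rintro x₀ ⟨y, ε⟩ ⟨hy, -⟩
  obtain ⟨x, hx, hxS, rfl⟩ := exists_of_mem_chartSet hy
  obtain ⟨T, hT, hxT, hσ⟩ := h x hxS
  refine ((hσ x₀).contDiffAt (((isOpen_chartSet x₀ hT).prod isOpen_univ).mem_nhds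
    ⟨chart_mem_chartSet hx hxT, mem_univ _⟩)).contDiffWithinAt

theorem SmoothFormOn.sub {σ τ : DiffForm E M k} (hσ : SmoothFormOn σ S) (hτ : SmoothFormOn τ S) :
    SmoothFormOn (σ - τ) S := fun x₀ ↦ (hσ x₀).sub (hτ x₀)

theorem SmoothFormOn.const_smul {σ : DiffForm E M k} (hσ : SmoothFormOn σ S) (c : ℝ) :
    SmoothFormOn (c • σ) S := fun x₀ ↦ (contDiff_const_smul c).comp_contDiffOn (hσ x₀)

theorem SmoothFormOn.differentiableAt {σ : DiffForm E M k} (hS : IsOpen S) (h : SmoothFormOn σ S)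
    {x₀ x : M} (hx : x ∈ (chartAt E x₀).source) (hxS : x ∈ S) :
    DifferentiableAt ℝ (σ.inChart x₀) (chartAt E x₀ x) :=
  ((h x₀).contDiffAt ((isOpen_chartSet x₀ hS).mem_nhds
    (chart_mem_chartSet hx hxS))).differentiableAt (by simp)

variable [IsManifold 𝓘(ℝ, E) ∞ M]

theorem contDiffOn_symm_comp {f : M → ℝ} (hf : ContMDiff 𝓘(ℝ, E) 𝓘(ℝ, ℝ) ∞ f) (x₀ : M) :
    ContDiffOn ℝ ∞ (fun y ↦ f ((chartAt E x₀).symm y)) (chartAt E x₀).target := by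
  rw [← contMDiffOn_iff_contDiffOn]
  exact hf.comp_contMDiffOn (contMDiffOn_symm_of_mem_maximalAtlas
    (IsManifold.chart_mem_maximalAtlas x₀))

theorem SmoothFamilyOn.smul {f : M → ℝ} (hf : ContMDiff 𝓘(ℝ, E) 𝓘(ℝ, ℝ) ∞ f)
    (hσ : SmoothFamilyOn σ S) :
    SmoothFamilyOn (fun ε x ↦ f x • σ ε x) S := fun x₀ ↦ by
  refine ContDiffOn.smul (f := fun p : E × ℝ ↦ f ((chartAt E x₀).symm p.1)) ?_ (hσ x₀)
  exact (contDiffOn_symm_comp hf x₀).comp (f := fun p : E × ℝ ↦ p.1) (by fun_prop)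
    (fun p hp ↦ hp.1.1)

/-- In another chart the family is pulled back by a smooth transition map that does not involve `ε`,
so joint smoothness in one chart suffices. -/
theorem SmoothFamilyOn.of_chart [FiniteDimensional ℝ E] {x₁ : M} (hS : IsOpen S)
    (hSs : S ⊆ (chartAt E x₁).source)
    (h : ContDiffOn ℝ ∞ (fun p : E × ℝ ↦ (σ p.2).inChart x₁ p.1) (chartSet E x₁ S ×ˢ univ)) :
    SmoothFamilyOn σ S := by
  rintro x₀ ⟨y, ε⟩ ⟨hy, -⟩
  obtain ⟨x, hx, hxS, rfl⟩ := exists_of_mem_chartSet hy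
  have hx1 := hSs hxS
  have hat : ContDiffAt ℝ ∞ (fun p : E × ℝ ↦
      ((σ p.2).inChart x₁ (transition E x₀ x₁ p.1)).compContinuousLinearMap
        (fderiv ℝ (transition E x₀ x₁) p.1)) (chartAt E x₀ x, ε) := by
    have ht := contDiffAt_transition hx hx1
    have h1 : ContDiffAt ℝ ∞ (fun p : E × ℝ ↦ (σ p.2).inChart x₁ (transition E x₀ x₁ p.1))
        (chartAt E x₀ x, ε) := by
      have h2 : ContDiffAt ℝ ∞ (fun p : E × ℝ ↦ (transition E x₀ x₁ p.1, p.2))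
          (chartAt E x₀ x, ε) :=
        (ContDiffAt.comp (chartAt E x₀ x, ε) (f := fun p : E × ℝ ↦ p.1) ht contDiffAt_fst).prodMk
          contDiffAt_snd
      refine ContDiffAt.comp (g := fun p : E × ℝ ↦ (σ p.2).inChart x₁ p.1)
        (chartAt E x₀ x, ε) ?_ h2
      refine h.contDiffAt (((isOpen_chartSet x₁ hS).prod isOpen_univ).mem_nhds ⟨?_, mem_univ _⟩)
      simp only [transition_chart hx]
      exact chart_mem_chartSet hx1 hxS
    have h2 : ContDiffAt ℝ ∞ (fun p : E × ℝ ↦ fderiv ℝ (transition E x₀ x₁) p.1)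
        (chartAt E x₀ x, ε) :=
      ContDiffAt.comp (chartAt E x₀ x, ε) (f := fun p : E × ℝ ↦ p.1)
        (ht.fderiv_right (by simp)) contDiffAt_fst
    exact (contDiff_compContinuousLinearMap k).contDiffAt.comp (chartAt E x₀ x, ε)
      (h1.prodMk h2)
  refine (hat.congr_of_eventuallyEq ?_).contDiffWithinAt
  have hnhds : chartSet E x₀ S ×ˢ univ ∈ 𝓝 (chartAt E x₀ x, ε) :=
    ((isOpen_chartSet x₀ hS).prod isOpen_univ).mem_nhds ⟨hy, mem_univ _⟩
  filter_upwards [hnhds] with p hp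
  obtain ⟨x', hx', hx'S, hp1⟩ := exists_of_mem_chartSet hp.1
  rw [← hp1]
  exact (σ p.2).inChart_transition hx' (hSs hx'S)

section ExteriorDerivative

omit [IsManifold 𝓘(ℝ, E) ∞ M] in
theorem DiffForm.d_val (σ : DiffForm E M k) (x : M) :
    σ.d.val x = (extDeriv (σ.inChart x) (chartAt E x x)).compContinuousLinearMap
      (chartD E x x) := rfl

/-- The exterior derivative can be computed in any chart. -/
theorem DiffForm.inChart_d {σ : DiffForm E M k} (hS : IsOpen S) (hσ : SmoothFormOn σ S)
    {x₀ x : M} (hx : x ∈ (chartAt E x₀).source) (hxS : x ∈ S) :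
    σ.d.inChart x₀ (chartAt E x₀ x) = extDeriv (σ.inChart x₀) (chartAt E x₀ x) := by
  have hxx := mem_chart_source E x
  have h1 : σ.d.inChart x₀ (chartAt E x₀ x) =
      (extDeriv (σ.inChart x) (transition E x₀ x (chartAt E x₀ x))).compContinuousLinearMap
        (fderiv ℝ (transition E x₀ x) (chartAt E x₀ x)) := by
    rw [DiffForm.inChart_chart _ hx, σ.d_val, transition_chart hx, fderiv_transition hx hxx]
    rfl
  rw [h1, ← extDeriv_pullback (r := ∞)]
  · refine Filter.EventuallyEq.extDeriv_eq ?_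
    filter_upwards [(isOpen_chartSet x₀ ((chartAt E x).open_source)).mem_nhds
      (chart_mem_chartSet hx hxx)] with y hy
    obtain ⟨x', hx', hx'S, rfl⟩ := exists_of_mem_chartSet hy
    exact (σ.inChart_transition hx' hx'S).symm
  · rw [transition_chart hx]
    exact hσ.differentiableAt hS hxx hxS
  · exact contDiffAt_transition hx hxx
  · simpa using ENat.LEInfty.out

omit [IsManifold 𝓘(ℝ, E) ∞ M] in
theorem DiffForm.d_congr {σ τ : DiffForm E M k} (hS : IsOpen S) (h : ∀ x ∈ S, σ x = τ x) {x : M}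
    (hx : x ∈ S) : σ.d x = τ.d x := by
  have h1 : extDeriv (σ.inChart x) (chartAt E x x) = extDeriv (τ.inChart x) (chartAt E x x) := by
    refine Filter.EventuallyEq.extDeriv_eq ?_
    filter_upwards [(isOpen_chartSet x hS).mem_nhds
      (chart_mem_chartSet (mem_chart_source E x) hx)] with y hy
    exact inChart_congr (h _ hy.2)
  rw [DiffForm.d, DiffForm.d, h1]

omit [IsManifold 𝓘(ℝ, E) ∞ M] in
theorem DiffForm.d_add {σ τ : DiffForm E M k} (hS : IsOpen S) (hσ : SmoothFormOn σ S)
    (hτ : SmoothFormOn τ S) {x : M} (hx : x ∈ S) : (σ + τ).d x = σ.d x + τ.d x := by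
  have hxx := mem_chart_source E x
  have h1 := extDeriv_add (hσ.differentiableAt hS hxx hx) (hτ.differentiableAt hS hxx hx)
  have h2 : (σ + τ).inChart x = σ.inChart x + τ.inChart x := rfl
  rw [DiffForm.d, h2, h1]
  rfl

omit [IsManifold 𝓘(ℝ, E) ∞ M] in
theorem DiffForm.d_sub {σ τ : DiffForm E M k} (hS : IsOpen S) (hσ : SmoothFormOn σ S)
    (hτ : SmoothFormOn τ S) {x : M} (hx : x ∈ S) : (σ - τ).d x = σ.d x - τ.d x := by
  have h := DiffForm.d_add hS (hσ.sub hτ) hτ hx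
  rw [sub_add_cancel] at h
  rw [h, add_sub_cancel_right]

theorem contDiffOn_extDeriv_family {f : E × ℝ → E [⋀^Fin k]→L[ℝ] ℝ} {U : Set E} (hU : IsOpen U)
    (hf : ContDiffOn ℝ ∞ f (U ×ˢ univ)) :
    ContDiffOn ℝ ∞ (fun p : E × ℝ ↦ extDeriv (fun y ↦ f (y, p.2)) p.1) (U ×ˢ univ) := by
  have hUu : IsOpen (U ×ˢ (univ : Set ℝ)) := hU.prod isOpen_univ
  have h1 : ContDiffOn ℝ ∞ (fderiv ℝ f) (U ×ˢ univ) :=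
    ((contDiffOn_infty_iff_fderiv_of_isOpen hUu).1 hf).2
  have h2 : ContDiffOn ℝ ∞ (fun p ↦ fderiv ℝ f p ∘L ContinuousLinearMap.inl ℝ E ℝ) (U ×ˢ univ) :=
    h1.clm_comp contDiffOn_const
  have h3 := contDiffOn_clm_map (F := E →L[ℝ] E [⋀^Fin k]→L[ℝ] ℝ)
    (G := E [⋀^Fin (k + 1)]→L[ℝ] ℝ) h2
    (ContinuousAlternatingMap.alternatizeUncurryFinCLM ℝ E ℝ)
  refine h3.congr fun p hp ↦ ?_
  have h4 : HasFDerivAt (fun y ↦ f (y, p.2)) (fderiv ℝ f p ∘L ContinuousLinearMap.inl ℝ E ℝ) p.1 :=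
    HasFDerivAt.comp (f := fun y : E ↦ (y, p.2)) p.1
      ((hf.contDiffAt (hUu.mem_nhds hp)).differentiableAt (by simp)).hasFDerivAt
      (hasFDerivAt_prodMk_left p.1 p.2)
  rw [extDeriv, h4.fderiv]
  rfl

theorem SmoothFamilyOn.d (hS : IsOpen S) (hσ : SmoothFamilyOn σ S) :
    SmoothFamilyOn (fun ε ↦ (σ ε).d) S := fun x₀ ↦ by
  refine (contDiffOn_extDeriv_family (isOpen_chartSet x₀ hS) (hσ x₀)).congr fun p hp ↦ ?_
  obtain ⟨x, hx, hxS, hp1⟩ := exists_of_mem_chartSet hp.1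
  change (σ p.2).d.inChart x₀ p.1 = extDeriv ((σ p.2).inChart x₀) p.1
  rw [← hp1]
  exact DiffForm.inChart_d hS (hσ.slice p.2) hx hxS

theorem DiffForm.d_d {σ : DiffForm E M k} (hS : IsOpen S) (hσ : SmoothFormOn σ S) {x : M}
    (hx : x ∈ S) : σ.d.d x = 0 := by
  have hxx := mem_chart_source E x
  have h1 : extDeriv (σ.d.inChart x) (chartAt E x x) = 0 := by
    have h2 : σ.d.inChart x =ᶠ[𝓝 (chartAt E x x)] extDeriv (σ.inChart x) := by
      filter_upwards [(isOpen_chartSet x hS).mem_nhds (chart_mem_chartSet hxx hx)] with y hy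
      obtain ⟨x', hx', hx'S, rfl⟩ := exists_of_mem_chartSet hy
      exact DiffForm.inChart_d hS hσ hx' hx'S
    rw [h2.extDeriv_eq]
    exact extDeriv_extDeriv_apply (r := ∞) ((hσ x).contDiffAt ((isOpen_chartSet x hS).mem_nhds
      (chart_mem_chartSet hxx hx))) (by simpa using ENat.LEInfty.out)
  rw [DiffForm.d, h1]
  rfl

end ExteriorDerivative

section FormOfChart

/-- The form with a given expression in the chart at `x₀`. -/
def formOfChart (x₀ : M) (η : E → E [⋀^Fin k]→L[ℝ] ℝ) : DiffForm E M k := fun x ↦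
  (η (chartAt E x₀ x)).compContinuousLinearMap (chartD E x₀ x)

theorem inChart_formOfChart {x₀ x : M} (η : E → E [⋀^Fin k]→L[ℝ] ℝ)
    (hx : x ∈ (chartAt E x₀).source) :
    (formOfChart x₀ η).inChart x₀ (chartAt E x₀ x) = η (chartAt E x₀ x) := by
  rw [DiffForm.inChart_chart _ hx]
  ext v
  change η (chartAt E x₀ x) (fun i ↦ chartD E x₀ x (symmD x₀ (chartAt E x₀ x) (v i))) = _
  congr 1
  ext i
  exact DFunLike.congr_fun (chartD_comp_symmD hx) (v i)

/-- The preimage of a ball under the chart at `x₀`. -/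
def chartBall (E : Type*) [NormedAddCommGroup E] {M : Type*} [TopologicalSpace M]
    [ChartedSpace E M] (x₀ : M) (r : ℝ) : Set M :=
  (chartAt E x₀).source ∩ chartAt E x₀ ⁻¹' Metric.ball (chartAt E x₀ x₀) r

omit [NormedSpace ℝ E] [IsManifold 𝓘(ℝ, E) ∞ M] in
theorem isOpen_chartBall (x₀ : M) (r : ℝ) : IsOpen (chartBall E x₀ r) :=
  (chartAt E x₀).isOpen_inter_preimage Metric.isOpen_ball

omit [NormedSpace ℝ E] [IsManifold 𝓘(ℝ, E) ∞ M] in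
theorem chartSet_chartBall {x₀ : M} {r : ℝ}
    (h : Metric.ball (chartAt E x₀ x₀) r ⊆ (chartAt E x₀).target) :
    chartSet E x₀ (chartBall E x₀ r) = Metric.ball (chartAt E x₀ x₀) r := by
  ext y
  constructor
  · intro hy
    obtain ⟨x, -, hx, rfl⟩ := exists_of_mem_chartSet hy
    exact hx.2
  · intro hy
    refine ⟨h hy, (chartAt E x₀).map_target (h hy), ?_⟩
    rwa [mem_preimage, (chartAt E x₀).right_inv (h hy)]

end FormOfChart

end Families

/-! ### The Poincaré lemma on coordinate balls. -/

section PoincareManifold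

universe u

variable {E : Type u} [NormedAddCommGroup E] [NormedSpace ℝ E] [FiniteDimensional ℝ E]
  {M : Type*} [TopologicalSpace M] [ChartedSpace E M] [IsManifold 𝓘(ℝ, E) ∞ M] {k : ℕ}

/-- **Poincaré lemma** for a smooth family of closed forms on a coordinate ball. -/
theorem SmoothFamilyOn.exists_primitive {σ : ℝ → DiffForm E M (k + 1)} {x₀ : M} {r : ℝ}
    (hr : Metric.ball (chartAt E x₀ x₀) r ⊆ (chartAt E x₀).target)
    (hσ : SmoothFamilyOn σ (chartBall E x₀ r))
    (hcl : ∀ ε, ∀ x ∈ chartBall E x₀ r, (σ ε).d x = 0) :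
    ∃ α : ℝ → DiffForm E M k, SmoothFamilyOn α (chartBall E x₀ r) ∧
      ∀ ε, ∀ x ∈ chartBall E x₀ r, (α ε).d x = σ ε x := by
  have hS := isOpen_chartBall (E := E) x₀ r
  have h0 := hσ x₀
  rw [chartSet_chartBall hr] at h0
  have hball : ∀ y ∈ Metric.ball (chartAt E x₀ x₀) r, ∃ x ∈ (chartAt E x₀).source,
      x ∈ chartBall E x₀ r ∧ chartAt E x₀ x = y := fun y hy ↦
    exists_of_mem_chartSet ((chartSet_chartBall hr).symm ▸ hy)
  obtain ⟨a, ha, had⟩ := BarelySymplectic.exists_smooth_primitive h0 (fun ε y hy ↦ by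
    obtain ⟨x, hx, hxS, rfl⟩ := hball y hy
    change extDeriv ((σ ε).inChart x₀) _ = 0
    rw [← DiffForm.inChart_d hS (hσ.slice ε) hx hxS, DiffForm.inChart_chart _ hx]
    have : (σ ε).d.val x = 0 := hcl ε x hxS
    rw [this]
    rfl)
  have hchart : ∀ ε, ∀ y ∈ Metric.ball (chartAt E x₀ x₀) r,
      (formOfChart (M := M) x₀ fun y ↦ a (y, ε)).inChart x₀ y = a (y, ε) := by
    intro ε y hy
    obtain ⟨x, hx, hxS, rfl⟩ := hball y hy
    exact inChart_formOfChart (fun y ↦ a (y, ε)) hx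
  have hα : SmoothFamilyOn (fun ε ↦ formOfChart (M := M) x₀ fun y ↦ a (y, ε))
      (chartBall E x₀ r) := by
    refine SmoothFamilyOn.of_chart hS inter_subset_left ?_
    rw [chartSet_chartBall hr]
    exact ha.congr fun p hp ↦ hchart p.2 p.1 hp.1
  refine ⟨_, hα, fun ε x hx ↦ ?_⟩
  have hxb : chartAt E x₀ x ∈ Metric.ball (chartAt E x₀ x₀) r := hx.2
  change (DiffForm.d _).val x = (σ ε).val x
  rw [DiffForm.val_eq _ hx.1, DiffForm.val_eq (σ ε) hx.1,
    DiffForm.inChart_d hS (hα.slice ε) hx.1 hx, ← had ε _ hxb]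
  congr 1
  refine Filter.EventuallyEq.extDeriv_eq ?_
  filter_upwards [Metric.isOpen_ball.mem_nhds hxb] with y hy using hchart ε y hy

end PoincareManifold

/-! ### Good covers. -/

section Cover

/-- Take a Lebesgue entourage `D` of the cover and halve it twice. If the `D₂`-balls about `x` and
`y` meet, then `x` and `y` are `D₁`-close, so every point of the second ball is `D`-close to `x`. -/
theorem exists_star_refinement {M ι : Type*} [TopologicalSpace M] [T2Space M] [CompactSpace M]
    {O : ι → Set M} (hO : ∀ i, IsOpen (O i)) (hcov : ∀ x, ∃ i, x ∈ O i) :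
    ∃ (i : M → ι) (N : M → Set M), (∀ x, N x ∈ 𝓝 x) ∧
      ∀ x y, (N x ∩ N y).Nonempty → N y ⊆ O (i x) := by
  let _ : UniformSpace M := uniformSpaceOfCompactR1
  obtain ⟨D, hD, hDO⟩ := lebesgue_number_lemma isCompact_univ hO
    (fun x _ ↦ mem_iUnion.2 (hcov x))
  obtain ⟨D₁, hD₁, hs₁, hc₁⟩ := comp_symm_mem_uniformity_sets hD
  obtain ⟨D₂, hD₂, hs₂, hc₂⟩ := comp_symm_mem_uniformity_sets hD₁
  choose i hi using fun x ↦ hDO x (mem_univ x)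
  refine ⟨i, fun x ↦ UniformSpace.ball x D₂, fun x ↦ UniformSpace.ball_mem_nhds x hD₂, ?_⟩
  rintro x y ⟨z, hxz, hyz⟩ w hw
  refine hi x (hc₁ ?_)
  refine ⟨y, hc₂ ⟨z, hxz, ?_⟩, ?_⟩
  · exact hs₂.symm _ _ hyz
  · exact hc₂ ⟨y, refl_mem_uniformity hD₂, hw⟩

variable {E : Type*} [NormedAddCommGroup E] {M : Type*} [TopologicalSpace M] [ChartedSpace E M]

theorem chartBall_mono (x : M) {r s : ℝ} (h : r ≤ s) : chartBall E x r ⊆ chartBall E x s :=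
  fun _ hy ↦ ⟨hy.1, Metric.ball_subset_ball h hy.2⟩

theorem mem_chartBall_self (x : M) {r : ℝ} (h : 0 < r) : x ∈ chartBall E x r :=
  ⟨mem_chart_source E x, Metric.mem_ball_self h⟩

variable (E M) in
/-- A finite cover of a compact manifold by half-sized coordinate balls, such that coordinate balls
which meet are contained in a common larger coordinate ball. -/
structure GoodCover where
  (I : Finset M)
  (r : M → ℝ)
  (b : M → M)
  (R : M → ℝ)
  r_pos : ∀ x, 0 < r x
  ball_r : ∀ x, Metric.closedBall (chartAt E x x) (r x) ⊆ (chartAt E x).target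
  ball_R : ∀ x, Metric.closedBall (chartAt E x x) (R x) ⊆ (chartAt E x).target
  subset_of_meet : ∀ x y, (chartBall E x (r x) ∩ chartBall E y (r y)).Nonempty →
    chartBall E y (r y) ⊆ chartBall E (b x) (R (b x))
  cover : ∀ x, ∃ i ∈ I, x ∈ chartBall E i (r i / 2)

namespace GoodCover

/-- The small balls of a good cover. -/
def U (C : GoodCover E M) (i : M) : Set M := chartBall E i (C.r i / 2)

/-- The middle balls of a good cover. -/
def V (C : GoodCover E M) (i : M) : Set M := chartBall E i (C.r i)

/-- The large balls of a good cover. -/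
def W (C : GoodCover E M) (i : M) : Set M := chartBall E (C.b i) (C.R (C.b i))

variable (C : GoodCover E M)

theorem isOpen_U (i : M) : IsOpen (C.U i) := isOpen_chartBall _ _

theorem isOpen_V (i : M) : IsOpen (C.V i) := isOpen_chartBall _ _

theorem isOpen_W (i : M) : IsOpen (C.W i) := isOpen_chartBall _ _

theorem U_subset_V (i : M) : C.U i ⊆ C.V i := chartBall_mono _ (by linarith [C.r_pos i])

theorem V_subset_W {i j x : M} (hi : x ∈ C.V i) (hj : x ∈ C.V j) : C.V i ⊆ C.W j :=
  C.subset_of_meet j i ⟨x, hj, hi⟩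

theorem V_subset_W_self (i : M) : C.V i ⊆ C.W i :=
  C.V_subset_W (mem_chartBall_self i (C.r_pos i)) (mem_chartBall_self i (C.r_pos i))

theorem mem_source {i x : M} (hx : x ∈ C.U i) : x ∈ (chartAt E (C.b i)).source :=
  (C.V_subset_W_self i (C.U_subset_V i hx)).1

/-- An index of a small ball of the cover that contains a given point. -/
def index (x : M) : M := (C.cover x).choose

theorem index_mem (x : M) : C.index x ∈ C.I := (C.cover x).choose_spec.1

theorem mem_U_index (x : M) : x ∈ C.U (C.index x) := (C.cover x).choose_spec.2

end GoodCover

/-- No contractibility of intersections is demanded. Star refinement puts any two balls that meet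
inside a common coordinate ball, and the Poincaré lemma is only applied on full balls. -/
theorem exists_goodCover [NormedSpace ℝ E] [T2Space M] [CompactSpace M] :
    Nonempty (GoodCover E M) := by
  have h1 : ∀ (x : M) (N : Set M), N ∈ 𝓝 x → ∃ r : ℝ, 0 < r ∧
      Metric.closedBall (chartAt E x x) r ⊆ (chartAt E x).target ∧ chartBall E x r ⊆ N := by
    intro x N hN
    have h2 : (chartAt E x).target ∩ (chartAt E x).symm ⁻¹' N ∈ 𝓝 (chartAt E x x) := by
      refine inter_mem ((chartAt E x).open_target.mem_nhds (mem_chart_target E x)) ?_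
      refine ((chartAt E x).continuousAt_symm (mem_chart_target E x)).preimage_mem_nhds ?_
      rwa [(chartAt E x).left_inv (mem_chart_source E x)]
    obtain ⟨r, hr, hrs⟩ := Metric.nhds_basis_closedBall.mem_iff.1 h2
    refine ⟨r, hr, fun y hy ↦ (hrs hy).1, fun y hy ↦ ?_⟩
    have := (hrs (Metric.ball_subset_closedBall hy.2)).2
    rwa [mem_preimage, (chartAt E x).left_inv hy.1] at this
  choose R hR0 hR _ using fun x : M ↦ h1 x univ univ_mem
  obtain ⟨b, N, hN, hNb⟩ := exists_star_refinement (O := fun x : M ↦ chartBall E x (R x))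
    (fun x ↦ isOpen_chartBall _ _) (fun x ↦ ⟨x, mem_chartBall_self x (hR0 x)⟩)
  choose r hr0 hr hrN using fun x : M ↦ h1 x (N x) (hN x)
  obtain ⟨I, hI⟩ := isCompact_univ.elim_finite_subcover (fun x : M ↦ chartBall E x (r x / 2))
    (fun x ↦ isOpen_chartBall _ _)
    (fun x _ ↦ mem_iUnion.2 ⟨x, mem_chartBall_self x (half_pos (hr0 x))⟩)
  refine ⟨⟨I, r, b, R, hr0, hr, hR, fun x y h ↦ ?_, fun x ↦ ?_⟩⟩
  · exact (hrN y).trans (hNb x y (h.mono (inter_subset_inter (hrN x) (hrN y))))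
  · obtain ⟨i, hi, hx⟩ := mem_iUnion₂.1 (hI (mem_univ x))
    exact ⟨i, hi, hx⟩

end Cover

/-! ### Zero-forms as functions. -/

section ZeroForms

variable {E : Type*} [NormedAddCommGroup E] [NormedSpace ℝ E]
  {M : Type*} [TopologicalSpace M] [ChartedSpace E M]

/-- The value of a `0`-form at a point. -/
def DiffForm.eval (f : DiffForm E M 0) (x : M) : ℝ := f.val x ![]

theorem DiffForm.ext_eval {f g : DiffForm E M 0} {x : M} (h : f.eval x = g.eval x) : f x = g x := by
  refine ContinuousAlternatingMap.ext fun v ↦ ?_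
  rw [Subsingleton.elim v ![]]
  exact h

theorem DiffForm.inChart_eval (f : DiffForm E M 0) (x₀ : M) (y : E) (v : Fin 0 → E) :
    f.inChart x₀ y v = f.eval ((chartAt E x₀).symm y) := by
  rw [f.inChart_eq x₀ rfl, DiffForm.eval, ContinuousAlternatingMap.compContinuousLinearMap_apply]
  congr 1
  exact Subsingleton.elim _ _

variable (E M) in
/-- A constant `0`-form. -/
def constForm (a : ℝ) : DiffForm E M 0 := fun _ ↦
  a • (ContinuousAlternatingMap.constOfIsEmpty ℝ E (Fin 0) (1 : ℝ))

theorem constForm_eval (a : ℝ) (x : M) : (constForm E M a).eval x = a := by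
  change a • (1 : ℝ) = a
  simp

theorem inChart_constForm (a : ℝ) (x₀ : M) (y : E) : (constForm E M a).inChart x₀ y =
    a • (ContinuousAlternatingMap.constOfIsEmpty ℝ E (Fin 0) (1 : ℝ)) := by
  refine ContinuousAlternatingMap.ext fun v ↦ ?_
  rw [DiffForm.inChart_eval, constForm_eval]
  simp

theorem smoothFamilyOn_constForm {a : ℝ → ℝ} (ha : ContDiff ℝ ∞ a) (S : Set M) :
    SmoothFamilyOn (fun ε ↦ constForm E M (a ε)) S := fun x₀ ↦ by
  simp only [inChart_constForm]
  exact ((ha.comp contDiff_snd).smul contDiff_const).contDiffOn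

theorem d_constForm (a : ℝ) : (constForm E M a).d = 0 := by
  ext x : 1
  have : (constForm E M a).inChart x = fun _ ↦
      a • (ContinuousAlternatingMap.constOfIsEmpty ℝ E (Fin 0) (1 : ℝ)) := by
    ext1 y
    exact inChart_constForm a x y
  rw [DiffForm.d, this]
  have : extDeriv (fun _ : E ↦ a • (ContinuousAlternatingMap.constOfIsEmpty ℝ E (Fin 0) (1 : ℝ)))
      (chartAt E x x) = 0 := by
    ext v
    simp [extDeriv, ContinuousAlternatingMap.alternatizeUncurryFin_apply]
  rw [this]
  rfl

theorem SmoothFamilyOn.contDiff_eval {f : ℝ → DiffForm E M 0} {S : Set M}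
    (hf : SmoothFamilyOn f S) {x : M} (hx : x ∈ S) : ContDiff ℝ ∞ fun ε ↦ (f ε).eval x := by
  have h1 : ContDiff ℝ ∞ fun ε ↦ (f ε).inChart x (chartAt E x x) := by
    rw [← contDiffOn_univ]
    exact (hf x).comp (f := fun ε : ℝ ↦ (chartAt E x x, ε)) (by fun_prop)
      (fun ε _ ↦ ⟨chart_mem_chartSet (mem_chart_source E x) hx, mem_univ _⟩)
  have h2 : ContDiff ℝ ∞ fun ε ↦ (f ε).inChart x (chartAt E x x) ![] :=
    (ContinuousAlternatingMap.apply ℝ E ℝ (![] : Fin 0 → E)).contDiff.comp h1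
  simpa only [DiffForm.inChart_eval, (chartAt E x).left_inv (mem_chart_source E x)] using h2

variable [IsManifold 𝓘(ℝ, E) ∞ M]

theorem DiffForm.eval_eq_of_d_eq_zero {f : DiffForm E M 0} {x₀ : M} {r : ℝ}
    (hr : Metric.ball (chartAt E x₀ x₀) r ⊆ (chartAt E x₀).target)
    (hf : SmoothFormOn f (chartBall E x₀ r)) (hd : ∀ x ∈ chartBall E x₀ r, f.d x = 0)
    {x y : M} (hx : x ∈ chartBall E x₀ r) (hy : y ∈ chartBall E x₀ r) : f.eval x = f.eval y := by
  have hS := isOpen_chartBall (E := E) x₀ r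
  have h1 : ∀ z ∈ Metric.ball (chartAt E x₀ x₀) r, 
      HasFDerivAt (f.inChart x₀) (0 : E →L[ℝ] E [⋀^Fin 0]→L[ℝ] ℝ) z := by
    intro z hz
    obtain ⟨w, hw, hwS, rfl⟩ := exists_of_mem_chartSet ((chartSet_chartBall hr).symm ▸ hz)
    have hdiff := hf.differentiableAt hS hw hwS
    have h2 := DiffForm.inChart_d hS hf hw hwS
    rw [DiffForm.inChart_chart _ hw, show f.d.val w = 0 from hd w hwS] at h2
    convert hdiff.hasFDerivAt
    refine ContinuousLinearMap.ext fun v ↦ ContinuousAlternatingMap.ext fun u ↦ ?_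
    have h3 := DFunLike.congr_fun h2 ![v]
    rw [extDeriv, ContinuousAlternatingMap.alternatizeUncurryFin_apply] at h3
    rw [Subsingleton.elim u ![]]
    simp at h3
    exact h3
  have h2 := (convex_ball (chartAt E x₀ x₀) r).is_const_of_fderivWithin_eq_zero (𝕜 := ℝ)
    (f := f.inChart x₀) (fun z hz ↦ (h1 z hz).differentiableAt.differentiableWithinAt)
    (fun z hz ↦ (h1 z hz).hasFDerivWithinAt.fderivWithin (Metric.isOpen_ball.uniqueDiffWithinAt hz))
    hx.2 hy.2
  have h3 := DFunLike.congr_fun h2 ![]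
  rwa [DiffForm.inChart_eval, DiffForm.inChart_eval, (chartAt E x₀).left_inv hx.1,
    (chartAt E x₀).left_inv hy.1] at h3

end ZeroForms

/-! ### Primitives depending smoothly on the parameter. -/

section SmoothPrimitive

/-- Solves `δ e = c` linearly in `c` on the range of `δ`. A solution obtained this way is smooth in
`ε` as soon as `c` is, even if solutions were only known to exist for each `ε`. -/
theorem exists_linear_section {V W : Type*} [AddCommGroup V] [Module ℝ V] [AddCommGroup W]
    [Module ℝ W] (δ : V →ₗ[ℝ] W) : ∃ s : W →ₗ[ℝ] V, ∀ v, δ (s (δ v)) = δ v := by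
  obtain ⟨s, hs⟩ := δ.rangeRestrict.exists_rightInverse_of_surjective
    (LinearMap.range_eq_top.2 δ.surjective_rangeRestrict)
  obtain ⟨t, ht⟩ := LinearMap.exists_extend s
  refine ⟨t, fun v ↦ ?_⟩
  have h1 : t (δ v) = s ⟨δ v, LinearMap.mem_range_self δ v⟩ := by rw [← ht]; rfl
  rw [h1]
  exact congrArg Subtype.val (DFunLike.congr_fun hs ⟨δ v, LinearMap.mem_range_self δ v⟩)

/-- The Čech coboundary of `1`-cochains of constants, restricted to a set of triples. -/
theorem exists_coboundary {ι : Type*} (P : ι → ι → ι → Prop) :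
    ∃ δ : (ι × ι → ℝ) →ₗ[ℝ] (ι × ι × ι → ℝ),
      (∀ e i j k, P i j k → δ e (i, j, k) = e (i, j) + e (j, k) - e (i, k)) ∧
      ∀ e i j k, ¬ P i j k → δ e (i, j, k) = 0 := by
  classical
  refine ⟨
    { toFun := fun e p ↦ if P p.1 p.2.1 p.2.2 then
        e (p.1, p.2.1) + e (p.2.1, p.2.2) - e (p.1, p.2.2) else 0
      map_add' := fun e e' ↦ by
        ext p
        by_cases h : P p.1 p.2.1 p.2.2
        · simp only [h, if_true, Pi.add_apply]
          ring
        · simp [h]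
      map_smul' := fun a e ↦ by
        ext p
        by_cases h : P p.1 p.2.1 p.2.2
        · simp only [h, if_true, Pi.smul_apply, smul_eq_mul, RingHom.id_apply]
          ring
        · simp [h] }, fun e i j k h ↦ if_pos h, fun e i j k h ↦ if_neg h⟩

section Eval

variable {E : Type*} [NormedAddCommGroup E] {M : Type*} [TopologicalSpace M] [ChartedSpace E M]

theorem GoodCover.ball_V (C : GoodCover E M) (i : M) :
    Metric.ball (chartAt E i i) (C.r i) ⊆ (chartAt E i).target :=
  Metric.ball_subset_closedBall.trans (C.ball_r i)

theorem GoodCover.ball_W (C : GoodCover E M) (i : M) :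
    Metric.ball (chartAt E (C.b i) (C.b i)) (C.R (C.b i)) ⊆ (chartAt E (C.b i)).target :=
  Metric.ball_subset_closedBall.trans (C.ball_R _)

variable [NormedSpace ℝ E]

theorem eval_add (f g : DiffForm E M 0) (x : M) : (f + g).eval x = f.eval x + g.eval x := rfl

theorem eval_sub (f g : DiffForm E M 0) (x : M) : (f - g).eval x = f.eval x - g.eval x := rfl

theorem eval_sum {ι : Type*} (s : Finset ι) (f : ι → DiffForm E M 0) (x : M) :
    (∑ i ∈ s, f i).eval x = ∑ i ∈ s, (f i).eval x := by
  classical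
  induction s using Finset.induction_on with
  | empty => rfl
  | insert i s hi ih => rw [Finset.sum_insert hi, Finset.sum_insert hi, eval_add, ih]

end Eval

universe u

variable {E : Type u} [NormedAddCommGroup E] [NormedSpace ℝ E] [FiniteDimensional ℝ E]
  {M : Type*} [TopologicalSpace M] [ChartedSpace E M] [IsManifold 𝓘(ℝ, E) ∞ M]

/-- Local primitives whose differences are exact: if every `σ ε` is exact, then the functions
`g i j` with `d (g i j) = α j - α i` form a cocycle up to a coboundary of constants, which can be
removed smoothly in `ε`. -/
theorem exists_cocycle (C : GoodCover E M) {σ : ℝ → DiffForm E M 2}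
    (hex : ∀ ε, ∃ β : DiffForm E M 1, β.IsSmooth ∧ β.d = σ ε)
    {α : M → ℝ → DiffForm E M 1} (hα : ∀ i, SmoothFamilyOn (α i) (C.W i))
    (hαd : ∀ i, ∀ ε, ∀ x ∈ C.W i, (α i ε).d x = σ ε x) :
    ∃ g : M → M → ℝ → DiffForm E M 0,
      (∀ i j, SmoothFamilyOn (g i j) (C.V i)) ∧
      (∀ i j ε, ∀ x ∈ C.V i ∩ C.V j, (g i j ε).d x = α j ε x - α i ε x) ∧
      ∀ i ∈ C.I, ∀ j ∈ C.I, ∀ k ∈ C.I, ∀ ε, ∀ x ∈ C.U i ∩ C.U j ∩ C.U k,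
        (g i j ε).eval x + (g j k ε).eval x = (g i k ε).eval x := by
  classical
  -- If the two balls meet, the whole ball `C.V i` lies in `C.W j`, so `α j - α i` is closed on a
  -- full coordinate ball. Otherwise `0` will do.
  have hg : ∀ i j, ∃ g : ℝ → DiffForm E M 0, SmoothFamilyOn g (C.V i) ∧
      ((C.V i ∩ C.V j).Nonempty → ∀ ε, ∀ x ∈ C.V i, (g ε).d x = α j ε x - α i ε x) := by
    intro i j
    by_cases hij : (C.V i ∩ C.V j).Nonempty
    · obtain ⟨z, hzi, hzj⟩ := hij
      have hj := (hα j).mono (C.V_subset_W hzi hzj)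
      have hi := (hα i).mono (C.V_subset_W_self i)
      obtain ⟨g, hg, hgd⟩ := SmoothFamilyOn.exists_primitive (C.ball_V i) (hj.sub hi)
        (fun ε x hx ↦ by
          rw [DiffForm.d_sub (C.isOpen_V i) (hj.slice ε) (hi.slice ε) hx,
            hαd j ε x (C.V_subset_W hzi hzj hx), hαd i ε x (C.V_subset_W_self i hx), sub_self])
      exact ⟨g, hg, fun _ ↦ hgd⟩
    · exact ⟨fun _ ↦ 0, smoothFamilyOn_zero, fun h ↦ absurd h hij⟩
  choose g hgs hgd using hg
  obtain ⟨δ, hδ, hδ0⟩ := exists_coboundary (ι := C.I) fun i j k ↦ (C.U i ∩ C.U j ∩ C.U k).Nonempty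
  obtain ⟨s, hs⟩ := exists_linear_section δ
  -- For fixed `ε`, a global primitive `β` gives `α i - β = d (f i)` on large balls. Then `g i j -
  -- (f j - f i)` is a constant `e (i, j)` on `C.V i` when the balls meet, and the `f` cancel in the
  -- alternating sum. No regularity in `ε` is claimed for `e`.
  have he : ∀ ε, ∃ e : C.I × C.I → ℝ, ∀ i j k : C.I, ∀ x ∈ C.U i ∩ C.U j ∩ C.U k,
      (g i j ε).eval x + (g j k ε).eval x - (g i k ε).eval x =
        e (i, j) + e (j, k) - e (i, k) := by
    intro ε
    obtain ⟨β, hβ, hβd⟩ := hex ε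
    have hβ' : ∀ S, SmoothFormOn β S := fun S ↦ (smoothFormOn_univ.2 hβ).mono (subset_univ S)
    have hf : ∀ i, ∃ f : DiffForm E M 0, SmoothFormOn f (C.W i) ∧
        ∀ x ∈ C.W i, f.d x = α i ε x - β x := by
      intro i
      have h1 : SmoothFormOn (α i ε - β) (C.W i) := ((hα i).slice ε).sub (hβ' _)
      obtain ⟨f, hf, hfd⟩ := SmoothFamilyOn.exists_primitive (C.ball_W i) h1.family
        (fun _ x hx ↦ by
          rw [DiffForm.d_sub (C.isOpen_W i) ((hα i).slice ε) (hβ' _) hx, hαd i ε x hx, hβd,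
            sub_self])
      exact ⟨f 0, hf.slice 0, hfd 0⟩
    choose f hfs hfd using hf
    have hc : ∀ i j x, x ∈ C.V i → x ∈ C.V j → (g i j ε).eval x - ((f j).eval x - (f i).eval x) =
        (g i j ε).eval i - ((f j).eval i - (f i).eval i) := by
      intro i j x hxi hxj
      have hfj := (hfs j).mono (C.V_subset_W hxi hxj)
      have hfi := (hfs i).mono (C.V_subset_W_self i)
      have h := DiffForm.eval_eq_of_d_eq_zero (f := g i j ε - (f j - f i)) (C.ball_V i)
        (((hgs i j).slice ε).sub (hfj.sub hfi)) (fun y hy ↦ by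
          rw [DiffForm.d_sub (C.isOpen_V i) ((hgs i j).slice ε) (hfj.sub hfi) hy,
            DiffForm.d_sub (C.isOpen_V i) hfj hfi hy, hgd i j ⟨x, hxi, hxj⟩ ε y hy,
            hfd j y (C.V_subset_W hxi hxj hy), hfd i y (C.V_subset_W_self i hy)]
          abel) hxi (mem_chartBall_self i (C.r_pos i))
      exact h
    refine ⟨fun p ↦ (g p.1 p.2 ε).eval p.1 - ((f p.2).eval p.1 - (f p.1).eval p.1),
      fun i j k x hx ↦ ?_⟩
    have hi := C.U_subset_V _ hx.1.1
    have hj := C.U_subset_V _ hx.1.2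
    have hk := C.U_subset_V _ hx.2
    have e1 := hc i j x hi hj
    have e2 := hc j k x hj hk
    have e3 := hc i k x hi hk
    simp only
    rw [← e1, ← e2, ← e3]
    ring
  choose e he using he
  -- Although `e` may be irregular in `ε`, its coboundary is read off from the smooth families `g`
  -- at a fixed point of the triple overlap.
  have hsm : ContDiff ℝ ∞ fun ε ↦ δ (e ε) := by
    rw [contDiff_pi]
    rintro ⟨i, j, k⟩
    by_cases h : (C.U i ∩ C.U j ∩ C.U k).Nonempty
    · have hh := h
      obtain ⟨q, hq⟩ := hh
      have : (fun ε ↦ δ (e ε) (i, j, k)) = fun ε ↦ (g i j ε).eval q + (g j k ε).eval q -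
          (g i k ε).eval q := by
        ext ε
        rw [hδ _ _ _ _ h, he ε i j k q hq]
      rw [this]
      have hi := C.U_subset_V _ hq.1.1
      have hj := C.U_subset_V _ hq.1.2
      exact (((hgs _ _).contDiff_eval hi).add ((hgs _ _).contDiff_eval hj)).sub
        ((hgs _ _).contDiff_eval hi)
    · have : (fun ε ↦ δ (e ε) (i, j, k)) = fun _ ↦ 0 := by
        ext ε
        exact hδ0 _ _ _ _ h
      rw [this]
      exact contDiff_const
  have hsm' : ContDiff ℝ ∞ fun ε ↦ s (δ (e ε)) :=
    (LinearMap.toContinuousLinearMap s).contDiff.comp hsm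
  let a : M → M → ℝ → ℝ := fun i j ε ↦
    if h : i ∈ C.I ∧ j ∈ C.I then s (δ (e ε)) (⟨i, h.1⟩, ⟨j, h.2⟩) else 0
  have ha : ∀ i j, ContDiff ℝ ∞ (a i j) := by
    intro i j
    by_cases h : i ∈ C.I ∧ j ∈ C.I
    · simp only [a, h, and_self, dite_true]
      exact contDiff_pi.1 hsm' _
    · simp only [a, h, dite_false]
      exact contDiff_const
  have hsub : ∀ i j ε, SmoothFormOn (constForm E M (a i j ε)) (C.V i) := fun i j ε ↦
    (smoothFamilyOn_constForm (ha i j) _).slice ε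
  refine ⟨fun i j ε ↦ g i j ε - constForm E M (a i j ε),
    fun i j ↦ (hgs i j).sub (smoothFamilyOn_constForm (ha i j) _), fun i j ε x hx ↦ ?_,
    fun i hi j hj k hk ε x hx ↦ ?_⟩
  · rw [DiffForm.d_sub (C.isOpen_V i) ((hgs i j).slice ε) (hsub i j ε) hx.1, d_constForm,
      hgd i j ⟨x, hx⟩ ε x hx.1]
    exact sub_zero _
  · have h1 := he ε ⟨i, hi⟩ ⟨j, hj⟩ ⟨k, hk⟩ x hx
    have h2 := congrFun (hs (e ε)) (⟨i, hi⟩, ⟨j, hj⟩, ⟨k, hk⟩)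
    have h3 := fun e ↦ hδ e ⟨i, hi⟩ ⟨j, hj⟩ ⟨k, hk⟩ ⟨x, hx⟩
    rw [h3, h3] at h2
    simp only [eval_sub, constForm_eval, a, hi, hj, hk, and_self, dite_true]
    linarith

variable [T2Space M] [CompactSpace M]

/-- Once the `g i j` satisfy the exact cocycle identity, a partition of unity writes them as
differences `f i - f j`, and the local primitives `α i + d (f i)` agree on overlaps. -/
theorem exists_smooth_family_primitive {σ : ℝ → DiffForm E M 2}
    (hσ : SmoothFamilyOn σ univ) (hcl : ∀ ε, (σ ε).d = 0)
    (hex : ∀ ε, ∃ β : DiffForm E M 1, β.IsSmooth ∧ β.d = σ ε) :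
    ∃ α : ℝ → DiffForm E M 1, SmoothFamilyOn α univ ∧ ∀ ε, (α ε).d = σ ε := by
  obtain ⟨C⟩ := exists_goodCover (E := E) (M := M)
  have h1 : ∀ i, ∃ α : ℝ → DiffForm E M 1, SmoothFamilyOn α (C.W i) ∧
      ∀ ε, ∀ x ∈ C.W i, (α ε).d x = σ ε x := fun i ↦
    SmoothFamilyOn.exists_primitive (C.ball_W i) (hσ.mono (subset_univ _))
      (fun ε x _ ↦ congrFun (hcl ε) x)
  choose α hα hαd using h1
  obtain ⟨g, hg, hgd, hgc⟩ := exists_cocycle C hex hα hαd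
  obtain ⟨ρ, hρ⟩ := SmoothPartitionOfUnity.exists_isSubordinate 𝓘(ℝ, E) (isClosed_univ (X := M))
    (fun i : C.I ↦ C.U i) (fun i ↦ C.isOpen_U i) (fun x _ ↦ by
      obtain ⟨i, hi, hx⟩ := C.cover x
      exact mem_iUnion.2 ⟨⟨i, hi⟩, hx⟩)
  have hρ1 : ∀ x, ∑ k, ρ k x = 1 := fun x ↦ by
    rw [← finsum_eq_sum_of_fintype]
    exact ρ.sum_eq_one (mem_univ x)
  have hρ0 : ∀ (k : C.I) x, x ∉ C.U k → ρ k x = 0 := fun k x hx ↦ by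
    by_contra h
    exact hx (hρ k (subset_tsupport _ h))
  let f : M → ℝ → DiffForm E M 0 := fun i ε ↦ ∑ k, fun x ↦ ρ k x • g i k ε x
  have hfe : ∀ i ε x, (f i ε).eval x = ∑ k, ρ k x * (g i k ε).eval x := by
    intro i ε x
    rw [eval_sum]
    rfl
  have hf : ∀ i, SmoothFamilyOn (f i) (C.V i) := fun i ↦
    SmoothFamilyOn.sum fun k _ ↦ (hg i k).smul (ρ k).contMDiff
  have hfU : ∀ i, SmoothFamilyOn (f i) (C.U i) := fun i ↦ (hf i).mono (C.U_subset_V i)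
  have hαU : ∀ i, SmoothFamilyOn (α i) (C.U i) := fun i ↦
    (hα i).mono ((C.U_subset_V i).trans (C.V_subset_W_self i))
  have hff : ∀ i ∈ C.I, ∀ j ∈ C.I, ∀ ε, ∀ x ∈ C.U i ∩ C.U j,
      (f i ε - f j ε) x = g i j ε x := by
    intro i hi j hj ε x hx
    refine DiffForm.ext_eval ?_
    rw [eval_sub, hfe, hfe, ← Finset.sum_sub_distrib, ← one_mul ((g i j ε).eval x), ← hρ1 x,
      Finset.sum_mul]
    refine Finset.sum_congr rfl fun k _ ↦ ?_
    by_cases hk : x ∈ C.U k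
    · rw [← hgc i hi j hj k k.2 ε x ⟨hx, hk⟩]
      ring
    · simp [hρ0 k x hk]
  have hglue : ∀ i ∈ C.I, ∀ j ∈ C.I, ∀ ε, ∀ x ∈ C.U i ∩ C.U j,
      α i ε x + (f i ε).d x = α j ε x + (f j ε).d x := by
    intro i hi j hj ε x hx
    have hop := (C.isOpen_U i).inter (C.isOpen_U j)
    have e1 := DiffForm.d_congr hop (hff i hi j hj ε) hx
    rw [DiffForm.d_sub hop (((hfU i).mono inter_subset_left).slice ε)
      (((hfU j).mono inter_subset_right).slice ε) hx,
      hgd i j ε x ⟨C.U_subset_V i hx.1, C.U_subset_V j hx.2⟩] at e1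
    rw [sub_eq_iff_eq_add] at e1
    rw [e1]
    abel
  choose i hiI hi using C.cover
  let A : ℝ → DiffForm E M 1 := fun ε x ↦ α (i x) ε x + (f (i x) ε).d x
  have hA : ∀ j ∈ C.I, ∀ ε, ∀ x ∈ C.U j, A ε x = (α j ε + (f j ε).d) x := fun j hj ε x hx ↦
    hglue (i x) (hiI x) j hj ε x ⟨hi x, hx⟩
  have hfd : ∀ j, SmoothFamilyOn (fun ε ↦ (f j ε).d) (C.U j) := fun j ↦ (hfU j).d (C.isOpen_U j)
  refine ⟨A, SmoothFamilyOn.of_locally fun x _ ↦ ⟨C.U (i x), C.isOpen_U _, hi x,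
    ((hαU (i x)).add (hfd (i x))).congr (hA (i x) (hiI x))⟩, fun ε ↦ ?_⟩
  ext x : 1
  have ho := C.isOpen_U (i x)
  rw [DiffForm.d_congr ho (hA (i x) (hiI x) ε) (hi x), DiffForm.d_add ho ((hαU (i x)).slice ε)
    ((hfd (i x)).slice ε) (hi x), DiffForm.d_d ho ((hfU (i x)).slice ε) (hi x), add_zero]
  exact hαd (i x) ε x (C.V_subset_W_self _ (C.U_subset_V _ (hi x)))

end SmoothPrimitive

/-! ### Derivatives of a difference quotient at zero. -/

section Taylor

variable {F : Type*} [NormedAddCommGroup F] [NormedSpace ℝ F]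

theorem iteratedDeriv_id_smul {g : ℝ → F} (hg : ContDiff ℝ ∞ g) (n : ℕ) :
    iteratedDeriv (n + 1) (fun ε ↦ ε • g ε) =
      fun ε ↦ ε • iteratedDeriv (n + 1) g ε + ((n : ℝ) + 1) • iteratedDeriv n g ε := by
  have hd : ∀ n ε, HasDerivAt (iteratedDeriv n g) (iteratedDeriv (n + 1) g ε) ε := fun n ε ↦ by
    rw [iteratedDeriv_succ]
    exact ((hg.differentiable_iteratedDeriv n (by exact_mod_cast ENat.natCast_lt_top n))
      ε).hasDerivAt
  induction n with
  | zero =>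
    ext1 ε
    have h0 := hd 0 ε
    rw [iteratedDeriv_zero] at h0
    rw [zero_add, iteratedDeriv_one]
    rw [((hasDerivAt_id' ε).fun_smul h0).deriv]
    simp
  | succ n ih =>
    ext1 ε
    rw [iteratedDeriv_succ, ih]
    rw [(((hasDerivAt_id' ε).fun_smul (hd (n + 1) ε)).fun_add
      ((hd n ε).fun_const_smul ((n : ℝ) + 1))).deriv]
    simp only [ one_smul, Nat.cast_add, Nat.cast_one, add_smul]
    abel

/-- Leibniz' rule for `f = f 0 + ε · dslope f 0`: at `ε = 0` only the term in which the factor `ε`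
is differentiated once survives. -/
theorem iteratedDeriv_succ_zero_eq {f : ℝ → F} (hf : ContDiff ℝ ∞ (dslope f 0)) (n : ℕ) :
    iteratedDeriv (n + 1) f 0 = ((n : ℝ) + 1) • iteratedDeriv n (dslope f 0) 0 := by
  have h1 : f = fun ε ↦ f 0 + ε • dslope f 0 ε := by
    ext1 ε
    have := sub_smul_dslope f 0 ε
    rw [sub_zero] at this
    rw [this]
    abel
  have h2 : iteratedDeriv (n + 1) f = iteratedDeriv (n + 1) (fun ε ↦ ε • dslope f 0 ε) := by
    conv_lhs => rw [h1]
    rw [iteratedDeriv_succ', iteratedDeriv_succ']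
    congr 1
    ext1 ε
    rw [deriv_const_add]
  rw [h2, iteratedDeriv_id_smul hf]
  simp

end Taylor

/-! ### Taylor's formula for families of forms. -/

section Quotient

variable {E : Type*} [NormedAddCommGroup E] [NormedSpace ℝ E]
  {M : Type*} [TopologicalSpace M] [ChartedSpace E M] {k : ℕ}

/-- The difference quotient `(σ ε - σ 0) / ε` of a family of forms, extended by the derivative
at `ε = 0`. -/
def quot (σ : ℝ → DiffForm E M k) : ℝ → DiffForm E M k := fun ε x ↦
  dslope (E := E [⋀^Fin k]→L[ℝ] ℝ) (fun ε ↦ (σ ε).val x) 0 ε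

theorem quot_val (σ : ℝ → DiffForm E M k) (ε : ℝ) (x : M) :
    (quot σ ε).val x = dslope (fun ε ↦ (σ ε).val x) 0 ε := rfl

theorem eq_add_smul_quot (σ : ℝ → DiffForm E M k) (ε : ℝ) : σ ε = σ 0 + ε • quot σ ε := by
  ext x : 1
  have := sub_smul_dslope (fun ε ↦ (σ ε).val x) 0 ε
  rw [sub_zero] at this
  change (σ ε).val x = (σ 0).val x + ε • (quot σ ε).val x
  rw [quot_val, this]
  abel

theorem quot_of_ne (σ : ℝ → DiffForm E M k) {ε : ℝ} (h : ε ≠ 0) :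
    quot σ ε = ε⁻¹ • (σ ε - σ 0) := by
  conv_rhs => rw [eq_add_smul_quot σ ε]
  rw [add_sub_cancel_left, inv_smul_smul₀ h]

theorem eq_sum_add_smul_iterate_quot (σ : ℝ → DiffForm E M k) (n : ℕ) (ε : ℝ) :
    σ ε = ∑ m ∈ Finset.range n, ε ^ m • quot^[m] σ 0 + ε ^ n • quot^[n] σ ε := by
  induction n with
  | zero => simp
  | succ n ih =>
    rw [Finset.sum_range_succ, Function.iterate_succ_apply', add_assoc, pow_succ, mul_smul,
      ← smul_add, ← eq_add_smul_quot]
    exact ih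

theorem SmoothFamilyOn.contDiff_inChart {σ : ℝ → DiffForm E M k} (hσ : SmoothFamilyOn σ univ)
    {x₀ : M} {y : E} (hy : y ∈ (chartAt E x₀).target) :
    ContDiff ℝ ∞ fun ε ↦ (σ ε).inChart x₀ y := by
  rw [← contDiffOn_univ]
  exact (hσ x₀).comp (f := fun ε : ℝ ↦ (y, ε)) (by fun_prop) (fun ε _ ↦ ⟨⟨hy, trivial⟩, trivial⟩)

variable [IsManifold 𝓘(ℝ, E) ∞ M]

theorem SmoothFamilyOn.contDiff_val {σ : ℝ → DiffForm E M k} (hσ : SmoothFamilyOn σ univ) (x : M) :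
    ContDiff ℝ ∞ fun ε ↦ (σ ε).val x := by
  have hx := mem_chart_source E x
  have h1 : (fun ε ↦ (σ ε).val x) = fun ε ↦ ContinuousAlternatingMap.compContinuousLinearMapCLM
      (chartD E x x) ((σ ε).inChart x (chartAt E x x)) := by
    ext1 ε
    exact (σ ε).val_eq hx
  rw [h1]
  exact (ContinuousLinearMap.contDiff _).comp (hσ.contDiff_inChart (mem_chart_target E x))

theorem SmoothFamilyOn.inChart_quot {σ : ℝ → DiffForm E M k} (hσ : SmoothFamilyOn σ univ)
    (x₀ : M) (y : E) (ε : ℝ) :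
    (quot σ ε).inChart x₀ y = dslope (fun ε ↦ (σ ε).inChart x₀ y) 0 ε := by
  set x := (chartAt E x₀).symm y with hx
  have h1 : (fun ε ↦ (σ ε).inChart x₀ y) =
      ContinuousAlternatingMap.compContinuousLinearMapCLM (symmD x₀ y) ∘ fun ε ↦ (σ ε).val x := by
    ext1 ε
    exact (σ ε).inChart_eq x₀ rfl
  rw [h1, ContinuousLinearMap.dslope_comp _ _ _ _ fun _ ↦
    ((hσ.contDiff_val x).differentiable (by simp)) 0]
  exact (quot σ ε).inChart_eq x₀ hx.symm

theorem SmoothFamilyOn.quot [FiniteDimensional ℝ E] {σ : ℝ → DiffForm E M k}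
    (hσ : SmoothFamilyOn σ univ) : SmoothFamilyOn (quot σ) univ := fun x₀ ↦ by
  simp only [hσ.inChart_quot]
  exact contDiffOn_dslope (isOpen_chartSet x₀ isOpen_univ) (hσ x₀)

theorem SmoothFamilyOn.quot_iterate [FiniteDimensional ℝ E] {σ : ℝ → DiffForm E M k}
    (hσ : SmoothFamilyOn σ univ) (n : ℕ) : SmoothFamilyOn (BarelySymplectic.quot^[n] σ) univ := by
  induction n with
  | zero => exact hσ
  | succ n ih =>
    rw [Function.iterate_succ_apply']
    exact ih.quot

/-- Each quotient lowers the order of differentiation by one and removes one integer factor. After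
`n` quotients the factors multiply to `n!`, cancelling the normalisation of the Taylor coefficient.
-/
theorem powerCoeff_eq [FiniteDimensional ℝ E] {σ : ℝ → DiffForm E M k}
    (hσ : SmoothFamilyOn σ univ) (n : ℕ) : powerCoeff σ n = quot^[n] σ 0 := by
  ext x : 1
  have h : ∀ n m, ((n + m).descFactorial n : ℝ) •
      iteratedDeriv m (fun ε ↦ (quot^[n] σ ε).val x) 0 =
      iteratedDeriv (n + m) (fun ε ↦ (σ ε).val x) 0 := by
    intro n
    induction n with
    | zero => intro m; simp
    | succ n ih =>
      intro m
      have h1 := iteratedDeriv_succ_zero_eq (f := fun ε ↦ (quot^[n] σ ε).val x)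
        (n := m) (by
          have := (hσ.quot_iterate (n + 1)).contDiff_val x
          rw [Function.iterate_succ_apply'] at this
          exact this)
      have h2 : (fun ε ↦ (quot^[n + 1] σ ε).val x) =
          dslope (fun ε ↦ (quot^[n] σ ε).val x) 0 := by
        rw [Function.iterate_succ_apply']
        rfl
      rw [h2, show n + 1 + m = n + (m + 1) by ring, ← ih (m + 1), h1, smul_smul,
        show n + (m + 1) = n + m + 1 by ring, Nat.descFactorial_succ,
        show n + m + 1 - n = m + 1 by omega]
      push_cast
      rw [mul_comm]
  have h0 := h n 0
  rw [add_zero, Nat.descFactorial_self, iteratedDeriv_zero] at h0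
  change (n.factorial : ℝ)⁻¹ • iteratedDeriv n (fun ε ↦ (σ ε).val x) 0 = (quot^[n] σ 0).val x
  rw [← h0, inv_smul_smul₀ (by positivity)]

/-- Taylor's formula with a smooth remainder. -/
theorem eq_truncation_add [FiniteDimensional ℝ E] {σ : ℝ → DiffForm E M k}
    (hσ : SmoothFamilyOn σ univ) (d : ℕ) (ε : ℝ) :
    σ ε = truncation σ d ε + ε ^ (d + 1) • quot^[d + 1] σ ε := by
  rw [truncation]
  simp only [powerCoeff_eq hσ]
  exact eq_sum_add_smul_iterate_quot σ (d + 1) ε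

omit [IsManifold 𝓘(ℝ, E) ∞ M] in
theorem DiffForm.d_smul (c : ℝ) (σ : DiffForm E M k) : (c • σ).d = c • σ.d := by
  ext x : 1
  have h2 : (c • σ).inChart x = c • σ.inChart x := rfl
  rw [DiffForm.d, h2, extDeriv_smul]
  rfl

/-- The fixed form `τ` cancels in the difference, which settles `ε ≠ 0`; at `ε = 0` both sides are
limits of their values at nonzero `ε`. -/
theorem d_quot [FiniteDimensional ℝ E] {α : ℝ → DiffForm E M k} {σ : ℝ → DiffForm E M (k + 1)}
    (hα : SmoothFamilyOn α univ) (hσ : SmoothFamilyOn σ univ) {τ : DiffForm E M (k + 1)}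
    (h : ∀ ε, (α ε).d = σ ε - τ) (ε : ℝ) : (quot α ε).d = quot σ ε := by
  have hne : ∀ ε, ε ≠ 0 → (quot α ε).d = quot σ ε := by
    intro ε hε
    rw [quot_of_ne α hε, quot_of_ne σ hε, DiffForm.d_smul]
    congr 1
    ext x : 1
    rw [DiffForm.d_sub isOpen_univ (hα.slice ε) (hα.slice 0) (mem_univ x), h, h]
    simp
  by_cases hε : ε = 0
  · subst hε
    ext x : 1
    have c1 := ((hα.quot.d isOpen_univ).contDiff_val x).continuous
    have c2 := (hσ.quot.contDiff_val x).continuous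
    have h3 := Continuous.ext_on (dense_compl_singleton (0 : ℝ)) c1 c2 (fun ε hε ↦ by
      change (BarelySymplectic.quot α ε).d x = _
      rw [hne ε hε]
      rfl)
    exact congrFun h3 0
  · exact hne ε hε

theorem d_quot_iterate [FiniteDimensional ℝ E] {α : ℝ → DiffForm E M k}
    {σ : ℝ → DiffForm E M (k + 1)}
    (hα : SmoothFamilyOn α univ) (hσ : SmoothFamilyOn σ univ) {τ : DiffForm E M (k + 1)}
    (h : ∀ ε, (α ε).d = σ ε - τ) (n : ℕ) (ε : ℝ) :
    (quot^[n + 1] α ε).d = quot^[n + 1] σ ε := by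
  induction n generalizing ε with
  | zero => exact d_quot hα hσ h ε
  | succ n ih =>
    rw [Function.iterate_succ_apply', Function.iterate_succ_apply' (n := n + 1)]
    -- After the first quotient the derivatives agree exactly, so the constant `τ` is now `0`.
    exact d_quot (hα.quot_iterate _) (hσ.quot_iterate _) (τ := 0) (by simpa using ih) ε

end Quotient

/-! ### Patching local flows on the manifold. -/

section ManifoldFlow

universe u

variable {E : Type u} [NormedAddCommGroup E] [NormedSpace ℝ E]
  {M : Type*} [TopologicalSpace M] [ChartedSpace E M]

/-- Vector fields `ε G i (·, ε, t)` in the charts of the large balls of a good cover that agree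
on overlaps. -/
structure ChartFields (C : GoodCover E M) where
  (G : M → E × ℝ × ℝ → E)
  smooth : ∀ i, ContDiff ℝ ∞ (G i)
  supp : ∀ i, HasCompactSupport (G i)
  (δ : ℝ)
  δ_pos : 0 < δ
  compat : ∀ i ∈ C.I, ∀ j ∈ C.I, ∀ x ∈ C.W i ∩ C.W j, ∀ ε ∈ Ioo (-δ) δ, ∀ t ∈ Icc (0 : ℝ) 1,
    ε • G j (chartAt E (C.b j) x, ε, t) =
      fderiv ℝ (transition E (C.b i) (C.b j)) (chartAt E (C.b i) x)
        (ε • G i (chartAt E (C.b i) x, ε, t))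

/-- The time reversal of a time-dependent vector field. -/
def ChartFields.reverse {C : GoodCover E M} (F : ChartFields C) : ChartFields C where
  G i p := -F.G i (p.1, p.2.1, 1 - p.2.2)
  smooth i := by
    have := F.smooth i
    fun_prop
  supp i := by
    let h : E × ℝ × ℝ ≃ₜ E × ℝ × ℝ :=
      (Homeomorph.refl E).prodCongr ((Homeomorph.refl ℝ).prodCongr (Homeomorph.subLeft (1 : ℝ)))
    exact ((F.supp i).comp_homeomorph h).neg
  δ := F.δ
  δ_pos := F.δ_pos
  compat i hi j hj x hx ε hε t ht := by
    rw [smul_neg, smul_neg, map_neg,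
      F.compat i hi j hj x hx ε hε (1 - t) ⟨by linarith [ht.2], by linarith [ht.1]⟩]

/-- Flows of compatible chart fields for small `ε`, such that orbits which start in a small ball
stay in the corresponding middle ball. -/
structure LocalFlow {C : GoodCover E M} (F : ChartFields C) where
  (φ : M → E × ℝ × ℝ → E)
  (ε₀ : ℝ)
  pos : 0 < ε₀
  le : ε₀ ≤ F.δ
  smooth : ∀ i ∈ C.I, ContDiffOn ℝ ∞ (φ i) (univ ×ˢ Ioo (-ε₀) ε₀ ×ˢ Ioo (-2) 2)
  init : ∀ i ∈ C.I, ∀ x, ∀ ε ∈ Ioo (-ε₀) ε₀, φ i (x, ε, 0) = x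
  deriv : ∀ i ∈ C.I, ∀ x, ∀ ε ∈ Ioo (-ε₀) ε₀, ∀ t ∈ Ioo (-2 : ℝ) 2,
    HasDerivAt (fun t ↦ φ i (x, ε, t)) (ε • F.G i (φ i (x, ε, t), ε, t)) t
  mem : ∀ i ∈ C.I, ∀ x ∈ C.U i, ∀ ε ∈ Ioo (-ε₀) ε₀, ∀ t ∈ Icc (0 : ℝ) 1,
    φ i (chartAt E (C.b i) x, ε, t) ∈ chartSet E (C.b i) (C.V i)

/-- The closed half-sized ball, moved to the larger chart, is compact and still inside `C.V i`. It
provides the room needed to keep short orbits in that ball. -/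
theorem GoodCover.exists_compact [FiniteDimensional ℝ E] [IsManifold 𝓘(ℝ, E) ∞ M]
    (C : GoodCover E M) (i : M) :
    ∃ K : Set E, IsCompact K ∧ K ⊆ chartSet E (C.b i) (C.V i) ∧
      ∀ x ∈ C.U i, chartAt E (C.b i) x ∈ K := by
  have hsub : Metric.closedBall (chartAt E i i) (C.r i / 2) ⊆
      Metric.ball (chartAt E i i) (C.r i) :=
    Metric.closedBall_subset_ball (by linarith [C.r_pos i])
  have hy : ∀ y ∈ Metric.closedBall (chartAt E i i) (C.r i / 2),
      ∃ x ∈ (chartAt E i).source, x ∈ C.V i ∧ chartAt E i x = y := fun y hy ↦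
    exists_of_mem_chartSet ((chartSet_chartBall (C.ball_V i)).symm ▸ hsub hy)
  refine ⟨transition E i (C.b i) '' Metric.closedBall (chartAt E i i) (C.r i / 2),
    (isCompact_closedBall _ _).image_of_continuousOn fun y hyb ↦ ?_, ?_, fun x hx ↦ ?_⟩
  · obtain ⟨x, hx, hxV, rfl⟩ := hy y hyb
    exact (contDiffAt_transition hx
      (C.V_subset_W_self i hxV).1).continuousAt.continuousWithinAt
  · rintro _ ⟨y, hyb, rfl⟩
    obtain ⟨x, hx, hxV, rfl⟩ := hy y hyb
    rw [transition_chart hx]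
    exact chart_mem_chartSet (C.V_subset_W_self i hxV).1 hxV
  · exact ⟨chartAt E i x, Metric.ball_subset_closedBall hx.2, transition_chart hx.1⟩

/-- At `ε = 0` the field vanishes and orbits stand still. The tube lemma around `K × {0} × [0, 1]`
then confines orbits for small `ε`, and finitely many balls allow a common bound. -/
theorem exists_localFlow [FiniteDimensional ℝ E] [IsManifold 𝓘(ℝ, E) ∞ M] {C : GoodCover E M}
    (F : ChartFields C) : Nonempty (LocalFlow F) := by
  choose e he φ hφ hode using fun i ↦ exists_smooth_flow (F.smooth i) (F.supp i)
  have hη : ∀ i, ∃ η : ℝ, 0 < η ∧ ∀ x ∈ C.U i, ∀ ε ∈ Ioo (-η) η, ∀ t ∈ Icc (0 : ℝ) 1,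
      φ i (chartAt E (C.b i) x, ε, t) ∈ chartSet E (C.b i) (C.V i) := by
    intro i
    obtain ⟨K, hK, hKV, hUK⟩ := C.exists_compact i
    have hD : IsOpen ((univ : Set E) ×ˢ Ioo (-e i) (e i) ×ˢ Ioo (-2 : ℝ) 2) :=
      isOpen_univ.prod (isOpen_Ioo.prod isOpen_Ioo)
    have hN := (hφ i).continuousOn.isOpen_inter_preimage hD
      (isOpen_chartSet (C.b i) (C.isOpen_V i))
    have h0 : (0 : ℝ) ∈ Ioo (-e i) (e i) := ⟨by linarith [he i], he i⟩
    have hstat : ∀ y, ∀ t ∈ Icc (0 : ℝ) 1, φ i (y, 0, t) = y := by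
      intro y t ht
      have hd : ∀ s ∈ Icc (0 : ℝ) 1, HasDerivAt (fun t ↦ φ i (y, 0, t)) 0 s := fun s hs ↦ by
        have := (hode i y 0 h0).2 s ⟨by linarith [hs.1], by linarith [hs.2]⟩
        rwa [zero_smul] at this
      rw [constant_of_has_deriv_right_zero
        (fun s hs ↦ (hd s hs).continuousAt.continuousWithinAt)
        (fun s hs ↦ (hd s (Ico_subset_Icc_self hs)).hasDerivWithinAt) t ht, (hode i y 0 h0).1]
    obtain ⟨u, v, -, hv, hKu, h0v, huv⟩ := generalized_tube_lemma hK
      (isCompact_singleton.prod isCompact_Icc : IsCompact (({0} : Set ℝ) ×ˢ Icc (0 : ℝ) 1)) hN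
      (by
        rintro ⟨y, ε, t⟩ ⟨hy, hε, ht⟩
        obtain rfl : ε = 0 := hε
        refine ⟨⟨mem_univ _, h0, by linarith [ht.1], by linarith [ht.2]⟩, ?_⟩
        rw [mem_preimage, hstat y t ht]
        exact hKV hy)
    obtain ⟨a, b, ha, -, h0a, hb, hab⟩ := generalized_tube_lemma isCompact_singleton
      isCompact_Icc hv h0v
    obtain ⟨η, hη, hηa⟩ := Metric.isOpen_iff.1 ha 0 (h0a rfl)
    refine ⟨η, hη, fun x hx ε hε t ht ↦ ?_⟩
    refine (huv ⟨hKu (hUK x hx), hab ⟨hηa ?_, hb ht⟩⟩).2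
    rw [Real.ball_eq_Ioo]
    simpa using hε
  choose η hη0 hη using hη
  have hev : ∀ᶠ s in 𝓝[>] (0 : ℝ), (∀ i ∈ C.I, s ≤ e i ∧ s ≤ η i) ∧ s ≤ F.δ := by
    refine ((Finset.eventually_all C.I).2 fun i _ ↦ ?_).and ?_
    · exact ((eventually_le_nhds (he i)).and (eventually_le_nhds (hη0 i))).filter_mono
        nhdsWithin_le_nhds
    · exact (eventually_le_nhds F.δ_pos).filter_mono nhdsWithin_le_nhds
  obtain ⟨s, ⟨hs, hsδ⟩, hs0⟩ := (hev.and self_mem_nhdsWithin).exists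
  have hsub : ∀ i ∈ C.I, Ioo (-s) s ⊆ Ioo (-e i) (e i) := fun i hi ↦
    Ioo_subset_Ioo (by linarith [(hs i hi).1]) (hs i hi).1
  exact ⟨{
    φ := φ
    ε₀ := s
    pos := hs0
    le := hsδ
    smooth := fun i hi ↦ (hφ i).mono
      (prod_mono subset_rfl (prod_mono (hsub i hi) subset_rfl))
    init := fun i hi x ε hε ↦ (hode i x ε (hsub i hi hε)).1
    deriv := fun i hi x ε hε ↦ (hode i x ε (hsub i hi hε)).2
    mem := fun i hi x hx ε hε ↦ hη i x hx ε
      (Ioo_subset_Ioo (by linarith [(hs i hi).2]) (hs i hi).2 hε) }⟩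

namespace LocalFlow

variable {C : GoodCover E M} {F : ChartFields C} (L : LocalFlow F)

/-- The curve, moved to the chart of `C.W j`, solves the equation there by `compat`, and ODE
uniqueness identifies it with the orbit of `L.φ j`. Allowing an arbitrary integral curve serves both
independence of the chart and, with a reversed orbit, the inverse map. -/
theorem eq_of_curve [IsManifold 𝓘(ℝ, E) ∞ M] {i j : M} (hi : i ∈ C.I) (hj : j ∈ C.I) {ε : ℝ}
    (hε : ε ∈ Ioo (-L.ε₀) L.ε₀) {γ : ℝ → E}
    (hγ : ∀ t ∈ Icc (0 : ℝ) 1, HasDerivAt γ (ε • F.G i (γ t, ε, t)) t)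
    (hγV : ∀ t ∈ Icc (0 : ℝ) 1, γ t ∈ chartSet E (C.b i) (C.V i))
    (hU : (chartAt E (C.b i)).symm (γ 0) ∈ C.U j) {t : ℝ} (ht : t ∈ Icc (0 : ℝ) 1) :
    (chartAt E (C.b j)).symm
      (L.φ j (chartAt E (C.b j) ((chartAt E (C.b i)).symm (γ 0)), ε, t)) =
      (chartAt E (C.b i)).symm (γ t) := by
  have h01 : (0 : ℝ) ∈ Icc (0 : ℝ) 1 := ⟨le_rfl, zero_le_one⟩
  have hVW : C.V i ⊆ C.W j := C.V_subset_W (hγV 0 h01).2 (C.U_subset_V j hU)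
  set η : ℝ → E := fun t ↦ chartAt E (C.b j) ((chartAt E (C.b i)).symm (γ t)) with hη
  have hηd : ∀ t ∈ Icc (0 : ℝ) 1, HasDerivAt η (ε • F.G j (η t, ε, t)) t := by
    intro t ht
    obtain ⟨x, hx, hxV, hxγ⟩ := exists_of_mem_chartSet (hγV t ht)
    have hW := hVW hxV
    have hηt : η t = chartAt E (C.b j) x := by
      rw [hη]
      simp only
      rw [← hxγ, (chartAt E (C.b i)).left_inv hx]
    rw [hηt, F.compat i hi j hj x ⟨C.V_subset_W_self i hxV, hW⟩ ε
      ⟨by linarith [hε.1, L.le], by linarith [hε.2, L.le]⟩ t ht, hxγ]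
    have h1 := (contDiffAt_transition hx hW.1).differentiableAt (by simp)
    rw [hxγ] at h1
    exact h1.hasFDerivAt.comp_hasDerivAt t (hγ t ht)
  have hφd : ∀ t ∈ Icc (0 : ℝ) 1, HasDerivAt (fun t ↦ L.φ j (η 0, ε, t))
      (ε • F.G j (L.φ j (η 0, ε, t), ε, t)) t := fun t ht ↦
    L.deriv j hj _ ε hε t ⟨by linarith [ht.1], by linarith [ht.2]⟩
  obtain ⟨K, hK⟩ := (F.smooth j).lipschitzWith_of_hasCompactSupport (F.supp j) (by simp)
  have hlip : ∀ t, LipschitzWith (‖ε‖₊ * (K * 1)) fun y ↦ ε • F.G j (y, ε, t) := fun t ↦ by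
    have h1 : LipschitzWith 1 fun y : E ↦ (y, ε, t) := LipschitzWith.prodMk_right (ε, t)
    exact (lipschitzWith_smul ε).comp (hK.comp h1)
  have huniq := ODE_solution_unique (v := fun t y ↦ ε • F.G j (y, ε, t)) hlip
    (fun t ht ↦ (hφd t ht).continuousAt.continuousWithinAt)
    (fun t ht ↦ (hφd t (Ico_subset_Icc_self ht)).hasDerivWithinAt)
    (fun t ht ↦ (hηd t ht).continuousAt.continuousWithinAt)
    (fun t ht ↦ (hηd t (Ico_subset_Icc_self ht)).hasDerivWithinAt)
    (L.init j hj _ ε hε) ht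
  change (chartAt E (C.b j)).symm (L.φ j (η 0, ε, t)) = _
  simp only at huniq
  rw [huniq]
  exact (chartAt E (C.b j)).left_inv (hVW (hγV t ht).2).1

/-- The time-one map of a local flow. -/
def map (ε : ℝ) (x : M) : M :=
  (chartAt E (C.b (C.index x))).symm
    (L.φ (C.index x) (chartAt E (C.b (C.index x)) x, ε, 1))

variable [IsManifold 𝓘(ℝ, E) ∞ M]

/-- The choice of `C.index x` is immaterial. Since the index may jump from point to point, this is
what makes the map smooth: near `x` a single ball can be used. -/
theorem map_eq {i x : M} (hi : i ∈ C.I) (hx : x ∈ C.U i) {ε : ℝ} (hε : ε ∈ Ioo (-L.ε₀) L.ε₀) :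
    L.map ε x = (chartAt E (C.b i)).symm (L.φ i (chartAt E (C.b i) x, ε, 1)) := by
  have h0 : (chartAt E (C.b i)).symm (L.φ i (chartAt E (C.b i) x, ε, 0)) = x := by
    rw [L.init i hi _ ε hε, (chartAt E (C.b i)).left_inv (C.mem_source hx)]
  have h := L.eq_of_curve hi (C.index_mem x) hε (γ := fun t ↦ L.φ i (chartAt E (C.b i) x, ε, t))
    (fun t ht ↦ L.deriv i hi _ ε hε t ⟨by linarith [ht.1], by linarith [ht.2]⟩)
    (fun t ht ↦ L.mem i hi x hx ε hε t ht) (by rw [h0]; exact C.mem_U_index x)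
    (t := 1) ⟨zero_le_one, le_rfl⟩
  rwa [h0] at h

/-- The time-one map of the reversed field is the inverse of the time-one map. -/
theorem map_map {F' : ChartFields C} (L' : LocalFlow F')
    (hF : ∀ i p, F'.G i p = -F.G i (p.1, p.2.1, 1 - p.2.2)) {ε : ℝ}
    (hε : ε ∈ Ioo (-L.ε₀) L.ε₀) (hε' : ε ∈ Ioo (-L'.ε₀) L'.ε₀) (x : M) :
    L'.map ε (L.map ε x) = x := by
  set i := C.index x with hi
  have hiI : i ∈ C.I := C.index_mem x
  have hx : x ∈ C.U i := C.mem_U_index x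
  set y := chartAt E (C.b i) x with hy
  have h0 : (chartAt E (C.b i)).symm (L.φ i (y, ε, 0)) = x := by
    rw [L.init i hiI _ ε hε, (chartAt E (C.b i)).left_inv (C.mem_source hx)]
  have h1 : (chartAt E (C.b i)).symm (L.φ i (y, ε, 1 - 0)) = L.map ε x := by
    rw [sub_zero, L.map_eq hiI hx hε]
  -- The orbit of `x` run backwards solves the reversed equation, starting at `L.map ε x` and ending
  -- at `x`.
  have h := L'.eq_of_curve hiI (C.index_mem (L.map ε x)) hε'
    (γ := fun t ↦ L.φ i (y, ε, 1 - t))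
    (fun t ht ↦ by
      have e1 := (L.deriv i hiI y ε hε (1 - t) ⟨by linarith [ht.2], by linarith [ht.1]⟩).scomp t
        ((hasDerivAt_id' t).const_sub 1)
      rw [hF, smul_neg]
      exact e1.congr_deriv (neg_one_smul ℝ (_ : E)))
    (fun t ht ↦ L.mem i hiI x hx ε hε (1 - t) ⟨by linarith [ht.2], by linarith [ht.1]⟩)
    (by rw [h1]; exact C.mem_U_index _) (t := 1) ⟨zero_le_one, le_rfl⟩
  rw [h1, sub_self, h0] at h
  exact h

theorem contMDiffOn_map : ContMDiffOn (𝓘(ℝ, E).prod 𝓘(ℝ, ℝ)) 𝓘(ℝ, E) ∞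
    (fun p : M × ℝ ↦ L.map p.2 p.1) (univ ×ˢ Ioo (-L.ε₀) L.ε₀) := by
  rintro ⟨x, ε⟩ ⟨-, hε⟩
  set i := C.index x with hi
  have hiI : i ∈ C.I := C.index_mem x
  have hx : x ∈ C.U i := C.mem_U_index x
  have hmem := L.mem i hiI x hx ε hε 1 ⟨zero_le_one, le_rfl⟩
  have h1 : ContMDiffAt (𝓘(ℝ, E).prod 𝓘(ℝ, ℝ)) 𝓘(ℝ, E) ∞
      (fun p : M × ℝ ↦ chartAt E (C.b i) p.1) (x, ε) :=
    ContMDiffAt.comp (x, ε) (contMDiffAt_of_mem_maximalAtlas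
      (IsManifold.chart_mem_maximalAtlas (C.b i)) (C.mem_source hx)) contMDiffAt_fst
  have h2 : ContMDiffAt (𝓘(ℝ, E).prod 𝓘(ℝ, ℝ)) 𝓘(ℝ, E × ℝ × ℝ) ∞
      (fun p : M × ℝ ↦ (chartAt E (C.b i) p.1, p.2, (1 : ℝ))) (x, ε) :=
    h1.prodMk_space (contMDiffAt_snd.prodMk_space contMDiffAt_const)
  have h3 : ContMDiffAt 𝓘(ℝ, E × ℝ × ℝ) 𝓘(ℝ, E) ∞ (L.φ i) (chartAt E (C.b i) x, ε, (1 : ℝ)) := by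
    rw [contMDiffAt_iff_contDiffAt]
    exact (L.smooth i hiI).contDiffAt ((isOpen_univ.prod (isOpen_Ioo.prod isOpen_Ioo)).mem_nhds
      ⟨mem_univ _, hε, by norm_num, by norm_num⟩)
  have h4 : ContMDiffAt 𝓘(ℝ, E) 𝓘(ℝ, E) ∞ (chartAt E (C.b i)).symm
      (L.φ i (chartAt E (C.b i) x, ε, (1 : ℝ))) :=
    contMDiffAt_symm_of_mem_maximalAtlas (IsManifold.chart_mem_maximalAtlas (C.b i)) hmem.1
  have h5 := ContMDiffAt.comp (x, ε) h4 (ContMDiffAt.comp (x, ε) h3 h2)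
  refine (h5.congr_of_eventuallyEq ?_).contMDiffWithinAt
  filter_upwards [((C.isOpen_U i).prod isOpen_Ioo).mem_nhds ⟨hx, hε⟩] with p hp
  exact L.map_eq hiI hp.1 hp.2

theorem contMDiff_map {ε : ℝ} (hε : ε ∈ Ioo (-L.ε₀) L.ε₀) :
    ContMDiff 𝓘(ℝ, E) 𝓘(ℝ, E) ∞ (L.map ε) := by
  rw [← contMDiffOn_univ]
  exact L.contMDiffOn_map.comp (f := fun x : M ↦ (x, ε))
    (contMDiff_id.prodMk contMDiff_const).contMDiffOn fun x _ ↦ ⟨mem_univ _, hε⟩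

theorem mfderiv_map {i x : M} (hi : i ∈ C.I) (hx : x ∈ C.U i) {ε : ℝ}
    (hε : ε ∈ Ioo (-L.ε₀) L.ε₀) :
    mfderiv 𝓘(ℝ, E) 𝓘(ℝ, E) (L.map ε) x =
      symmD (C.b i) (L.φ i (chartAt E (C.b i) x, ε, 1)) ∘L
        (fderiv ℝ (fun y ↦ L.φ i (y, ε, 1)) (chartAt E (C.b i) x) ∘L chartD E (C.b i) x) := by
  have : IsManifold 𝓘(ℝ, E) 1 M := IsManifold.of_le (n := ∞) (by simp)
  have hmem := L.mem i hi x hx ε hε 1 ⟨zero_le_one, le_rfl⟩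
  have e1 : L.map ε =ᶠ[𝓝 x] (chartAt E (C.b i)).symm ∘ (fun y ↦ L.φ i (y, ε, 1)) ∘
      chartAt E (C.b i) := by
    filter_upwards [(C.isOpen_U i).mem_nhds hx] with x' hx'
    exact L.map_eq hi hx' hε
  have hφ : ContDiffAt ℝ ∞ (fun y ↦ L.φ i (y, ε, 1)) (chartAt E (C.b i) x) :=
    ContDiffAt.comp _ ((L.smooth i hi).contDiffAt
      ((isOpen_univ.prod (isOpen_Ioo.prod isOpen_Ioo)).mem_nhds
      ⟨mem_univ _, hε, by norm_num, by norm_num⟩)) (by fun_prop)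
  have d1 := (mdifferentiable_chart (I := 𝓘(ℝ, E)) (C.b i)).mdifferentiableAt (C.mem_source hx)
  have d2 := (hφ.differentiableAt (by simp)).mdifferentiableAt
  have d3 := (mdifferentiable_chart (I := 𝓘(ℝ, E)) (C.b i)).mdifferentiableAt_symm hmem.1
  rw [e1.mfderiv_eq]
  have h1 := mfderiv_comp x (g := (fun y ↦ L.φ i (y, ε, 1))) d2 d1
  rw [mfderiv_eq_fderiv] at h1
  have h2 := mfderiv_comp x (g := (chartAt E (C.b i)).symm) (f := (fun y ↦ L.φ i (y, ε, 1)) ∘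
      chartAt E (C.b i)) d3 (d2.comp x d1)
  rw [h1] at h2
  exact h2

end LocalFlow

end ManifoldFlow

/-! ### Smooth cutoff functions. -/

section Cutoff

theorem exists_contDiff_cutoff {X : Type*} [NormedAddCommGroup X] [NormedSpace ℝ X]
    [FiniteDimensional ℝ X] {K D : Set X} (hK : IsCompact K) (hD : IsOpen D) (hKD : K ⊆ D) :
    ∃ χ : X → ℝ, ContDiff ℝ ∞ χ ∧ HasCompactSupport χ ∧ tsupport χ ⊆ D ∧ ∀ x ∈ K, χ x = 1 := by
  have : ProperSpace X := FiniteDimensional.proper ℝ X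
  obtain ⟨K', hK', hKK', hK'D⟩ := exists_compact_between hK hD hKD
  obtain ⟨χ, h0, h1, -⟩ := exists_contMDiffMap_zero_one_of_isClosed 𝓘(ℝ, X) (n := ⊤)
    (isOpen_interior (s := K')).isClosed_compl hK.isClosed
    (disjoint_left.2 fun x hx hx' ↦ hx (hKK' hx'))
  have hs : tsupport χ ⊆ K' := by
    refine closure_minimal (fun x hx ↦ ?_) hK'.isClosed
    by_contra h
    exact hx (h0 fun h' ↦ h (interior_subset h'))
  exact ⟨χ, χ.contMDiff.contDiff, hK'.of_isClosed_subset (isClosed_tsupport _) hs, hs.trans hK'D,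
    fun x hx ↦ h1 hx⟩

end Cutoff

/-! ### Solving Moser's equation across the singular parameter. -/

section Sharp

variable (E : Type*) [NormedAddCommGroup E] [NormedSpace ℝ E] [FiniteDimensional ℝ E]

theorem finrank_dual : Module.finrank ℝ (E →L[ℝ] ℝ) = Module.finrank ℝ E := by
  rw [← (LinearMap.toContinuousLinearMap : (E →ₗ[ℝ] ℝ) ≃ₗ[ℝ] (E →L[ℝ] ℝ)).finrank_eq]
  exact Subspace.dual_finrank_eq

/-- A finite-dimensional space is isomorphic to its bidual. -/
def bidual : E ≃L[ℝ] ((E →L[ℝ] ℝ) →L[ℝ] ℝ) :=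
  (LinearMap.linearEquivOfInjective (NormedSpace.inclusionInDoubleDual ℝ E).toLinearMap
    (fun x y h ↦ (NormedSpace.inclusionInDoubleDualLi (E := E) ℝ).injective h)
    (by rw [finrank_dual, finrank_dual])).toContinuousLinearEquiv

/-- The map `E^* → E` associated with a bivector, as a function of the bivector. -/
def sharp : ((E →L[ℝ] ℝ) [⋀^Fin 2]→L[ℝ] ℝ) →L[ℝ] (E →L[ℝ] ℝ) →L[ℝ] E :=
  ContinuousLinearMap.compL ℝ (E →L[ℝ] ℝ) ((E →L[ℝ] ℝ) →L[ℝ] ℝ) E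
    ((bidual E).symm : ((E →L[ℝ] ℝ) →L[ℝ] ℝ) →L[ℝ] E) ∘L flat (E →L[ℝ] ℝ)

variable {E}

theorem apply_sharp (j : (E →L[ℝ] ℝ) [⋀^Fin 2]→L[ℝ] ℝ) (α β : E →L[ℝ] ℝ) :
    β (sharp E j α) = j ![α, β] := by
  have h : bidual E (sharp E j α) = flat (E →L[ℝ] ℝ) j α := (bidual E).apply_symm_apply _
  rw [← flat_apply, ← h]
  rfl

/-- The hypothesis makes `sharp E j` surjective, and `E` and its dual have equal dimension. -/
theorem sharp_injective {j : (E →L[ℝ] ℝ) [⋀^Fin 2]→L[ℝ] ℝ} {σ : E [⋀^Fin 2]→L[ℝ] ℝ} {c : ℝ}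
    (hc : c ≠ 0) (h : ∀ X, sharp E j (flat E σ X) = c • X) : Function.Injective (sharp E j) := by
  have hs : Function.Surjective (sharp E j) := fun X ↦
    ⟨flat E σ (c⁻¹ • X), by rw [h, smul_inv_smul₀ hc]⟩
  exact (LinearMap.injective_iff_surjective_of_finrank_eq_finrank
    (f := (sharp E j).toLinearMap) (finrank_dual E)).2 hs

/-- The operator `1 + s j R` on `E`. -/
def moserOp (j : (E →L[ℝ] ℝ) [⋀^Fin 2]→L[ℝ] ℝ) (R : E [⋀^Fin 2]→L[ℝ] ℝ) (s : ℝ) : E →L[ℝ] E :=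
  1 + s • (sharp E j ∘L flat E R)

/-- The cancellation behind the theorem: the bivector turns `σ` into `-ε^d`, and the perturbation of
order `ε^(d+1)` leaves one spare factor `ε` once `ε^d` is taken out. -/
theorem sharp_flat_sub {j : (E →L[ℝ] ℝ) [⋀^Fin 2]→L[ℝ] ℝ} {σ R : E [⋀^Fin 2]→L[ℝ] ℝ} {ε : ℝ}
    {d : ℕ} (h : ∀ X, sharp E j (flat E σ X) = (-ε ^ d) • X) (t : ℝ) (X : E) :
    sharp E j (flat E (σ - ((1 - t) * ε ^ (d + 1)) • R) X) =
      (-ε ^ d) • moserOp j R ((1 - t) * ε) X := by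
  rw [map_sub, map_smul, sub_apply, map_sub, h, moserOp]
  simp only [smul_apply, map_smul, add_apply,
    one_apply_eq_self, ContinuousLinearMap.comp_apply, smul_add, smul_smul]
  rw [sub_eq_add_neg, ← neg_smul]
  congr 2
  ring

theorem flat_injective_of_isUnit {j : (E →L[ℝ] ℝ) [⋀^Fin 2]→L[ℝ] ℝ} {σ R : E [⋀^Fin 2]→L[ℝ] ℝ}
    {ε : ℝ} (hε : ε ≠ 0) {d : ℕ} (h : ∀ X, sharp E j (flat E σ X) = (-ε ^ d) • X) {t : ℝ}
    (hA : IsUnit (moserOp j R ((1 - t) * ε))) {X : E}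
    (hX : flat E (σ - ((1 - t) * ε ^ (d + 1)) • R) X = 0) : X = 0 := by
  have h1 := sharp_flat_sub (R := R) h t X
  rw [hX, map_zero] at h1
  have h2 := (smul_eq_zero_iff_right (neg_ne_zero.2 (pow_ne_zero d hε))).1 h1.symm
  obtain ⟨A, hA⟩ := hA
  rw [← hA] at h2
  have h3 : (A⁻¹.1 * A.1) X = 0 := by
    rw [mul_apply_eq_comp, h2, map_zero]
  rwa [A.inv_mul] at h3

/-- The equation for `Y` stays regular at `ε = 0`. For `ε ≠ 0`, applying the injective map `sharp E
j` turns the claim into that equation multiplied by `-ε^(d+1)`; for `ε = 0` both sides vanish. -/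
theorem flat_sub_eq {j : (E →L[ℝ] ℝ) [⋀^Fin 2]→L[ℝ] ℝ} {σ R : E [⋀^Fin 2]→L[ℝ] ℝ}
    {ε : ℝ} {d : ℕ} (h : ε ≠ 0 → ∀ X, sharp E j (flat E σ X) = (-ε ^ d) • X) {t : ℝ}
    {θ : E →L[ℝ] ℝ} {Y : E} (hY : moserOp j R ((1 - t) * ε) Y = sharp E j θ) :
    flat E (σ - ((1 - t) * ε ^ (d + 1)) • R) (ε • Y) = (-ε ^ (d + 1)) • θ := by
  by_cases hε : ε = 0
  · simp [hε]
  · refine sharp_injective (neg_ne_zero.2 (pow_ne_zero d hε)) (h hε) ?_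
    rw [map_smul, map_smul, map_smul, sharp_flat_sub (h hε), hY, smul_smul]
    congr 1
    ring

/-- `moserOp` is the identity at `ε = 0`, hence invertible near the compact set `K × {0} × [0, 1]`.
The solution is multiplied by a cutoff equal to `1` on `K × [-η, η] × [0, 1]`, which makes it
globally smooth with compact support. -/
theorem exists_moserField {j : E × ℝ → (E →L[ℝ] ℝ) [⋀^Fin 2]→L[ℝ] ℝ}
    {R : E × ℝ → E [⋀^Fin 2]→L[ℝ] ℝ} {θ : E × ℝ → E [⋀^Fin 1]→L[ℝ] ℝ} {U K : Set E}
    (hU : IsOpen U) (hK : IsCompact K) (hKU : K ⊆ U) (hj : ContDiffOn ℝ ∞ j (U ×ˢ univ))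
    (hR : ContDiffOn ℝ ∞ R (U ×ˢ univ)) (hθ : ContDiffOn ℝ ∞ θ (U ×ˢ univ)) :
    ∃ G : E × ℝ × ℝ → E, ContDiff ℝ ∞ G ∧ HasCompactSupport G ∧ ∃ δ : ℝ, 0 < δ ∧
      ∀ y ∈ K, ∀ ε ∈ Ioo (-δ) δ, ∀ t ∈ Icc (0 : ℝ) 1,
        IsUnit (moserOp (j (y, ε)) (R (y, ε)) ((1 - t) * ε)) ∧
        moserOp (j (y, ε)) (R (y, ε)) ((1 - t) * ε) (G (y, ε, t)) =
          sharp E (j (y, ε)) (covector E (θ (y, ε))) := by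
  have : CompleteSpace E := FiniteDimensional.complete ℝ E
  have hUo : IsOpen (U ×ˢ (univ : Set (ℝ × ℝ))) := hU.prod isOpen_univ
  set π : E × ℝ × ℝ → E × ℝ := fun p ↦ (p.1, p.2.1) with hπ
  have hπs : ContDiff ℝ ∞ π := by fun_prop
  have hπU : MapsTo π (U ×ˢ univ) (U ×ˢ univ) := fun p hp ↦ ⟨hp.1, trivial⟩
  have hsj : ContDiffOn ℝ ∞ (fun p ↦ sharp E (j (π p))) (U ×ˢ univ) :=
    contDiffOn_clm_map (F := (E →L[ℝ] ℝ) [⋀^Fin 2]→L[ℝ] ℝ) (G := (E →L[ℝ] ℝ) →L[ℝ] E)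
      (hj.comp hπs.contDiffOn hπU) (sharp E)
  have hfR : ContDiffOn ℝ ∞ (fun p ↦ flat E (R (π p))) (U ×ˢ univ) :=
    contDiffOn_clm_map (F := E [⋀^Fin 2]→L[ℝ] ℝ) (G := E →L[ℝ] E →L[ℝ] ℝ)
      (hR.comp hπs.contDiffOn hπU) (flat E)
  have hcθ : ContDiffOn ℝ ∞ (fun p ↦ covector E (θ (π p))) (U ×ˢ univ) :=
    contDiffOn_clm_map (F := E [⋀^Fin 1]→L[ℝ] ℝ) (G := E →L[ℝ] ℝ)
      (hθ.comp hπs.contDiffOn hπU) (covector E)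
  set A : E × ℝ × ℝ → E →L[ℝ] E := fun p ↦
    moserOp (j (π p)) (R (π p)) ((1 - p.2.2) * p.2.1) with hA
  have hAs : ContDiffOn ℝ ∞ A (U ×ˢ univ) := by
    have hs : ContDiff ℝ ∞ fun p : E × ℝ × ℝ ↦ (1 - p.2.2) * p.2.1 := by fun_prop
    exact contDiffOn_const.add (hs.contDiffOn.smul (hsj.clm_comp hfR))
  set D : Set (E × ℝ × ℝ) := (U ×ˢ univ) ∩ A ⁻¹' {a | IsUnit a} with hD
  have hDo : IsOpen D := hAs.continuousOn.isOpen_inter_preimage hUo Units.isOpen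
  have hYs : ContDiffOn ℝ ∞ (fun p ↦ Ring.inverse (A p) (sharp E (j (π p))
      (covector E (θ (π p))))) D := by
    refine ContDiffOn.clm_apply (fun p hp ↦ ?_) ((hsj.clm_apply hcθ).mono inter_subset_left)
    obtain ⟨a, ha⟩ := hp.2
    have h1 : ContDiffAt ℝ ∞ Ring.inverse (A p) := by
      rw [← ha]
      exact contDiffAt_ringInverse ℝ a
    exact h1.comp_contDiffWithinAt p ((hAs p hp.1).mono inter_subset_left)
  have hKD : K ×ˢ (({0} : Set ℝ) ×ˢ Icc (0 : ℝ) 1) ⊆ D := by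
    rintro ⟨y, ε, t⟩ ⟨hy, hε, ht⟩
    obtain rfl : ε = 0 := hε
    refine ⟨⟨hKU hy, trivial⟩, ?_⟩
    change IsUnit (moserOp _ _ ((1 - t) * 0))
    simp [moserOp]
  obtain ⟨u, v, -, hv, hKu, h0v, huv⟩ := generalized_tube_lemma hK
    (isCompact_singleton.prod isCompact_Icc) hDo hKD
  obtain ⟨a, b, ha, -, h0a, hb, hab⟩ := generalized_tube_lemma isCompact_singleton
    isCompact_Icc hv h0v
  obtain ⟨η, hη, hηa⟩ := Metric.nhds_basis_closedBall.mem_iff.1 (ha.mem_nhds (h0a rfl))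
  have hK'D : K ×ˢ (Metric.closedBall (0 : ℝ) η ×ˢ Icc (0 : ℝ) 1) ⊆ D :=
    fun p hp ↦ huv ⟨hKu hp.1, hab ⟨hηa hp.2.1, hb hp.2.2⟩⟩
  obtain ⟨χ, hχ, hχc, hχD, hχ1⟩ := exists_contDiff_cutoff
    (hK.prod ((isCompact_closedBall (0 : ℝ) η).prod isCompact_Icc)) hDo hK'D
  refine ⟨fun p ↦ χ p • Ring.inverse (A p) (sharp E (j (π p)) (covector E (θ (π p)))),
    contDiff_iff_contDiffAt.2 fun p ↦ ?_, hχc.smul_right, η, hη, fun y hy ε hε t ht ↦ ?_⟩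
  · by_cases hp : p ∈ tsupport χ
    · exact hχ.contDiffAt.smul (hYs.contDiffAt (hDo.mem_nhds (hχD hp)))
    · refine ContDiffAt.congr_of_eventuallyEq (f := fun _ ↦ (0 : E)) contDiffAt_const ?_
      filter_upwards [(isClosed_tsupport χ).isOpen_compl.mem_nhds hp] with q hq
      rw [image_eq_zero_of_notMem_tsupport hq, zero_smul]
  · have hp : (y, ε, t) ∈ K ×ˢ (Metric.closedBall (0 : ℝ) η ×ˢ Icc (0 : ℝ) 1) := by
      refine ⟨hy, ?_, ht⟩
      rw [Real.closedBall_eq_Icc]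
      exact ⟨by linarith [hε.1], by linarith [hε.2]⟩
    have hunit : IsUnit (A (y, ε, t)) := (hK'D hp).2
    refine ⟨hunit, ?_⟩
    simp only [hχ1 _ hp, one_smul]
    change (A (y, ε, t) * Ring.inverse (A (y, ε, t))) _ = _
    rw [Ring.mul_inverse_cancel _ hunit]
    rfl

end Sharp

/-! ### The Moser field in the charts of a good cover. -/

section Manifold

universe u

variable {E : Type u} [NormedAddCommGroup E] [NormedSpace ℝ E] [FiniteDimensional ℝ E]
  {M : Type*} [TopologicalSpace M] [ChartedSpace E M] [IsManifold 𝓘(ℝ, E) ∞ M]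

/-- The defining property of the inverse Poisson bivector, in a chart. -/
theorem sharp_flat_inChart {j : BivectorField E M} {σ : DiffForm E M 2} {c : ℝ} (hc : c ≠ 0)
    (h : IsPoissonBivectorOf (c⁻¹ • j) σ) {x₀ x : M} (hx : x ∈ (chartAt E x₀).source) (X : E) :
    sharp E (j.inChart x₀ (chartAt E x₀ x)) (flat E (σ.inChart x₀ (chartAt E x₀ x)) X) =
      (-c) • X := by
  have hbi : ∀ α β : E →L[ℝ] ℝ, j.inChart x₀ (chartAt E x₀ x) ![α, β] =
      (show (E →L[ℝ] ℝ) [⋀^Fin 2]→L[ℝ] ℝ from j x) ![α ∘L chartD E x₀ x, β ∘L chartD E x₀ x] := by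
    intro α β
    rw [BivectorField.inChart, (chartAt E x₀).left_inv hx]
    change (show (E →L[ℝ] ℝ) [⋀^Fin 2]→L[ℝ] ℝ from j x) _ = _
    congr 1
    ext i
    fin_cases i <;> rfl
  refine (bidual E).injective (ContinuousLinearMap.ext fun β ↦ ?_)
  change β (sharp E _ _) = β ((-c) • X)
  rw [apply_sharp, hbi]
  have h1 := h x (symmD x₀ (chartAt E x₀ x) X)
    (flat E (σ.inChart x₀ (chartAt E x₀ x)) X ∘L chartD E x₀ x) (β ∘L chartD E x₀ x) (fun Y ↦ by
      change flat E (σ.inChart x₀ (chartAt E x₀ x)) X (chartD E x₀ x Y) = _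
      rw [flat_apply, σ.inChart_chart hx]
      change (σ.val x) _ = (σ.val x) _
      congr 1
      ext i
      fin_cases i
      · rfl
      · exact DFunLike.congr_fun (symmD_comp_chartD hx) Y)
  have h2 : (β ∘L chartD E x₀ x) (symmD x₀ (chartAt E x₀ x) X) = β X :=
    congrArg β (DFunLike.congr_fun (chartD_comp_symmD hx) X)
  have h3 : c⁻¹ * (show (E →L[ℝ] ℝ) [⋀^Fin 2]→L[ℝ] ℝ from j x)
      ![flat E (σ.inChart x₀ (chartAt E x₀ x)) X ∘L chartD E x₀ x, β ∘L chartD E x₀ x] =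
      -β X := by
    rw [← h2]
    exact h1
  rw [map_smul, smul_eq_mul, ← mul_right_inj' (inv_ne_zero hc), h3]
  field_simp

omit [FiniteDimensional ℝ E] in
theorem fderiv_transition_surjective {x₀ x₁ x : M} (h₀ : x ∈ (chartAt E x₀).source)
    (h₁ : x ∈ (chartAt E x₁).source) :
    Function.Surjective (fderiv ℝ (transition E x₀ x₁) (chartAt E x₀ x)) := by
  intro w
  refine ⟨chartD E x₀ x (symmD x₁ (chartAt E x₁ x) w), ?_⟩
  rw [fderiv_transition h₀ h₁, ContinuousLinearMap.comp_apply]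
  have e1 := DFunLike.congr_fun (symmD_comp_chartD h₀) (symmD x₁ (chartAt E x₁ x) w)
  have e2 := DFunLike.congr_fun (chartD_comp_symmD h₁) w
  rw [ContinuousLinearMap.comp_apply] at e1 e2
  rw [e1]
  exact e2

/-- The path of forms joining `Ω - ε ^ (d + 1) R` to `Ω`. -/
def moserPath (Ω R : ℝ → DiffForm E M 2) (d : ℕ) (ε t : ℝ) : DiffForm E M 2 :=
  Ω ε - ((1 - t) * ε ^ (d + 1)) • R ε

/-- Moser's equation does not depend on the chart, and for `ε ≠ 0` the path is non-degenerate, so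
its solutions in two charts correspond under the transition map. At `ε = 0` both fields vanish. -/
theorem exists_chartFields [T2Space M] [CompactSpace M] (C : GoodCover E M)
    {Ω R : ℝ → DiffForm E M 2} {θ : ℝ → DiffForm E M 1} {j : ℝ → BivectorField E M} {d : ℕ}
    (hR : SmoothFamilyOn R univ) (hθ : SmoothFamilyOn θ univ) (hj : IsSmoothBivectorFamily j)
    (hjΩ : ∀ ε : ℝ, ε ≠ 0 → IsPoissonBivectorOf ((ε ^ d)⁻¹ • j ε) (Ω ε)) :
    ∃ F : ChartFields C, ∀ i ∈ C.I, ∀ x ∈ C.W i, ∀ ε ∈ Ioo (-F.δ) F.δ, ∀ t ∈ Icc (0 : ℝ) 1, ∀ w,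
      (moserPath Ω R d ε t).inChart (C.b i) (chartAt E (C.b i) x)
        ![ε • F.G i (chartAt E (C.b i) x, ε, t), w] =
      -(ε ^ (d + 1) • θ ε).inChart (C.b i) (chartAt E (C.b i) x) ![w] := by
  have hsm : ∀ i, _ := fun i ↦ exists_moserField (E := E)
    (j := fun p ↦ (j p.2).inChart (C.b i) p.1) (R := fun p ↦ (R p.2).inChart (C.b i) p.1)
    (θ := fun p ↦ (θ p.2).inChart (C.b i) p.1)
    (chartAt E (C.b i)).open_target (isCompact_closedBall _ _) (C.ball_R (C.b i)) (hj (C.b i))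
    (smoothFamilyOn_univ.1 hR (C.b i)) (smoothFamilyOn_univ.1 hθ (C.b i))
  choose G hG hGc δ hδ hGe using hsm
  obtain ⟨s, hs, hs0⟩ : ∃ s : ℝ, (∀ i ∈ C.I, s ≤ δ i) ∧ 0 < s := by
    have hev : ∀ᶠ s in 𝓝[>] (0 : ℝ), ∀ i ∈ C.I, s ≤ δ i :=
      (Finset.eventually_all C.I).2 fun i _ ↦ (eventually_le_nhds (hδ i)).filter_mono
        nhdsWithin_le_nhds
    exact (hev.and self_mem_nhdsWithin).exists
  have hsub : ∀ i ∈ C.I, Ioo (-s) s ⊆ Ioo (-δ i) (δ i) := fun i hi ↦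
    Ioo_subset_Ioo (by linarith [hs i hi]) (hs i hi)
  have hsf : ∀ i, ∀ x ∈ C.W i, ∀ ε : ℝ, ε ≠ 0 → ∀ X,
      sharp E ((j ε).inChart (C.b i) (chartAt E (C.b i) x))
        (flat E ((Ω ε).inChart (C.b i) (chartAt E (C.b i) x)) X) = (-ε ^ d) • X :=
    fun i x hx ε hε X ↦ sharp_flat_inChart (pow_ne_zero d hε) (hjΩ ε hε) hx.1 X
  have hpath : ∀ i x ε t, (moserPath Ω R d ε t).inChart (C.b i) (chartAt E (C.b i) x) =
      (Ω ε).inChart (C.b i) (chartAt E (C.b i) x) -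
      ((1 - t) * ε ^ (d + 1)) • (R ε).inChart (C.b i) (chartAt E (C.b i) x) :=
    fun i x ε t ↦ rfl
  have heq : ∀ i ∈ C.I, ∀ x ∈ C.W i, ∀ ε ∈ Ioo (-s) s, ∀ t ∈ Icc (0 : ℝ) 1, ∀ w,
      (moserPath Ω R d ε t).inChart (C.b i) (chartAt E (C.b i) x)
        ![ε • G i (chartAt E (C.b i) x, ε, t), w] =
      -(ε ^ (d + 1) • θ ε).inChart (C.b i) (chartAt E (C.b i) x) ![w] := by
    intro i hi x hx ε hε t ht w
    have hB : chartAt E (C.b i) x ∈ Metric.closedBall (chartAt E (C.b i) (C.b i)) (C.R (C.b i)) :=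
      Metric.ball_subset_closedBall hx.2
    have h1 := flat_sub_eq (hsf i x hx ε) (hGe i _ hB ε (hsub i hi hε) t ht).2
    have h2 := DFunLike.congr_fun h1 w
    rw [flat_apply, ← hpath, smul_apply, covector_apply, smul_eq_mul,
      neg_mul] at h2
    exact h2
  refine ⟨⟨G, hG, hGc, s, hs0, fun i hi k hk x hx ε hε t ht ↦ ?_⟩, heq⟩
  by_cases hε0 : ε = 0
  · simp [hε0]
  set T := fderiv ℝ (transition E (C.b i) (C.b k)) (chartAt E (C.b i) x) with hT
  have hB : chartAt E (C.b k) x ∈ Metric.closedBall (chartAt E (C.b k) (C.b k)) (C.R (C.b k)) :=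
    Metric.ball_subset_closedBall hx.2.2
  rw [← sub_eq_zero]
  refine flat_injective_of_isUnit hε0 (hsf k x hx.2 ε hε0)
    (hGe k _ hB ε (hsub k hk hε) t ht).1 ?_
  rw [← hpath, map_sub, sub_eq_zero]
  ext w
  -- Test vectors can be taken in the image of the transition derivative, where the equation of the
  -- first chart applies.
  obtain ⟨w, rfl⟩ := fderiv_transition_surjective hx.1.1 hx.2.1 w
  rw [flat_apply, flat_apply, heq k hk x hx.2 ε hε t ht]
  have e1 := heq i hi x hx.1 ε hε t ht w
  rw [DiffForm.inChart_transition _ hx.1.1 hx.2.1,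
    DiffForm.inChart_transition (ε ^ (d + 1) • θ ε) hx.1.1 hx.2.1, transition_chart hx.1.1] at e1
  have v2 : ∀ a b : E, (fun i ↦ T (![a, b] i)) = ![T a, T b] := fun a b ↦ by
    ext i
    fin_cases i <;> rfl
  have v1 : ∀ a : E, (fun i ↦ T (![a] i)) = ![T a] := fun a ↦ by
    ext i
    fin_cases i
    rfl
  have e2 : (moserPath Ω R d ε t).inChart (C.b k) (chartAt E (C.b k) x)
        (fun l ↦ T (![ε • G i (chartAt E (C.b i) x, ε, t), w] l)) =
      -(ε ^ (d + 1) • θ ε).inChart (C.b k) (chartAt E (C.b k) x) (fun l ↦ T (![w] l)) := e1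
  rw [v2, v1] at e2
  exact e2.symm

end Manifold

/-! ### The diffeomorphisms and the pullback identity. -/

section Darboux

universe u

variable {E : Type u} [NormedAddCommGroup E] [NormedSpace ℝ E] [FiniteDimensional ℝ E]
  {M : Type*} [TopologicalSpace M] [ChartedSpace E M] [IsManifold 𝓘(ℝ, E) ∞ M]

omit [FiniteDimensional ℝ E] [IsManifold 𝓘(ℝ, E) ∞ M] in
/-- Diffeomorphisms for `ε ∈ I` extended by the identity to all `ε`. -/
theorem exists_diffeomorph_family {f g : ℝ → M → M} {I : Set ℝ}
    (hf : ∀ ε ∈ I, ContMDiff 𝓘(ℝ, E) 𝓘(ℝ, E) ∞ (f ε))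
    (hg : ∀ ε ∈ I, ContMDiff 𝓘(ℝ, E) 𝓘(ℝ, E) ∞ (g ε))
    (hgf : ∀ ε ∈ I, ∀ x, g ε (f ε x) = x) (hfg : ∀ ε ∈ I, ∀ x, f ε (g ε x) = x) :
    ∃ Ψ : ℝ → Diffeomorph 𝓘(ℝ, E) 𝓘(ℝ, E) M M ∞, ∀ ε ∈ I, ⇑(Ψ ε) = f ε := by
  classical
  refine ⟨fun ε ↦ if h : ε ∈ I then
    { toFun := f ε
      invFun := g ε
      left_inv := hgf ε h
      right_inv := hfg ε h
      contMDiff_toFun := hf ε h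
      contMDiff_invFun := hg ε h } else Diffeomorph.refl _ _ _, fun ε h ↦ ?_⟩
  simp only [h, dite_true]
  rfl

omit [FiniteDimensional ℝ E] in
-- Orbits from `C.U i` stay in `C.V i`, so Moser's argument runs inside one chart; the outer
-- derivatives of `L.map ε` are those of that chart and its inverse.
theorem LocalFlow.pullback_eq {C : GoodCover E M} {F : ChartFields C} (L : LocalFlow F)
    {Ω R : ℝ → DiffForm E M 2} {θ : ℝ → DiffForm E M 1} {d : ℕ}
    (hΩ : SmoothFamilyOn Ω univ) (hΩd : ∀ ε, (Ω ε).d = 0)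
    (hR : SmoothFamilyOn R univ) (hθ : SmoothFamilyOn θ univ) (hθR : ∀ ε, (θ ε).d = R ε)
    {ε : ℝ} (hε : ε ∈ Ioo (-L.ε₀) L.ε₀)
    (hF : ∀ i ∈ C.I, ∀ x ∈ C.W i, ∀ t ∈ Icc (0 : ℝ) 1, ∀ w,
      (moserPath Ω R d ε t).inChart (C.b i) (chartAt E (C.b i) x)
        ![ε • F.G i (chartAt E (C.b i) x, ε, t), w] =
      -(ε ^ (d + 1) • θ ε).inChart (C.b i) (chartAt E (C.b i) x) ![w]) :
    (Ω ε).pullback (L.map ε) = Ω ε - ε ^ (d + 1) • R ε := by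
  ext x : 1
  set i := C.index x with hi
  have hiI : i ∈ C.I := C.index_mem x
  have hx : x ∈ C.U i := C.mem_U_index x
  have hsrc := C.mem_source hx
  set c := chartAt E (C.b i) with hc
  have hRd : ∀ x, (R ε).d x = 0 := fun x ↦ by
    rw [← hθR]
    exact DiffForm.d_d isOpen_univ (hθ.slice ε) (mem_univ x)
  have hB : ∀ y ∈ chartSet E (C.b i) (C.V i), ∃ z ∈ c.source, z ∈ C.V i ∧ c z = y :=
    fun y hy ↦ exists_of_mem_chartSet hy
  have hVt : chartSet E (C.b i) (C.V i) ⊆ chartSet E (C.b i) univ :=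
    inter_subset_inter_right _ (preimage_mono (subset_univ _))
  have hpath : ∀ t, SmoothFormOn (moserPath Ω R d ε t) univ := fun t ↦
    (hΩ.slice ε).sub ((hR.slice ε).const_smul _)
  have hmoser := moser_pullback (φ := fun p : E × ℝ ↦ L.φ i (p.1, ε, p.2))
    (X := fun p ↦ ε • F.G i (p.1, ε, p.2)) (U := chartSet E (C.b i) (C.U i))
    (B := chartSet E (C.b i) (C.V i)) (I := Ioo (-2) 2)
    (σ := fun p ↦ (moserPath Ω R d ε p.2).inChart (C.b i) p.1)
    (θ := (ε ^ (d + 1) • θ ε).inChart (C.b i))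
    (isOpen_chartSet _ (C.isOpen_U i)) (isOpen_chartSet _ (C.isOpen_V i)) isOpen_Ioo
    (Icc_subset_Ioo (by norm_num) (by norm_num))
    ((L.smooth i hiI).comp (f := fun p : E × ℝ ↦ (p.1, ε, p.2)) (by fun_prop)
      fun p hp ↦ ⟨mem_univ _, hε, hp.2⟩)
    (fun y _ t ht ↦ L.deriv i hiI y ε hε t ht)
    (fun y _ ↦ L.init i hiI y ε hε)
    (fun y hy t ht ↦ by
      obtain ⟨z, hz, hzU, rfl⟩ := exists_of_mem_chartSet hy
      exact L.mem i hiI z hzU ε hε t ht)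
    (by
      have h1 : ContDiff ℝ ∞ fun p : E × ℝ ↦ ε • F.G i (p.1, ε, p.2) :=
        contDiff_const.smul ((F.smooth i).comp (by fun_prop))
      exact h1.differentiable (by simp))
    (by
      have h1 : ContDiffOn ℝ ∞ (fun p : E × ℝ ↦ (Ω ε).inChart (C.b i) p.1)
          (chartSet E (C.b i) (C.V i) ×ˢ univ) :=
        (hΩ.slice ε (C.b i)).comp (f := fun p : E × ℝ ↦ p.1) (by fun_prop) fun p hp ↦ hVt hp.1
      have h2 : ContDiffOn ℝ ∞ (fun p : E × ℝ ↦ (R ε).inChart (C.b i) p.1)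
          (chartSet E (C.b i) (C.V i) ×ˢ univ) :=
        (hR.slice ε (C.b i)).comp (f := fun p : E × ℝ ↦ p.1) (by fun_prop) fun p hp ↦ hVt hp.1
      have h3 : ContDiff ℝ ∞ fun p : E × ℝ ↦ (1 - p.2) * ε ^ (d + 1) := by fun_prop
      exact h1.sub (h3.contDiffOn.smul h2))
    (fun t y hy ↦ by
      obtain ⟨z, hz, -, rfl⟩ := hB y hy
      change extDeriv ((moserPath Ω R d ε t).inChart (C.b i)) _ = 0
      rw [← DiffForm.inChart_d isOpen_univ (hpath t) hz (mem_univ z), DiffForm.inChart_chart _ hz]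
      have h0 : (moserPath Ω R d ε t).d.val z = 0 := by
        change (moserPath Ω R d ε t).d z = 0
        rw [moserPath, DiffForm.d_sub isOpen_univ (hΩ.slice ε)
          ((hR.slice ε).const_smul _) (mem_univ z), DiffForm.d_smul, hΩd]
        change _ - ((1 - t) * ε ^ (d + 1)) • (R ε).d z = 0
        rw [hRd z, smul_zero]
        exact sub_zero _
      rw [h0]
      rfl)
    (((hθ.slice ε).const_smul _ (C.b i)).mono hVt)
    (fun t y hy ↦ by
      obtain ⟨z, hz, -, rfl⟩ := hB y hy
      have h1 : extDeriv ((ε ^ (d + 1) • θ ε).inChart (C.b i)) (c z) =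
          ε ^ (d + 1) • (R ε).inChart (C.b i) (c z) := by
        change extDeriv (ε ^ (d + 1) • (θ ε).inChart (C.b i)) (c z) = _
        rw [extDeriv_smul, ← DiffForm.inChart_d isOpen_univ (hθ.slice ε) hz (mem_univ z), hθR]
      rw [h1]
      have h2 : HasDerivAt (fun t : ℝ ↦ (1 - t) * ε ^ (d + 1)) (-1 * ε ^ (d + 1)) t :=
        ((hasDerivAt_id' t).const_sub 1).mul_const _
      have h3 := (h2.smul_const ((R ε).inChart (C.b i) (c z))).const_sub
        ((Ω ε).inChart (C.b i) (c z))
      refine h3.congr_deriv ?_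
      rw [neg_one_mul, neg_smul, neg_neg])
    (fun t ht y hy w ↦ by
      obtain ⟨z, hz, hzV, rfl⟩ := hB y hy
      exact hF i hiI z (C.V_subset_W_self i hzV) t ht w)
    (chart_mem_chartSet hsrc hx)
  simp only at hmoser
  have hmem := L.mem i hiI x hx ε hε 1 ⟨zero_le_one, le_rfl⟩
  have h1 : (moserPath Ω R d ε 1) = Ω ε := by simp [moserPath]
  have h0 : (moserPath Ω R d ε 0) = Ω ε - ε ^ (d + 1) • R ε := by simp [moserPath]
  rw [h1, h0] at hmoser
  have hval := (Ω ε - ε ^ (d + 1) • R ε).val_eq hsrc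
  rw [← hmoser] at hval
  change ((Ω ε).pullback (L.map ε)).val x = (Ω ε - ε ^ (d + 1) • R ε).val x
  rw [hval]
  have hpull : ((Ω ε).pullback (L.map ε)).val x =
      ((Ω ε).val (L.map ε x)).compContinuousLinearMap
        (mfderiv 𝓘(ℝ, E) 𝓘(ℝ, E) (L.map ε) x : E →L[ℝ] E) := rfl
  rw [hpull, L.mfderiv_map hiI hx hε, L.map_eq hiI hx hε,
    (Ω ε).inChart_eq (C.b i) (y := L.φ i (c x, ε, 1)) rfl]
  rfl

theorem exists_diffeomorph_pullback_eq [T2Space M] [CompactSpace M]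
    {Ω R : ℝ → DiffForm E M 2} {θ : ℝ → DiffForm E M 1} {j : ℝ → BivectorField E M} {d : ℕ}
    (hΩ : SmoothFamilyOn Ω univ) (hΩd : ∀ ε, (Ω ε).d = 0)
    (hR : SmoothFamilyOn R univ) (hθ : SmoothFamilyOn θ univ) (hθR : ∀ ε, (θ ε).d = R ε)
    (hj : IsSmoothBivectorFamily j)
    (hjΩ : ∀ ε : ℝ, ε ≠ 0 → IsPoissonBivectorOf ((ε ^ d)⁻¹ • j ε) (Ω ε)) :
    ∃ ε₀ : ℝ, 0 < ε₀ ∧ ∃ Ψ : ℝ → Diffeomorph 𝓘(ℝ, E) 𝓘(ℝ, E) M M ∞,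
      ContMDiffOn (𝓘(ℝ, E).prod 𝓘(ℝ, ℝ)) 𝓘(ℝ, E) ∞ (fun p : M × ℝ ↦ Ψ p.2 p.1)
        (univ ×ˢ Icc (-ε₀) ε₀) ∧
      ∀ ε ∈ Icc (-ε₀) ε₀, (Ω ε).pullback (Ψ ε) = Ω ε - ε ^ (d + 1) • R ε := by
  obtain ⟨C⟩ := exists_goodCover (E := E) (M := M)
  obtain ⟨F, hF⟩ := exists_chartFields C hR hθ hj hjΩ
  obtain ⟨L⟩ := exists_localFlow F
  obtain ⟨L'⟩ := exists_localFlow F.reverse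
  have hmin : 0 < min L.ε₀ L'.ε₀ := lt_min L.pos L'.pos
  -- Halving places the closed interval inside both open intervals on which the flow and its
  -- reversal exist.
  set ε₀ := min L.ε₀ L'.ε₀ / 2 with hε₀
  have hI : ∀ ε ∈ Icc (-ε₀) ε₀, ε ∈ Ioo (-L.ε₀) L.ε₀ ∧ ε ∈ Ioo (-L'.ε₀) L'.ε₀ := by
    intro ε hε
    have h1 := min_le_left L.ε₀ L'.ε₀
    have h2 := min_le_right L.ε₀ L'.ε₀
    refine ⟨⟨?_, ?_⟩, ?_, ?_⟩ <;> linarith [hε.1, hε.2]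
  obtain ⟨Ψ, hΨ⟩ := exists_diffeomorph_family (E := E) (f := L.map) (g := L'.map)
    (I := Icc (-ε₀) ε₀)
    (fun ε hε ↦ L.contMDiff_map (hI ε hε).1) (fun ε hε ↦ L'.contMDiff_map (hI ε hε).2)
    (fun ε hε x ↦ L.map_map L' (fun _ _ ↦ rfl) (hI ε hε).1 (hI ε hε).2 x)
    (fun ε hε x ↦ L'.map_map L (fun i p ↦ by simp [ChartFields.reverse])
      (hI ε hε).2 (hI ε hε).1 x)
  refine ⟨ε₀, half_pos hmin, Ψ, ?_, fun ε hε ↦ ?_⟩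
  · refine (L.contMDiffOn_map.mono (prod_mono subset_rfl fun ε hε ↦ (hI ε hε).1)).congr ?_
    rintro ⟨x, ε⟩ ⟨-, hε⟩
    exact congrFun (hΨ ε hε) x
  · rw [hΨ ε hε]
    have hεL := (hI ε hε).1
    exact L.pullback_eq hΩ hΩd hR hθ hθR hεL fun i hi x hx ↦
      hF i hi x hx ε ⟨by linarith [hεL.1, L.le], by linarith [hεL.2, L.le]⟩

end Darboux

end

end BarelySymplectic

theorem mainTheorem5 {E : Type*} [NormedAddCommGroup E] [NormedSpace ℝ E] [FiniteDimensional ℝ E]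
    {M : Type*} [TopologicalSpace M] [ChartedSpace E M] [IsManifold 𝓘(ℝ, E) ∞ M]
    [T2Space M] [CompactSpace M]
    (Ω : ℝ → DiffForm E M 2) (d : ℕ)
    (hΩ : IsBarelySymplectic Ω) (hd : IsRegularWithIndex Ω d)
    (hcoh : ∀ ε : ℝ, (Ω ε).SameDeRhamClass (Ω 0)) :
    ∃ ε₀ : ℝ, 0 < ε₀ ∧
      ∃ Ψ : ℝ → Diffeomorph 𝓘(ℝ, E) 𝓘(ℝ, E) M M ∞,
        ContMDiffOn (𝓘(ℝ, E).prod 𝓘(ℝ, ℝ)) 𝓘(ℝ, E) ∞ (fun p : M × ℝ ↦ Ψ p.2 p.1)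
          (Set.univ ×ˢ Set.Icc (-ε₀) ε₀) ∧
        ∀ ε ∈ Set.Icc (-ε₀) ε₀, (Ω ε).pullback (Ψ ε) = truncation Ω d ε := by
  have hs := smoothFamilyOn_univ.2 hΩ.smooth
  have hs' : SmoothFamilyOn (fun ε ↦ Ω ε - Ω 0) Set.univ := hs.sub (hs.slice 0).family
  obtain ⟨α, hα, hαd⟩ := exists_smooth_family_primitive hs' (fun ε ↦ by
      ext x : 1
      rw [DiffForm.d_sub isOpen_univ (hs.slice ε) (hs.slice 0) (Set.mem_univ x), hΩ.closed,
        hΩ.closed]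
      exact sub_zero _) (fun ε ↦ by
      obtain ⟨β, hβ, hβd⟩ := hcoh ε
      exact ⟨β, hβ, hβd.symm⟩)
  obtain ⟨j, hj, hjΩ⟩ := hd.1
  -- The remainder of order `d + 1` is the iterated quotient of `Ω`, and its primitive is the same
  -- iterated quotient of `α`.
  obtain ⟨ε₀, hε₀, Ψ, hΨ, hΨΩ⟩ := exists_diffeomorph_pullback_eq hs hΩ.closed
    (hs.quot_iterate (d + 1)) (hα.quot_iterate (d + 1)) (d_quot_iterate hα hs hαd d) hj hjΩ
  refine ⟨ε₀, hε₀, Ψ, hΨ, fun ε hε ↦ ?_⟩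
  rw [hΨΩ ε hε, sub_eq_iff_eq_add]
  exact eq_truncation_add hs d ε
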